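/- Let $K$ be a compact metrizable space with finite covering dimension, and let $(\mathcal M,K,E)$ be a $W^*$-bundle over $K$: $\mathcal M$ is a unital $C^*$-algebra with a given unital inclusion of $C(K)$ into its center and a faithful conditional expectation $E\colon\mathcal M\to C(K)$ with $E(ab)=E(ba)$ for all $a,b\in\mathcal M$, such that the norm-closed unit ball of $\mathcal M$ is complete in the uniform $2$-norm $\|a\|_{2,u}=\|E(a^*a)\|^{1/2}$. Assume that $\mathcal M$ is strictly separable, that is, it contains a countable $\|\cdot\|_{2,u}$-dense subset. Let $G$ be a countable discrete group and let $\gamma\colon G\to\mathrm{Aut}(\mathcal M)$ be a fiber-wise action, that is, an action with $\gamma_g\circ E=E=E\circ\gamma_g$ for all $g\in G$. Let $d\geq 2$, let $\nu\colon G\to\mathcal U(M_d)$ be a unitary representation, and let $\delta^\nu=\bigotimes_{n=1}^\infty\mathrm{Ad}(\nu)$ be the induced product type action of $G$ on the hyperfinite II$_1$ factor $\mathcal R$, realized as the weak closure of $\bigotimes_{n\in\mathbb N}M_d$ in the GNS representation of its unique trace $\tau_{\mathcal R}$. For $\lambda\in K$, let $\tau_\lambda=\mathrm{ev}_\lambda\circ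 E$, let $\pi_\lambda$ be the GNS representation of $\mathcal M$ associated with $\tau_\lambda$, let $\mathcal M_\lambda=\pi_\lambda(\mathcal M)$ be the fiber, viewed as a $W^*$-bundle over the one-point space via the trace induced by $\tau_\lambda$, and let $\gamma^\lambda$ be the action on $\mathcal M_\lambda$ with $\gamma^\lambda_g\circ\pi_\lambda=\pi_\lambda\circ\gamma_g$. For a $W^*$-bundle $(\mathcal N,E_{\mathcal N})$ with a fiber-wise action $\beta$ of $G$, let $\mathcal N\overline\otimes\mathcal R$ be the strict completion of $\mathcal N\otimes\mathcal R$ with respect to $E_{\mathcal N}\otimes\tau_{\mathcal R}$, that is, the algebra of norm-bounded sequences that are Cauchy in the associated uniform $2$-norm modulo those converging to zero in it, with the induced expectation and the induced action $\beta\otimes\delta^\nu$. Say that $(\mathcal N,\beta)$ is $\delta^\nu$-McDuff if it is cocycle conjugate to $(\mathcal N\overline\otimes\mathcal R,\beta\otimes\delta^\nu)$: there are unitaries $u_g\in\mathcal N$ with $u_{gh}=u_g\beta_g(u_h)$ for all $g,h\in G$, and a $*$-isomorphism $\varphi\colon\mathcal N\to\mathcal N\overline\otimes\mathcal R$ with $E_{\mathcal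 N\overline\otimes\mathcal R}\circ\varphi=E_{\mathcal N}$ and $(\beta\otimes\delta^\nu)_g\circ\varphi=\varphi\circ\mathrm{Ad}(u_g)\circ\beta_g$ for all $g\in G$. Then the following are equivalent: 1. $(\mathcal M,\gamma)$ is $\delta^\nu$-McDuff; 2. for every $\lambda\in K$, the fiber $(\mathcal M_\lambda,\gamma^\lambda)$ is $\delta^\nu$-McDuff. -/

import Mathlib

open scoped ComplexOrder Kronecker TensorProduct Topology
open Filter

namespace EquivariantBundle

set_option linter.unusedSectionVars false

noncomputable section

/-! ### Tracial `C(K)`-valued expectations and the uniform 2-norm -/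

/-- A positive tracial `C(K)`-valued linear map on a unital `*`-algebra `A`. For `k : K`, the
functional `a ↦ E a k` is a (not necessarily faithful) positive trace on `A`. -/
structure TracialExpectation (K A : Type*) [TopologicalSpace K] [Ring A] [StarRing A]
    [Algebra ℂ A] where
  E : A →ₗ[ℂ] C(K, ℂ)
  nonneg : ∀ (a : A) (k : K), 0 ≤ E (star a * a) k
  tracial : ∀ a b : A, E (a * b) = E (b * a)

/-- A positive tracial functional, as an expectation over the one-point space. -/
def TracialExpectation.ofTrace {A : Type*} [Ring A] [StarRing A] [Algebra ℂ A] (t : A →ₗ[ℂ] ℂ)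
    (nonneg : ∀ a, 0 ≤ t (star a * a)) (tracial : ∀ a b, t (a * b) = t (b * a)) :
    TracialExpectation Unit A where
  E :=
    { toFun := fun a => ContinuousMap.const Unit (t a)
      map_add' := fun a b => ContinuousMap.ext fun _ => map_add t a b
      map_smul' := fun c a => ContinuousMap.ext fun _ => map_smul t c a }
  nonneg a _ := nonneg a
  tracial a b := ContinuousMap.ext fun _ => tracial a b

section Tracial

variable {K A : Type*} [TopologicalSpace K] [Ring A] [StarRing A] [Algebra ℂ A] [StarModule ℂ A]

theorem TracialExpectation.conj_symm (T : TracialExpectation K A) (k : K) (a b : A) :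
    (starRingEnd ℂ) (T.E (star b * a) k) = T.E (star a * b) k := by
  have ha := (Complex.nonneg_iff.1 (T.nonneg a k)).2
  have hb := (Complex.nonneg_iff.1 (T.nonneg b k)).2
  have h1 := (Complex.nonneg_iff.1 (T.nonneg (a + b) k)).2
  have h2 := (Complex.nonneg_iff.1 (T.nonneg (a + Complex.I • b) k)).2
  simp only [star_add, star_smul, add_mul, mul_add, map_add, ContinuousMap.add_apply,
    smul_mul_assoc, mul_smul_comm, map_smul, ContinuousMap.smul_apply, smul_eq_mul,
    Complex.add_im, Complex.mul_im, Complex.star_def, Complex.conj_I, Complex.I_re,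
    Complex.I_im, Complex.neg_re, Complex.neg_im, Complex.mul_re] at h1 h2 ha hb
  apply Complex.ext
  · simp only [Complex.conj_re]; linarith
  · simp only [Complex.conj_im]; linarith

/-- The semi-inner product `⟨a, b⟩ = E(a* b)(k)`. -/
abbrev TracialExpectation.core (T : TracialExpectation K A) (k : K) :
    PreInnerProductSpace.Core ℂ A where
  inner a b := T.E (star a * b) k
  conj_inner_symm a b := T.conj_symm k a b
  re_inner_nonneg a := (Complex.nonneg_iff.1 (T.nonneg a k)).1
  add_left a b c := by simp [add_mul]
  smul_left a b r := by simp

/-- The 2-seminorm `‖a‖_{2,k} = (E(a* a)(k))^{1/2}`. -/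
def TracialExpectation.norm2 (T : TracialExpectation K A) (k : K) (a : A) : ℝ :=
  Real.sqrt (T.E (star a * a) k).re

theorem TracialExpectation.norm2_add_le (T : TracialExpectation K A) (k : K) (a b : A) :
    T.norm2 k (a + b) ≤ T.norm2 k a + T.norm2 k b := by
  let _ := InnerProductSpace.Core.toSeminormedAddCommGroup (𝕜 := ℂ) (F := A) (c := T.core k)
  exact norm_add_le a b

theorem TracialExpectation.norm_apply_le (T : TracialExpectation K A) (k : K) (a : A) :
    ‖T.E a k‖ ≤ T.norm2 k 1 * T.norm2 k a := by
  have h := @InnerProductSpace.Core.norm_inner_le_norm ℂ A _ _ _ (T.core k) 1 a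
  have e : T.E (star 1 * a) k = T.E a k := by simp
  rw [← e]
  exact h

variable [CompactSpace K]

/-- The uniform 2-norm `‖a‖_{2,u} = ‖E(a* a)‖^{1/2}`. -/
def TracialExpectation.norm2u (T : TracialExpectation K A) (a : A) : ℝ :=
  Real.sqrt ‖T.E (star a * a)‖

theorem TracialExpectation.norm2u_nonneg (T : TracialExpectation K A) (a : A) :
    0 ≤ T.norm2u a := Real.sqrt_nonneg _

theorem TracialExpectation.norm2_le (T : TracialExpectation K A) (k : K) (a : A) :
    T.norm2 k a ≤ T.norm2u a :=
  Real.sqrt_le_sqrt (((Complex.re_le_norm _).trans ((T.E (star a * a)).norm_coe_le_norm k)))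

theorem TracialExpectation.norm2u_le_iff (T : TracialExpectation K A) (a : A) {C : ℝ}
    (hC : 0 ≤ C) : T.norm2u a ≤ C ↔ ∀ k, T.norm2 k a ≤ C := by
  refine ⟨fun h k => (T.norm2_le k a).trans h, fun h => ?_⟩
  refine Real.sqrt_le_iff.2 ⟨hC, (ContinuousMap.norm_le _ (by positivity)).2 fun k => ?_⟩
  have h0 := Complex.nonneg_iff.1 (T.nonneg a k)
  have e : T.E (star a * a) k = (((T.E (star a * a) k).re : ℝ) : ℂ) :=
    Complex.ext (by simp) (by simp [← h0.2])
  rw [e, Complex.norm_real, Real.norm_of_nonneg h0.1]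
  exact (Real.sqrt_le_iff.1 (h k)).2

theorem TracialExpectation.norm2u_add_le (T : TracialExpectation K A) (a b : A) :
    T.norm2u (a + b) ≤ T.norm2u a + T.norm2u b :=
  (T.norm2u_le_iff _ (add_nonneg (T.norm2u_nonneg a) (T.norm2u_nonneg b))).2 fun k =>
    (T.norm2_add_le k a b).trans (add_le_add (T.norm2_le k a) (T.norm2_le k b))

theorem TracialExpectation.norm2u_star (T : TracialExpectation K A) (a : A) :
    T.norm2u (star a) = T.norm2u a := by
  simp only [norm2u, star_star, T.tracial a (star a)]

theorem TracialExpectation.norm2u_smul (T : TracialExpectation K A) (c : ℂ) (a : A) :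
    T.norm2u (c • a) = ‖c‖ * T.norm2u a := by
  have : T.E (star (c • a) * (c • a)) = (star c * c) • T.E (star a * a) := by
    rw [star_smul, smul_mul_smul_comm, map_smul]
  rw [norm2u, this, norm_smul, norm_mul, norm_star, Real.sqrt_mul (by positivity),
    Real.sqrt_mul_self (norm_nonneg _)]
  rfl

theorem TracialExpectation.norm2u_neg (T : TracialExpectation K A) (a : A) :
    T.norm2u (-a) = T.norm2u a := by
  simp [norm2u]

theorem TracialExpectation.norm2u_sub_comm (T : TracialExpectation K A) (a b : A) :
    T.norm2u (a - b) = T.norm2u (b - a) := by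
  rw [← T.norm2u_neg, neg_sub]

theorem TracialExpectation.norm_E_le (T : TracialExpectation K A) (a : A) :
    ‖T.E a‖ ≤ T.norm2u 1 * T.norm2u a := by
  refine (ContinuousMap.norm_le _ (mul_nonneg (T.norm2u_nonneg _) (T.norm2u_nonneg _))).2
    fun k => (T.norm_apply_le k a).trans ?_
  exact mul_le_mul (T.norm2_le k 1) (T.norm2_le k a) (Real.sqrt_nonneg _) (T.norm2u_nonneg _)

/-! ### Strict completion

`A` acts by left multiplication on the Hilbert `C(K)`-module `L²(A, E)`, the completion of `A` in
the uniform 2-norm. The strict completion consists of the sequences in `A` that are bounded for the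
resulting operator norm and Cauchy for the uniform 2-norm, modulo those that converge to zero in the
uniform 2-norm. -/

/-- Left multiplication by `a` on `L²(A, E)` has operator norm at most `C`. -/
def TracialExpectation.OpNormLE (T : TracialExpectation K A) (C : ℝ) (a : A) : Prop :=
  ∀ b : A, T.norm2u (a * b) ≤ C * T.norm2u b

/-- Sequences bounded in operator norm (together with their adjoints). -/
def TracialExpectation.BddSeq (T : TracialExpectation K A) (x : ℕ → A) : Prop :=
  ∃ C : ℝ, 0 ≤ C ∧ ∀ n, T.OpNormLE C (x n) ∧ T.OpNormLE C (star (x n))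

/-- Cauchy sequences for the uniform 2-norm. -/
def TracialExpectation.CauchySeq2 (T : TracialExpectation K A) (x : ℕ → A) : Prop :=
  ∀ ε > 0, ∃ N, ∀ m ≥ N, ∀ n ≥ N, T.norm2u (x m - x n) < ε

/-- Sequences converging to zero for the uniform 2-norm. -/
def TracialExpectation.NullSeq (T : TracialExpectation K A) (x : ℕ → A) : Prop :=
  Tendsto (fun n => T.norm2u (x n)) atTop (𝓝 0)

theorem TracialExpectation.OpNormLE.right {T : TracialExpectation K A} {C : ℝ} {a : A}
    (h : T.OpNormLE C (star a)) (b : A) : T.norm2u (b * a) ≤ C * T.norm2u b := by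
  have := h (star b)
  rwa [← star_mul, T.norm2u_star, T.norm2u_star] at this

theorem TracialExpectation.OpNormLE.mul {T : TracialExpectation K A} {C D : ℝ} {a b : A}
    (hC : 0 ≤ C) (ha : T.OpNormLE C a) (hb : T.OpNormLE D b) : T.OpNormLE (C * D) (a * b) := by
  intro c
  rw [mul_assoc, mul_assoc]
  exact (ha _).trans (mul_le_mul_of_nonneg_left (hb c) hC)

theorem TracialExpectation.OpNormLE.add {T : TracialExpectation K A} {C D : ℝ} {a b : A}
    (ha : T.OpNormLE C a) (hb : T.OpNormLE D b) : T.OpNormLE (C + D) (a + b) := by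
  intro c
  rw [add_mul, add_mul]
  exact (T.norm2u_add_le _ _).trans (add_le_add (ha c) (hb c))

theorem TracialExpectation.opNormLE_algebraMap (T : TracialExpectation K A) (c : ℂ) :
    T.OpNormLE ‖c‖ (algebraMap ℂ A c) := by
  intro b
  rw [← Algebra.smul_def, T.norm2u_smul]

/-- The `*`-algebra of bounded `‖·‖_{2,u}`-Cauchy sequences. -/
def TracialExpectation.bddCauchy (T : TracialExpectation K A) : StarSubalgebra ℂ (ℕ → A) where
  carrier := {x | T.BddSeq x ∧ T.CauchySeq2 x}
  mul_mem' := by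
    rintro x y ⟨⟨C, hC, hx⟩, hx'⟩ ⟨⟨D, hD, hy⟩, hy'⟩
    refine ⟨⟨C * D, mul_nonneg hC hD, fun n => ⟨(hx n).1.mul hC (hy n).1, ?_⟩⟩, ?_⟩
    · rw [Pi.mul_apply, star_mul, mul_comm C D]
      exact (hy n).2.mul hD (hx n).2
    · intro ε hε
      obtain ⟨N, hN⟩ := hx' (ε / (2 * (D + 1))) (by positivity)
      obtain ⟨N', hN'⟩ := hy' (ε / (2 * (C + 1))) (by positivity)
      refine ⟨max N N', fun m hm n hn => ?_⟩
      have e : (x * y) m - (x * y) n = x m * (y m - y n) + (x m - x n) * y n := by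
        simp only [Pi.mul_apply]; noncomm_ring
      rw [e]
      have h1 := (hx m).1 (y m - y n)
      have h2 := (hy n).2.right (x m - x n)
      have h3 := hN m (le_trans (le_max_left _ _) hm) n (le_trans (le_max_left _ _) hn)
      have h4 := hN' m (le_trans (le_max_right _ _) hm) n (le_trans (le_max_right _ _) hn)
      have h5 : C * T.norm2u (y m - y n) ≤ (C + 1) * T.norm2u (y m - y n) := by
        nlinarith [T.norm2u_nonneg (y m - y n)]
      have h6 : D * T.norm2u (x m - x n) ≤ (D + 1) * T.norm2u (x m - x n) := by
        nlinarith [T.norm2u_nonneg (x m - x n)]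
      have h7 : (C + 1) * T.norm2u (y m - y n) < ε / 2 := by
        calc _ < (C + 1) * (ε / (2 * (C + 1))) := by gcongr
          _ = ε / 2 := by field_simp
      have h8 : (D + 1) * T.norm2u (x m - x n) < ε / 2 := by
        calc _ < (D + 1) * (ε / (2 * (D + 1))) := by gcongr
          _ = ε / 2 := by field_simp
      linarith [T.norm2u_add_le (x m * (y m - y n)) ((x m - x n) * y n)]
  add_mem' := by
    rintro x y ⟨⟨C, hC, hx⟩, hx'⟩ ⟨⟨D, hD, hy⟩, hy'⟩
    refine ⟨⟨C + D, add_nonneg hC hD, fun n => ⟨(hx n).1.add (hy n).1, ?_⟩⟩, ?_⟩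
    · rw [Pi.add_apply, star_add]
      exact (hx n).2.add (hy n).2
    · intro ε hε
      obtain ⟨N, hN⟩ := hx' (ε / 2) (by positivity)
      obtain ⟨N', hN'⟩ := hy' (ε / 2) (by positivity)
      refine ⟨max N N', fun m hm n hn => ?_⟩
      have e : (x + y) m - (x + y) n = (x m - x n) + (y m - y n) := by
        simp only [Pi.add_apply]; abel
      rw [e]
      have h3 := hN m (le_trans (le_max_left _ _) hm) n (le_trans (le_max_left _ _) hn)
      have h4 := hN' m (le_trans (le_max_right _ _) hm) n (le_trans (le_max_right _ _) hn)
      linarith [T.norm2u_add_le (x m - x n) (y m - y n)]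
  algebraMap_mem' c := by
    refine ⟨⟨‖c‖, norm_nonneg _, fun n => ⟨T.opNormLE_algebraMap c, ?_⟩⟩, fun ε hε => ⟨0, ?_⟩⟩
    · have h := T.opNormLE_algebraMap (star c)
      rw [norm_star, algebraMap_star_comm] at h
      exact h
    · intro m _ n _
      simpa [TracialExpectation.norm2u] using hε
  star_mem' := by
    rintro x ⟨⟨C, hC, hx⟩, hx'⟩
    refine ⟨⟨C, hC, fun n => ⟨(hx n).2, ?_⟩⟩, fun ε hε => ?_⟩
    · rw [Pi.star_apply, star_star]; exact (hx n).1
    · obtain ⟨N, hN⟩ := hx' ε hε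
      refine ⟨N, fun m hm n hn => ?_⟩
      rw [Pi.star_apply, Pi.star_apply, ← star_sub, T.norm2u_star]
      exact hN m hm n hn

theorem TracialExpectation.NullSeq.add {T : TracialExpectation K A} {x y : ℕ → A}
    (hx : T.NullSeq x) (hy : T.NullSeq y) : T.NullSeq (x + y) := by
  have h := Tendsto.add hx hy
  rw [add_zero] at h
  exact squeeze_zero (fun n => T.norm2u_nonneg _) (fun n => T.norm2u_add_le _ _) h

theorem TracialExpectation.NullSeq.mul_left {T : TracialExpectation K A} {x y : ℕ → A}
    (hx : T.NullSeq x) (hy : T.BddSeq y) : T.NullSeq (y * x) := by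
  obtain ⟨C, hC, h⟩ := hy
  have h' := Tendsto.const_mul C hx
  rw [mul_zero] at h'
  exact squeeze_zero (fun n => T.norm2u_nonneg _) (fun n => (h n).1 _) h'

theorem TracialExpectation.NullSeq.mul_right {T : TracialExpectation K A} {x y : ℕ → A}
    (hx : T.NullSeq x) (hy : T.BddSeq y) : T.NullSeq (x * y) := by
  obtain ⟨C, hC, h⟩ := hy
  have h' := Tendsto.const_mul C hx
  rw [mul_zero] at h'
  exact squeeze_zero (fun n => T.norm2u_nonneg _) (fun n => (h n).2.right _) h'

/-- Two bounded Cauchy sequences are identified if their difference is `‖·‖_{2,u}`-null. -/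
def TracialExpectation.nullCon (T : TracialExpectation K A) : RingCon T.bddCauchy where
  r x y := T.NullSeq ((x : ℕ → A) - (y : ℕ → A))
  iseqv :=
    { refl := fun x => by simp [TracialExpectation.NullSeq, TracialExpectation.norm2u]
      symm := fun {x y} h => by
        have : (fun n => T.norm2u (((y : ℕ → A) - (x : ℕ → A)) n))
            = fun n => T.norm2u (((x : ℕ → A) - (y : ℕ → A)) n) :=
          funext fun n => T.norm2u_sub_comm _ _
        rw [TracialExpectation.NullSeq, this]
        exact h
      trans := fun {x y z} h h' => by
        have := h.add h'
        rwa [sub_add_sub_cancel] at this }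
  add' := fun {w x y z} h h' => by
    have := h.add h'
    rwa [sub_add_sub_comm] at this
  mul' := fun {w x y z} h h' => by
    have h1 := h'.mul_left w.2.1
    have h2 := h.mul_right z.2.1
    have := h1.add h2
    rwa [show (w : ℕ → A) * ((y : ℕ → A) - z) + ((w : ℕ → A) - x) * z
      = ((w * y : T.bddCauchy) : ℕ → A) - ((x * z : T.bddCauchy) : ℕ → A) by
        push_cast; noncomm_ring] at this

/-- The strict completion of `A` with respect to `E`. -/
abbrev TracialExpectation.Completion (T : TracialExpectation K A) : Type _ := T.nullCon.Quotient

instance (T : TracialExpectation K A) : StarRing T.Completion where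
  star := Quotient.map' star (fun x y (h : T.NullSeq _) => by
    show T.NullSeq _
    have : (fun n => T.norm2u (((star x : T.bddCauchy) : ℕ → A) n
        - ((star y : T.bddCauchy) : ℕ → A) n))
        = fun n => T.norm2u ((x : ℕ → A) n - (y : ℕ → A) n) := by
      funext n
      rw [← T.norm2u_star ((x : ℕ → A) n - (y : ℕ → A) n), star_sub]
      rfl
    exact (congrArg (fun f => Tendsto f atTop (𝓝 0)) this).mpr h)
  star_involutive := by
    rintro ⟨x⟩
    exact congrArg (Quotient.mk'' : T.bddCauchy → T.Completion) (star_star x)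
  star_mul := by
    rintro ⟨x⟩ ⟨y⟩
    exact congrArg (Quotient.mk'' : T.bddCauchy → T.Completion) (star_mul x y)
  star_add := by
    rintro ⟨x⟩ ⟨y⟩
    exact congrArg (Quotient.mk'' : T.bddCauchy → T.Completion) (star_add x y)

instance (T : TracialExpectation K A) : StarModule ℂ T.Completion where
  star_smul := by
    rintro c ⟨x⟩
    exact congrArg (Quotient.mk'' : T.bddCauchy → T.Completion) (star_smul c x)

theorem TracialExpectation.cauchySeq_E (T : TracialExpectation K A) (x : T.bddCauchy) :
    CauchySeq (fun n => T.E ((x : ℕ → A) n)) := by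
  rw [Metric.cauchySeq_iff]
  intro ε hε
  have h0 := T.norm2u_nonneg (1 : A)
  obtain ⟨N, hN⟩ := x.2.2 (ε / (T.norm2u 1 + 1)) (by positivity)
  refine ⟨N, fun m hm n hn => ?_⟩
  rw [dist_eq_norm, ← map_sub]
  calc _ ≤ T.norm2u 1 * T.norm2u ((x : ℕ → A) m - (x : ℕ → A) n) := T.norm_E_le _
    _ ≤ (T.norm2u 1 + 1) * T.norm2u ((x : ℕ → A) m - (x : ℕ → A) n) := by
        nlinarith [T.norm2u_nonneg ((x : ℕ → A) m - (x : ℕ → A) n)]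
    _ < (T.norm2u 1 + 1) * (ε / (T.norm2u 1 + 1)) := by
        gcongr; exact hN m hm n hn
    _ = ε := by field_simp

/-- `lim E(x_n)` for a bounded Cauchy sequence. -/
def TracialExpectation.limE (T : TracialExpectation K A) (x : T.bddCauchy) : C(K, ℂ) :=
  limUnder atTop (fun n => T.E ((x : ℕ → A) n))

theorem TracialExpectation.tendsto_limE (T : TracialExpectation K A) (x : T.bddCauchy) :
    Tendsto (fun n => T.E ((x : ℕ → A) n)) atTop (𝓝 (T.limE x)) :=
  (T.cauchySeq_E x).tendsto_limUnder

theorem TracialExpectation.limE_congr (T : TracialExpectation K A) (x y : T.bddCauchy)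
    (h : T.NullSeq ((x : ℕ → A) - (y : ℕ → A))) : T.limE x = T.limE y := by
  have h1 := (T.tendsto_limE x).sub (T.tendsto_limE y)
  have h2 : Tendsto (fun n => T.E ((x : ℕ → A) n) - T.E ((y : ℕ → A) n)) atTop (𝓝 0) := by
    have h' := Tendsto.const_mul (T.norm2u 1) h
    rw [mul_zero] at h'
    refine squeeze_zero_norm (fun n => ?_) h'
    rw [← map_sub]
    exact T.norm_E_le _
  exact sub_eq_zero.1 (tendsto_nhds_unique h1 h2)

/-- The expectation on the strict completion, `E([x]) = lim E(x_n)`. -/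
def TracialExpectation.completion (T : TracialExpectation K A) :
    TracialExpectation K T.Completion where
  E :=
    { toFun := fun q => Quotient.liftOn' q T.limE T.limE_congr
      map_add' := by
        rintro ⟨x⟩ ⟨y⟩
        refine tendsto_nhds_unique (T.tendsto_limE (x + y)) ?_
        have h := (T.tendsto_limE x).add (T.tendsto_limE y)
        simp_rw [← map_add] at h
        exact h
      map_smul' := by
        rintro c ⟨x⟩
        refine tendsto_nhds_unique (T.tendsto_limE (c • x)) ?_
        have h := (T.tendsto_limE x).const_smul c
        simp_rw [← map_smul] at h
        exact h }
  nonneg := by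
    rintro ⟨x⟩ k
    have h := ((continuous_eval_const (F := C(K, ℂ)) k).tendsto _).comp
      (T.tendsto_limE (star x * x))
    exact ge_of_tendsto' h fun n => T.nonneg _ k
  tracial := by
    rintro ⟨x⟩ ⟨y⟩
    refine tendsto_nhds_unique (T.tendsto_limE (x * y)) ?_
    have h := T.tendsto_limE (y * x)
    have e : (fun n => T.E (((x * y : T.bddCauchy) : ℕ → A) n))
        = fun n => T.E (((y * x : T.bddCauchy) : ℕ → A) n) :=
      funext fun n => T.tracial _ _
    rw [e]
    exact h

/-! ### Actions, conjugacy and cocycle conjugacy -/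

/-- An action of `G` on `A` by `*`-automorphisms that preserve `E`. -/
structure TracialAction (G : Type*) [Group G] (T : TracialExpectation K A) where
  act : G →* (A ≃⋆ₐ[ℂ] A)
  E_act : ∀ g a, T.E (act g a) = T.E a

/-- Cocycle conjugacy: there are a `γ`-cocycle `u` and a `*`-isomorphism `φ` that intertwines the
expectations and conjugates `Ad(u_g) ∘ γ_g` to `β_g`. -/
def CocycleConjugate {B G : Type*} [Ring B] [StarRing B] [Algebra ℂ B] [Group G]
    {T : TracialExpectation K A} {S : TracialExpectation K B}
    (γ : TracialAction G T) (β : TracialAction G S) : Prop :=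
  ∃ u : G → unitary A, (∀ g h, (u (g * h) : A) = u g * γ.act g (u h)) ∧
    ∃ φ : A ≃⋆ₐ[ℂ] B, (∀ a, S.E (φ a) = T.E a) ∧
      ∀ g a, β.act g (φ a) = φ (u g * γ.act g a * star (u g : A))

section CompletionAction

variable {T : TracialExpectation K A}

theorem norm2u_map (φ : A ≃⋆ₐ[ℂ] A) (hφ : ∀ a, T.E (φ a) = T.E a) (a : A) :
    T.norm2u (φ a) = T.norm2u a := by
  rw [TracialExpectation.norm2u, ← map_star, ← map_mul, hφ]
  rfl

theorem opNormLE_map (φ : A ≃⋆ₐ[ℂ] A) (hφ : ∀ a, T.E (φ a) = T.E a) {C : ℝ} {a : A}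
    (h : T.OpNormLE C a) : T.OpNormLE C (φ a) := by
  intro b
  obtain ⟨c, rfl⟩ : ∃ c, φ c = b := ⟨φ.symm b, φ.apply_symm_apply b⟩
  rw [← map_mul, norm2u_map φ hφ, norm2u_map φ hφ]
  exact h c

/-- The pointwise application of an `E`-preserving automorphism to bounded Cauchy sequences. -/
def bddCauchyMap (φ : A ≃⋆ₐ[ℂ] A) (hφ : ∀ a, T.E (φ a) = T.E a) (x : T.bddCauchy) :
    T.bddCauchy :=
  ⟨fun n => φ ((x : ℕ → A) n), by
    obtain ⟨⟨C, hC, h⟩, h'⟩ := x.2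
    refine ⟨⟨C, hC, fun n => ⟨opNormLE_map φ hφ (h n).1, ?_⟩⟩, fun ε hε => ?_⟩
    · rw [← map_star]
      exact opNormLE_map φ hφ (h n).2
    · obtain ⟨N, hN⟩ := h' ε hε
      refine ⟨N, fun m hm n hn => ?_⟩
      rw [← map_sub, norm2u_map φ hφ]
      exact hN m hm n hn⟩

/-- The map induced on the strict completion by an `E`-preserving automorphism. -/
def completionMap (φ : A ≃⋆ₐ[ℂ] A) (hφ : ∀ a, T.E (φ a) = T.E a) :
    T.Completion → T.Completion :=
  Quotient.map' (bddCauchyMap φ hφ) fun x y (h : T.NullSeq _) => by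
    show T.NullSeq _
    have : (fun n => T.norm2u (φ ((x : ℕ → A) n) - φ ((y : ℕ → A) n)))
        = fun n => T.norm2u ((x : ℕ → A) n - (y : ℕ → A) n) := by
      funext n
      rw [← map_sub, norm2u_map φ hφ]
    exact (congrArg (fun f => Tendsto f atTop (𝓝 0)) this).mpr h

/-- `completionMap` as a `*`-automorphism. -/
def completionEquiv (φ : A ≃⋆ₐ[ℂ] A) (hφ : ∀ a, T.E (φ a) = T.E a) :
    T.Completion ≃⋆ₐ[ℂ] T.Completion where
  toFun := completionMap φ hφ
  invFun := completionMap φ.symm fun a => by rw [← hφ, φ.apply_symm_apply]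
  left_inv := by
    rintro ⟨x⟩
    exact congrArg (Quotient.mk'' : T.bddCauchy → T.Completion)
      (Subtype.ext (funext fun n => φ.symm_apply_apply _))
  right_inv := by
    rintro ⟨x⟩
    exact congrArg (Quotient.mk'' : T.bddCauchy → T.Completion)
      (Subtype.ext (funext fun n => φ.apply_symm_apply _))
  map_mul' := by
    rintro ⟨x⟩ ⟨y⟩
    exact congrArg (Quotient.mk'' : T.bddCauchy → T.Completion)
      (Subtype.ext (funext fun n => map_mul φ _ _))
  map_add' := by
    rintro ⟨x⟩ ⟨y⟩
    exact congrArg (Quotient.mk'' : T.bddCauchy → T.Completion)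
      (Subtype.ext (funext fun n => map_add φ _ _))
  map_star' := by
    rintro ⟨x⟩
    exact congrArg (Quotient.mk'' : T.bddCauchy → T.Completion)
      (Subtype.ext (funext fun n => map_star φ _))
  map_smul' := by
    rintro c ⟨x⟩
    exact congrArg (Quotient.mk'' : T.bddCauchy → T.Completion)
      (Subtype.ext (funext fun n => map_smul φ c _))

/-- The action induced on the strict completion. -/
def TracialAction.completion {G : Type*} [Group G] (γ : TracialAction G T) :
    TracialAction G T.completion where
  act :=
    { toFun := fun g => completionEquiv (γ.act g) (γ.E_act g)
      map_one' := by
        ext ⟨x⟩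
        refine congrArg (Quotient.mk'' : T.bddCauchy → T.Completion)
          (Subtype.ext (funext fun n => ?_))
        show γ.act 1 _ = _
        rw [map_one]
        rfl
      map_mul' := fun g h => by
        ext ⟨x⟩
        refine congrArg (Quotient.mk'' : T.bddCauchy → T.Completion)
          (Subtype.ext (funext fun n => ?_))
        show γ.act (g * h) _ = _
        rw [map_mul]
        rfl }
  E_act := by
    rintro g ⟨x⟩
    refine tendsto_nhds_unique (T.tendsto_limE (bddCauchyMap (γ.act g) (γ.E_act g) x)) ?_
    have e : (fun n => T.E ((bddCauchyMap (γ.act g) (γ.E_act g) x : ℕ → A) n))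
        = fun n => T.E ((x : ℕ → A) n) := funext fun n => γ.E_act g _
    rw [e]
    exact T.tendsto_limE x

end CompletionAction

end Tracial

/-! ### Tensor products with a tracial algebra -/

section Tensor

variable {K A B : Type*} [TopologicalSpace K] [Ring A] [StarRing A] [Algebra ℂ A] [StarModule ℂ A]
  [Ring B] [StarRing B] [Algebra ℂ B] [StarModule ℂ B]

theorem gram_posSemidef (T : TracialExpectation K A) (k : K) {ι : Type*} [Fintype ι]
    (a : ι → A) : (Matrix.of fun i j => T.E (star (a i) * a j) k).PosSemidef := by
  rw [Matrix.posSemidef_iff_dotProduct_mulVec]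
  refine ⟨Matrix.ext fun i j => T.conj_symm k _ _, fun x => ?_⟩
  have h := T.nonneg (∑ j, x j • a j) k
  convert h using 1
  simp only [dotProduct, Matrix.mulVec, Matrix.of_apply, star_sum, Finset.sum_mul,
    Finset.mul_sum, map_sum, ContinuousMap.coe_sum, Finset.sum_apply, star_smul, smul_mul_smul_comm,
    map_smul, ContinuousMap.smul_apply, smul_eq_mul, Pi.star_apply]
  rw [Finset.sum_comm]
  refine Finset.sum_congr rfl fun i _ => Finset.sum_congr rfl fun j _ => ?_
  ring

/-- The expectation `E ⊗ τ` on the algebraic tensor product `A ⊗ B`, where `B` carries the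
trace `τ` (an expectation over the one-point space). -/
def TracialExpectation.tensor (T : TracialExpectation K A) (S : TracialExpectation Unit B) :
    TracialExpectation K (A ⊗[ℂ] B) where
  E := TensorProduct.lift
    (LinearMap.mk₂ ℂ (fun (a : A) (b : B) => (S.E b () • T.E a : C(K, ℂ)))
      (fun a a' b => ContinuousMap.ext fun k => by simp; ring)
      (fun c a b => ContinuousMap.ext fun k => by simp; ring)
      (fun a b b' => ContinuousMap.ext fun k => by simp; ring)
      (fun c a b => ContinuousMap.ext fun k => by simp; ring))
  nonneg z k := by
    obtain ⟨s, rfl⟩ := TensorProduct.exists_finset z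
    have h := ((gram_posSemidef T k fun i : s => i.1.1).hadamard
      (gram_posSemidef S () fun i : s => i.1.2)).dotProduct_mulVec_nonneg 1
    convert h using 1
    rw [← Finset.sum_coe_sort s]
    simp only [star_sum, Finset.sum_mul, Finset.mul_sum]
    rw [Finset.sum_comm]
    simp [dotProduct, Matrix.mulVec, mul_comm]
  tracial x y := by
    induction x with
    | zero => simp
    | add x x' h h' => simp only [add_mul, mul_add, map_add, h, h']
    | tmul a b =>
      induction y with
      | zero => simp
      | add y y' h h' => simp only [add_mul, mul_add, map_add, h, h']
      | tmul a' b' => simp [T.tracial a a', S.tracial b b']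

/-- The tensor product of two `*`-automorphisms. -/
def tensorEquiv (φ : A ≃⋆ₐ[ℂ] A) (ψ : B ≃⋆ₐ[ℂ] B) : A ⊗[ℂ] B ≃⋆ₐ[ℂ] A ⊗[ℂ] B :=
  StarAlgEquiv.ofAlgEquiv
    (Algebra.TensorProduct.congr (AlgEquivClass.toAlgEquiv φ) (AlgEquivClass.toAlgEquiv ψ))
    fun x => by
      induction x with
      | zero => simp
      | add x y h h' => simp only [star_add, map_add, h, h']
      | tmul a b => simp [map_star]

@[simp]
theorem tensorEquiv_tmul (φ : A ≃⋆ₐ[ℂ] A) (ψ : B ≃⋆ₐ[ℂ] B) (a : A) (b : B) :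
    tensorEquiv φ ψ (a ⊗ₜ b) = φ a ⊗ₜ ψ b := rfl

theorem starAlgEquiv_tensor_ext {φ ψ : A ⊗[ℂ] B ≃⋆ₐ[ℂ] A ⊗[ℂ] B}
    (h : ∀ a b, φ (a ⊗ₜ b) = ψ (a ⊗ₜ b)) : φ = ψ := by
  ext x
  induction x with
  | zero => simp only [map_zero]
  | add x y h h' => simp only [map_add, h, h']
  | tmul a b => exact h a b

/-- The diagonal tensor product action `γ ⊗ δ`. -/
def TracialAction.tensor {G : Type*} [Group G] {T : TracialExpectation K A}
    {S : TracialExpectation Unit B} (γ : TracialAction G T) (δ : TracialAction G S) :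
    TracialAction G (T.tensor S) where
  act :=
    { toFun := fun g => tensorEquiv (γ.act g) (δ.act g)
      map_one' := starAlgEquiv_tensor_ext fun a b => by simp
      map_mul' := fun g h => starAlgEquiv_tensor_ext fun a b => by simp }
  E_act g x := by
    induction x with
    | zero => simp only [map_zero]
    | add x y h h' => simp only [map_add, h, h']
    | tmul a b =>
      show (T.tensor S).E (tensorEquiv (γ.act g) (δ.act g) (a ⊗ₜ b)) = _
      simp [TracialExpectation.tensor, γ.E_act, δ.E_act]

end Tensor

/-! ### The hyperfinite II₁ factor and the product type action

`R` is realized as the strict completion, for the unique tracial state, of `⋃ₙ M_d^{⊗ n}`; this is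
the weak closure of `⨂ M_d` in the GNS representation of its trace. -/

/-- Index set of `M_d^{⊗ n}`. -/
abbrev TensorIndex (d : ℕ) : ℕ → Type
  | 0 => Unit
  | n + 1 => TensorIndex d n × Fin d

instance tensorIndexFintype (d : ℕ) : ∀ n, Fintype (TensorIndex d n)
  | 0 => inferInstanceAs (Fintype Unit)
  | n + 1 => letI := tensorIndexFintype d n; inferInstanceAs (Fintype (TensorIndex d n × Fin d))

instance tensorIndexDecidableEq (d : ℕ) : ∀ n, DecidableEq (TensorIndex d n)
  | 0 => inferInstanceAs (DecidableEq Unit)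
  | n + 1 =>
    letI := tensorIndexDecidableEq d n
    inferInstanceAs (DecidableEq (TensorIndex d n × Fin d))

/-- `M_d^{⊗ n}`. -/
abbrev MatrixTensor (d n : ℕ) : Type := Matrix (TensorIndex d n) (TensorIndex d n) ℂ

/-- The inclusion `M_d^{⊗ n} → M_d^{⊗ (n+1)}`, `x ↦ x ⊗ 1`. -/
def ampl (d n : ℕ) (x : MatrixTensor d n) : MatrixTensor d (n + 1) :=
  x ⊗ₖ (1 : Matrix (Fin d) (Fin d) ℂ)

theorem ampl_mul (d n : ℕ) (x y : MatrixTensor d n) :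
    ampl d n (x * y) = ampl d n x * ampl d n y := by
  have h := Matrix.mul_kronecker_mul x y (1 : Matrix (Fin d) (Fin d) ℂ)
    (1 : Matrix (Fin d) (Fin d) ℂ)
  rw [mul_one] at h
  exact h

theorem ampl_add (d n : ℕ) (x y : MatrixTensor d n) :
    ampl d n (x + y) = ampl d n x + ampl d n y := Matrix.add_kronecker x y _

theorem ampl_star (d n : ℕ) (x : MatrixTensor d n) :
    ampl d n (star x) = star (ampl d n x) := by
  have h := Matrix.conjTranspose_kronecker x (1 : Matrix (Fin d) (Fin d) ℂ)
  rw [Matrix.conjTranspose_one] at h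
  exact h.symm

theorem ampl_algebraMap (d n : ℕ) (c : ℂ) :
    ampl d n (algebraMap ℂ _ c) = algebraMap ℂ _ c := by
  rw [Algebra.algebraMap_eq_smul_one, Algebra.algebraMap_eq_smul_one, ampl, Matrix.smul_kronecker,
    Matrix.one_kronecker_one]

/-- The `*`-algebra `⋃ₙ M_d^{⊗ n}`: sequences `x_n ∈ M_d^{⊗ n}` with `x_{n+1} = x_n ⊗ 1` for all
large `n`. (Sequences that agree eventually represent the same element of the union; they are
identified in the strict completion, their distance being zero.) -/
def matrixUnion (d : ℕ) : StarSubalgebra ℂ (∀ n, MatrixTensor d n) where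
  carrier := {x | ∃ N, ∀ n ≥ N, x (n + 1) = ampl d n (x n)}
  mul_mem' := by
    rintro x y ⟨N, hN⟩ ⟨N', hN'⟩
    refine ⟨max N N', fun n hn => ?_⟩
    rw [Pi.mul_apply, Pi.mul_apply, ampl_mul, hN n (le_trans (le_max_left _ _) hn),
      hN' n (le_trans (le_max_right _ _) hn)]
  add_mem' := by
    rintro x y ⟨N, hN⟩ ⟨N', hN'⟩
    refine ⟨max N N', fun n hn => ?_⟩
    rw [Pi.add_apply, Pi.add_apply, ampl_add, hN n (le_trans (le_max_left _ _) hn),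
      hN' n (le_trans (le_max_right _ _) hn)]
  algebraMap_mem' c := ⟨0, fun n _ => (ampl_algebraMap d n c).symm⟩
  star_mem' := by
    rintro x ⟨N, hN⟩
    refine ⟨N, fun n hn => ?_⟩
    rw [Pi.star_apply, Pi.star_apply, ampl_star, hN n hn]

/-- The normalized trace on `M_d^{⊗ n}`. -/
def normTrace (d n : ℕ) (x : MatrixTensor d n) : ℂ := x.trace / (d : ℂ) ^ n

theorem normTrace_ampl (d n : ℕ) (hd : d ≠ 0) (x : MatrixTensor d n) :
    normTrace d (n + 1) (ampl d n x) = normTrace d n x := by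
  have h := Matrix.trace_kronecker x (1 : Matrix (Fin d) (Fin d) ℂ)
  rw [Matrix.trace_one, Fintype.card_fin] at h
  rw [normTrace, ampl, normTrace]
  have hd' : (d : ℂ) ≠ 0 := Nat.cast_ne_zero.2 hd
  refine (congrArg (· / (d : ℂ) ^ (n + 1)) h).trans ?_
  rw [pow_succ]
  field_simp

theorem normTrace_eventually_const (d : ℕ) (x : matrixUnion d) :
    ∃ N, ∀ n ≥ N, normTrace d n (x.1 n) = normTrace d N (x.1 N) := by
  obtain ⟨N, hN⟩ := x.2
  rcases eq_or_ne d 0 with rfl | hd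
  · refine ⟨1, fun n hn => ?_⟩
    have h : ∀ m ≥ 1, normTrace 0 m (x.1 m) = 0 := by
      intro m hm
      simp [normTrace, show m ≠ 0 by omega]
    rw [h n hn, h 1 le_rfl]
  · refine ⟨N, fun n hn => ?_⟩
    induction n, hn using Nat.le_induction with
    | base => rfl
    | succ n hn ih => rw [hN n hn, normTrace_ampl d n hd, ih]

/-- The trace on `⋃ₙ M_d^{⊗ n}`: the eventual value of the normalized traces. -/
def unionTrace (d : ℕ) (x : matrixUnion d) : ℂ :=
  limUnder atTop fun n => normTrace d n (x.1 n)

theorem tendsto_unionTrace (d : ℕ) (x : matrixUnion d) :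
    Tendsto (fun n => normTrace d n (x.1 n)) atTop (𝓝 (unionTrace d x)) := by
  obtain ⟨N, hN⟩ := normTrace_eventually_const d x
  exact tendsto_nhds_limUnder ⟨_, tendsto_const_nhds.congr'
    (eventually_atTop.2 ⟨N, fun n hn => (hN n hn).symm⟩)⟩

/-- The tracial state of `⋃ₙ M_d^{⊗ n}`, as an expectation over the one-point space. -/
def unionExpectation (d : ℕ) : TracialExpectation Unit (matrixUnion d) where
  E :=
    { toFun := fun x => ContinuousMap.const Unit (unionTrace d x)
      map_add' := fun x y => ContinuousMap.ext fun _ => by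
        refine tendsto_nhds_unique (tendsto_unionTrace d (x + y)) ?_
        refine ((tendsto_unionTrace d x).add (tendsto_unionTrace d y)).congr fun n => ?_
        simp [normTrace, add_div]
      map_smul' := fun c x => ContinuousMap.ext fun _ => by
        refine tendsto_nhds_unique (tendsto_unionTrace d (c • x)) ?_
        refine ((tendsto_unionTrace d x).const_mul c).congr fun n => ?_
        simp [normTrace, mul_div_assoc] }
  nonneg x _ := by
    refine ge_of_tendsto' (tendsto_unionTrace d (star x * x)) fun n => ?_
    refine div_nonneg (Matrix.posSemidef_conjTranspose_mul_self (x.1 n)).trace_nonneg ?_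
    positivity
  tracial x y := ContinuousMap.ext fun _ => by
    refine tendsto_nhds_unique (tendsto_unionTrace d (x * y)) ?_
    refine (tendsto_unionTrace d (y * x)).congr fun n => ?_
    exact congrArg (· / (d : ℂ) ^ n) (Matrix.trace_mul_comm (y.1 n) (x.1 n))

/-- The hyperfinite II₁ factor `R` (for `d ≥ 2`), the weak closure of `⨂ M_d`. -/
abbrev Hyperfinite (d : ℕ) : Type := (unionExpectation d).Completion

/-- The trace of `R`, as an expectation over the one-point space. -/
def hyperfiniteTrace (d : ℕ) : TracialExpectation Unit (Hyperfinite d) :=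
  (unionExpectation d).completion

section ProductType

variable {G : Type*} [Group G] {d : ℕ} (ν : G →* Matrix.unitaryGroup (Fin d) ℂ)

/-- The tensor power `ν_g ⊗ ⋯ ⊗ ν_g ∈ M_d^{⊗ n}`. -/
def repPow (g : G) : ∀ n, MatrixTensor d n
  | 0 => 1
  | n + 1 => repPow g n ⊗ₖ (ν g : Matrix (Fin d) (Fin d) ℂ)

theorem repPow_one (n : ℕ) : repPow ν 1 n = 1 := by
  induction n with
  | zero => rfl
  | succ n ih =>
    rw [repPow, ih, map_one]
    exact Matrix.one_kronecker_one

theorem repPow_mul (g h : G) (n : ℕ) : repPow ν (g * h) n = repPow ν g n * repPow ν h n := by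
  induction n with
  | zero => exact (mul_one _).symm
  | succ n ih =>
    rw [repPow, ih, map_mul]
    exact Matrix.mul_kronecker_mul _ _ _ _

theorem repPow_star (g : G) (n : ℕ) : star (repPow ν g n) = repPow ν g⁻¹ n := by
  induction n with
  | zero => exact star_one _
  | succ n ih =>
    rw [repPow, repPow, ← ih, map_inv]
    exact Matrix.conjTranspose_kronecker _ _

theorem repPow_star_mul (g : G) (n : ℕ) : star (repPow ν g n) * repPow ν g n = 1 := by
  rw [repPow_star, ← repPow_mul, inv_mul_cancel, repPow_one]

theorem ampl_conj (g : G) (n : ℕ) (x : MatrixTensor d n) :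
    repPow ν g (n + 1) * ampl d n x * star (repPow ν g (n + 1))
      = ampl d n (repPow ν g n * x * star (repPow ν g n)) := by
  have h : (ν g : Matrix (Fin d) (Fin d) ℂ) * star (ν g : Matrix (Fin d) (Fin d) ℂ) = 1 :=
    Unitary.coe_mul_star_self _
  have h1 : star (repPow ν g (n + 1)) = star (repPow ν g n) ⊗ₖ
      star (ν g : Matrix (Fin d) (Fin d) ℂ) := Matrix.conjTranspose_kronecker _ _
  rw [h1]
  show (repPow ν g n ⊗ₖ (ν g : Matrix (Fin d) (Fin d) ℂ)) * (x ⊗ₖ 1) * _ = _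
  rw [← Matrix.mul_kronecker_mul, mul_one]
  refine (Matrix.mul_kronecker_mul _ _ _ _).symm.trans ?_
  rw [h]
  rfl

/-- `⨂ Ad(ν_g)` on `⋃ₙ M_d^{⊗ n}`. -/
def adMap (g : G) (x : matrixUnion d) : matrixUnion d :=
  ⟨fun n => repPow ν g n * x.1 n * star (repPow ν g n), by
    obtain ⟨N, hN⟩ := x.2
    refine ⟨N, fun n hn => ?_⟩
    show repPow ν g (n + 1) * x.1 (n + 1) * _ = _
    rw [hN n hn, ampl_conj]⟩

theorem adMap_one (x : matrixUnion d) : adMap ν 1 x = x :=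
  Subtype.ext (funext fun n => by simp [adMap, repPow_one])

theorem adMap_mul (g h : G) (x : matrixUnion d) : adMap ν (g * h) x = adMap ν g (adMap ν h x) :=
  Subtype.ext (funext fun n => by simp only [adMap, repPow_mul, star_mul, mul_assoc])

/-- `⨂ Ad(ν_g)` as a `*`-automorphism of `⋃ₙ M_d^{⊗ n}`. -/
def adEquiv (g : G) : matrixUnion d ≃⋆ₐ[ℂ] matrixUnion d where
  toFun := adMap ν g
  invFun := adMap ν g⁻¹
  left_inv x := by rw [← adMap_mul, inv_mul_cancel, adMap_one]
  right_inv x := by rw [← adMap_mul, mul_inv_cancel, adMap_one]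
  map_mul' x y := Subtype.ext (funext fun n => by
    show repPow ν g n * (x.1 n * y.1 n) * star (repPow ν g n)
      = repPow ν g n * x.1 n * star (repPow ν g n) * (repPow ν g n * y.1 n * star (repPow ν g n))
    calc _ = repPow ν g n * x.1 n * 1 * y.1 n * star (repPow ν g n) := by
          simp only [mul_one, mul_assoc]
      _ = _ := by rw [← repPow_star_mul ν g n]; simp only [mul_assoc])
  map_add' x y := Subtype.ext (funext fun n => by
    show repPow ν g n * (x.1 n + y.1 n) * star (repPow ν g n)
      = repPow ν g n * x.1 n * star (repPow ν g n) + repPow ν g n * y.1 n * star (repPow ν g n)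
    rw [mul_add, add_mul])
  map_star' x := Subtype.ext (funext fun n => by
    show repPow ν g n * star (x.1 n) * star (repPow ν g n)
      = star (repPow ν g n * x.1 n * star (repPow ν g n))
    simp only [star_mul, star_star, mul_assoc])
  map_smul' c x := Subtype.ext (funext fun n => by
    show repPow ν g n * (c • x.1 n) * star (repPow ν g n)
      = c • (repPow ν g n * x.1 n * star (repPow ν g n))
    rw [mul_smul_comm, smul_mul_assoc])

/-- The action `g ↦ ⨂ Ad(ν_g)` on `⋃ₙ M_d^{⊗ n}`. -/
def unionAction : TracialAction G (unionExpectation d) where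
  act :=
    { toFun := adEquiv ν
      map_one' := StarAlgEquiv.ext (adMap_one ν)
      map_mul' := fun g h => StarAlgEquiv.ext (adMap_mul ν g h) }
  E_act g x := ContinuousMap.ext fun _ => by
    refine tendsto_nhds_unique (tendsto_unionTrace d (adMap ν g x)) ?_
    refine (tendsto_unionTrace d x).congr fun n => ?_
    show Matrix.trace _ / _ = Matrix.trace (repPow ν g n * x.1 n * star (repPow ν g n)) / _
    rw [mul_assoc, Matrix.trace_mul_comm, mul_assoc, repPow_star_mul, mul_one]

/-- The product type action `δ^ν = ⨂ Ad(ν)` on `R`. -/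
def productTypeAction : TracialAction G (hyperfiniteTrace d) := (unionAction ν).completion

end ProductType

/-! ### The McDuff property -/

/-- `(A, γ)` is `δ^ν`-McDuff: it is cocycle conjugate to `(A ⊗̄ R, γ ⊗ δ^ν)`, where `A ⊗̄ R` is the
strict completion of `A ⊗ R` with respect to `E ⊗ τ_R`. -/
def IsMcDuff {K A G : Type*} [TopologicalSpace K] [CompactSpace K] [Ring A] [StarRing A]
    [Algebra ℂ A] [StarModule ℂ A] [Group G] {d : ℕ} (ν : G →* Matrix.unitaryGroup (Fin d) ℂ)
    {T : TracialExpectation K A} (γ : TracialAction G T) : Prop :=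
  CocycleConjugate γ (γ.tensor (productTypeAction ν)).completion

/-! ### Equivariant `W*`-bundles and their fibers -/

/-- A `W*`-bundle over `K`: a unital C*-algebra `M` with a unital inclusion of `C(K)` into its
center and a faithful tracial conditional expectation `E : M → C(K)` such that the norm-closed unit
ball of `M` is complete in the uniform 2-norm. -/
structure WStarBundle (K M : Type*) [TopologicalSpace K] [CompactSpace K] [CStarAlgebra M] extends
    TracialExpectation K M where
  incl : C(K, ℂ) →⋆ₐ[ℂ] M
  incl_central : ∀ f a, incl f * a = a * incl f
  E_incl : ∀ f, E (incl f) = f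
  E_incl_mul : ∀ f a, E (incl f * a) = f * E a
  faithful : ∀ a, E (star a * a) = 0 → a = 0
  complete : ∀ x : ℕ → M, (∀ n, ‖x n‖ ≤ 1) → toTracialExpectation.CauchySeq2 x →
    ∃ a, ‖a‖ ≤ 1 ∧ toTracialExpectation.NullSeq fun n => x n - a

/-- A countable subset of `M` is dense in the uniform 2-norm. -/
def WStarBundle.StrictlySeparable {K M : Type*} [TopologicalSpace K] [CompactSpace K]
    [CStarAlgebra M] (B : WStarBundle K M) : Prop :=
  ∃ S : Set M, S.Countable ∧
    ∀ a, ∀ ε > 0, ∃ s ∈ S, B.toTracialExpectation.norm2u (a - s) < ε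

/-- A fiber-wise action: `γ_g ∘ E = E = E ∘ γ_g`, where `C(K)` is viewed inside `M`. -/
structure FiberwiseAction (G : Type*) [Group G] {K M : Type*} [TopologicalSpace K] [CompactSpace K]
    [CStarAlgebra M] (B : WStarBundle K M) extends TracialAction G B.toTracialExpectation where
  act_E : ∀ g a, act g (B.incl (B.E a)) = B.incl (B.E a)

/-- The vector functional `x ↦ ⟨ξ, x ξ⟩`. -/
def vecState {H : Type*} [NormedAddCommGroup H] [InnerProductSpace ℂ H] (ξ : H) :
    (H →L[ℂ] H) →ₗ[ℂ] ℂ where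
  toFun x := inner ℂ ξ (x ξ)
  map_add' x y := by rw [_root_.add_apply, inner_add_right]
  map_smul' c x := by
    rw [_root_.smul_apply, inner_smul_right, RingHom.id_apply, smul_eq_mul]

section Fiber

variable {K M : Type*} [TopologicalSpace K] [CompactSpace K] [CStarAlgebra M] [PartialOrder M]
  [StarOrderedRing M]

/-- The tracial state `τ_k = ev_k ∘ E`. -/
def WStarBundle.tau (B : WStarBundle K M) (k : K) : M →ₚ[ℂ] ℂ :=
  PositiveLinearMap.mk₀
    { toFun := fun a => B.E a k
      map_add' := fun a b => by simp
      map_smul' := fun c a => by simp }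
    fun a ha => by
      obtain ⟨b, rfl⟩ := CStarAlgebra.nonneg_iff_eq_star_mul_self.1 ha
      exact B.nonneg b k

/-- The fiber `M_k`: the image of the GNS representation `π_k` of `M` on `L²(M, τ_k)`. -/
def WStarBundle.Fiber (B : WStarBundle K M) (k : K) : Type _ :=
  ((B.tau k).gnsStarAlgHom.range : StarSubalgebra ℂ ((B.tau k).GNS →L[ℂ] (B.tau k).GNS))

instance (B : WStarBundle K M) (k : K) : Ring (B.Fiber k) :=
  inferInstanceAs (Ring ((B.tau k).gnsStarAlgHom.range))

instance (B : WStarBundle K M) (k : K) : StarRing (B.Fiber k) :=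
  inferInstanceAs (StarRing ((B.tau k).gnsStarAlgHom.range))

instance (B : WStarBundle K M) (k : K) : Algebra ℂ (B.Fiber k) :=
  inferInstanceAs (Algebra ℂ ((B.tau k).gnsStarAlgHom.range))

instance (B : WStarBundle K M) (k : K) : StarModule ℂ (B.Fiber k) :=
  inferInstanceAs (StarModule ℂ ((B.tau k).gnsStarAlgHom.range))

/-- The GNS representation as a `*`-homomorphism `π_k : M → M_k` onto the fiber. -/
def WStarBundle.proj (B : WStarBundle K M) (k : K) : M →⋆ₐ[ℂ] B.Fiber k :=
  (B.tau k).gnsStarAlgHom.rangeRestrict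

theorem WStarBundle.proj_surjective (B : WStarBundle K M) (k : K) (x : B.Fiber k) :
    ∃ a, B.proj k a = x := by
  obtain ⟨_, a, rfl⟩ := x
  exact ⟨a, rfl⟩

/-- The inclusion `M_k → B(L²(M, τ_k))`. -/
def WStarBundle.fiberVal (B : WStarBundle K M) (k : K) :
    B.Fiber k →⋆ₐ[ℂ] ((B.tau k).GNS →L[ℂ] (B.tau k).GNS) :=
  StarSubalgebra.subtype (B.tau k).gnsStarAlgHom.range

theorem WStarBundle.fiberVal_proj (B : WStarBundle K M) (k : K) (a : M) :
    B.fiberVal k (B.proj k a) = (B.tau k).gnsStarAlgHom a := rfl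

theorem WStarBundle.fiberVal_injective (B : WStarBundle K M) (k : K) :
    Function.Injective (B.fiberVal k) := Subtype.val_injective

/-- The canonical cyclic vector of `L²(M, τ_k)`. -/
def WStarBundle.xi (B : WStarBundle K M) (k : K) : (B.tau k).GNS :=
  (((B.tau k).toPreGNS 1 : (B.tau k).PreGNS) : (B.tau k).GNS)

theorem WStarBundle.gns_coe (B : WStarBundle K M) (k : K) (a b : M) :
    (B.tau k).gnsStarAlgHom a (((B.tau k).toPreGNS b : (B.tau k).PreGNS) : (B.tau k).GNS)
      = (((B.tau k).toPreGNS (a * b) : (B.tau k).PreGNS) : (B.tau k).GNS) := by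
  simp

theorem WStarBundle.vecState_xi (B : WStarBundle K M) (k : K) (a : M) :
    vecState (B.xi k) (B.fiberVal k (B.proj k a)) = B.E a k := by
  rw [B.fiberVal_proj]
  show inner ℂ (B.xi k) ((B.tau k).gnsStarAlgHom a (B.xi k)) = B.E a k
  rw [WStarBundle.xi, B.gns_coe, UniformSpace.Completion.inner_coe,
    PositiveLinearMap.preGNS_inner_def, PositiveLinearMap.ofPreGNS_toPreGNS,
    PositiveLinearMap.ofPreGNS_toPreGNS, star_one, one_mul, mul_one]
  rfl

/-- The trace on the fiber `M_k` (the vector state of the cyclic vector). -/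
def WStarBundle.fiberFunctional (B : WStarBundle K M) (k : K) : B.Fiber k →ₗ[ℂ] ℂ :=
  vecState (B.xi k) ∘ₗ (B.fiberVal k).toAlgHom.toLinearMap

theorem WStarBundle.fiberFunctional_proj (B : WStarBundle K M) (k : K) (a : M) :
    B.fiberFunctional k (B.proj k a) = B.E a k := B.vecState_xi k a

/-- The trace on the fiber `M_k`, with `τ(π_k(a)) = E(a)(k)`, as an expectation over the one-point
space. -/
def WStarBundle.fiberTrace (B : WStarBundle K M) (k : K) :
    TracialExpectation Unit (B.Fiber k) :=
  TracialExpectation.ofTrace (B.fiberFunctional k)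
    (fun x => by
      obtain ⟨a, rfl⟩ := B.proj_surjective k x
      rw [← map_star, ← map_mul, B.fiberFunctional_proj]
      exact B.nonneg a k)
    (fun x y => by
      obtain ⟨a, rfl⟩ := B.proj_surjective k x
      obtain ⟨b, rfl⟩ := B.proj_surjective k y
      rw [← map_mul, ← map_mul, B.fiberFunctional_proj, B.fiberFunctional_proj, B.tracial])

theorem WStarBundle.gns_eq_zero_iff (B : WStarBundle K M) (k : K) (a : M) :
    (B.tau k).gnsStarAlgHom a = 0 ↔ ∀ b, B.E (star (a * b) * (a * b)) k = 0 := by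
  have key : ∀ b, ‖(((B.tau k).toPreGNS b : (B.tau k).PreGNS) : (B.tau k).GNS)‖ ^ 2
      = (B.E (star b * b) k).re := by
    intro b
    rw [UniformSpace.Completion.norm_coe, PositiveLinearMap.preGNS_norm_def, Real.sq_sqrt]
    · rfl
    · exact (Complex.nonneg_iff.1 (B.nonneg b k)).1
  constructor
  · intro h b
    have h1 := key (a * b)
    rw [← B.gns_coe, h] at h1
    have h2 := Complex.nonneg_iff.1 (B.nonneg (a * b) k)
    exact Complex.ext (by simpa using h1.symm) h2.2.symm
  · intro h
    ext v
    induction v using UniformSpace.Completion.induction_on with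
    | hp => exact isClosed_eq (ContinuousLinearMap.continuous _) continuous_const
    | ih v =>
      have h1 := key (a * (B.tau k).ofPreGNS v)
      rw [h, Complex.zero_re, sq_eq_zero_iff, norm_eq_zero, ← B.gns_coe] at h1
      exact h1

theorem FiberwiseAction.gns_congr {G : Type*} [Group G] {B : WStarBundle K M}
    (γ : FiberwiseAction G B) (k : K) (g : G) {a b : M}
    (h : (B.tau k).gnsStarAlgHom a = (B.tau k).gnsStarAlgHom b) :
    (B.tau k).gnsStarAlgHom (γ.act g a) = (B.tau k).gnsStarAlgHom (γ.act g b) := by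
  rw [← sub_eq_zero, ← map_sub, B.gns_eq_zero_iff] at h ⊢
  intro c
  obtain ⟨c, rfl⟩ : ∃ c', γ.act g c' = c := ⟨(γ.act g).symm c, (γ.act g).apply_symm_apply c⟩
  rw [← map_sub, ← map_mul, ← map_star, ← map_mul, γ.E_act]
  exact h c

theorem WStarBundle.fiberTrace_proj (B : WStarBundle K M) (k : K) (a : M) :
    (B.fiberTrace k).E (B.proj k a) = ContinuousMap.const Unit (B.E a k) :=
  ContinuousMap.ext fun _ => B.fiberFunctional_proj k a

/-- The map `γ^k_g` induced by `γ_g` on the fiber: `γ^k_g(π_k(a)) = π_k(γ_g(a))`. -/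
def FiberwiseAction.fiberMap {G : Type*} [Group G] {B : WStarBundle K M}
    (γ : FiberwiseAction G B) (k : K) (g : G) (x : B.Fiber k) : B.Fiber k :=
  B.proj k (γ.act g (B.proj_surjective k x).choose)

theorem FiberwiseAction.fiberMap_apply {G : Type*} [Group G] {B : WStarBundle K M}
    (γ : FiberwiseAction G B) (k : K) (g : G) (a : M) :
    γ.fiberMap k g (B.proj k a) = B.proj k (γ.act g a) :=
  B.fiberVal_injective k (γ.gns_congr k g
    (congrArg (B.fiberVal k) (B.proj_surjective k (B.proj k a)).choose_spec))

theorem FiberwiseAction.fiberMap_one {G : Type*} [Group G] {B : WStarBundle K M}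
    (γ : FiberwiseAction G B) (k : K) (x : B.Fiber k) : γ.fiberMap k 1 x = x := by
  obtain ⟨a, rfl⟩ := B.proj_surjective k x
  rw [γ.fiberMap_apply, map_one, StarAlgEquiv.one_apply]

theorem FiberwiseAction.fiberMap_mul {G : Type*} [Group G] {B : WStarBundle K M}
    (γ : FiberwiseAction G B) (k : K) (g h : G) (x : B.Fiber k) :
    γ.fiberMap k (g * h) x = γ.fiberMap k g (γ.fiberMap k h x) := by
  obtain ⟨a, rfl⟩ := B.proj_surjective k x
  rw [γ.fiberMap_apply, γ.fiberMap_apply, γ.fiberMap_apply, map_mul, StarAlgEquiv.mul_apply]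

/-- `γ^k_g` as a `*`-automorphism of the fiber. -/
def FiberwiseAction.fiberEquiv {G : Type*} [Group G] {B : WStarBundle K M}
    (γ : FiberwiseAction G B) (k : K) (g : G) : B.Fiber k ≃⋆ₐ[ℂ] B.Fiber k where
  toFun := γ.fiberMap k g
  invFun := γ.fiberMap k g⁻¹
  left_inv x := by rw [← γ.fiberMap_mul, inv_mul_cancel, γ.fiberMap_one]
  right_inv x := by rw [← γ.fiberMap_mul, mul_inv_cancel, γ.fiberMap_one]
  map_mul' x y := by
    obtain ⟨a, rfl⟩ := B.proj_surjective k x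
    obtain ⟨b, rfl⟩ := B.proj_surjective k y
    rw [← map_mul, γ.fiberMap_apply, γ.fiberMap_apply, γ.fiberMap_apply, map_mul, map_mul]
  map_add' x y := by
    obtain ⟨a, rfl⟩ := B.proj_surjective k x
    obtain ⟨b, rfl⟩ := B.proj_surjective k y
    rw [← map_add, γ.fiberMap_apply, γ.fiberMap_apply, γ.fiberMap_apply, map_add, map_add]
  map_star' x := by
    obtain ⟨a, rfl⟩ := B.proj_surjective k x
    rw [← map_star, γ.fiberMap_apply, γ.fiberMap_apply, map_star, map_star]
  map_smul' c x := by
    obtain ⟨a, rfl⟩ := B.proj_surjective k x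
    rw [← map_smul, γ.fiberMap_apply, γ.fiberMap_apply, map_smul, map_smul]

/-- The action `γ^k` induced by `γ` on the fiber `M_k`. -/
def FiberwiseAction.fiber {G : Type*} [Group G] {B : WStarBundle K M} (γ : FiberwiseAction G B)
    (k : K) : TracialAction G (B.fiberTrace k) where
  act :=
    { toFun := γ.fiberEquiv k
      map_one' := StarAlgEquiv.ext (γ.fiberMap_one k)
      map_mul' := fun g h => StarAlgEquiv.ext (γ.fiberMap_mul k g h) }
  E_act g x := by
    obtain ⟨a, rfl⟩ := B.proj_surjective k x
    refine (congrArg (B.fiberTrace k).E (γ.fiberMap_apply k g a)).trans ?_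
    rw [B.fiberTrace_proj, B.fiberTrace_proj, γ.E_act]

end Fiber

/-! ### Covering dimension -/

/-- The (Lebesgue) covering dimension of `X` is at most `n`: every finite open cover has an open
refinement, covering `X`, such that each point lies in at most `n + 1` of its members. -/
def CoveringDimLE (X : Type*) [TopologicalSpace X] (n : ℕ) : Prop :=
  ∀ U : Set (Set X), U.Finite → (∀ u ∈ U, IsOpen u) → ⋃₀ U = Set.univ →
    ∃ V : Set (Set X), (∀ v ∈ V, IsOpen v) ∧ ⋃₀ V = Set.univ ∧ (∀ v ∈ V, ∃ u ∈ U, v ⊆ u) ∧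
      ∀ x, {v ∈ V | x ∈ v}.encard ≤ n + 1

end

end EquivariantBundle

/-!
If `(M, γ)` is `δ^ν`-McDuff, then an isomorphism `φ : M → M ⊗̄ R` followed by restriction to the
fiber over `k` gives a `*`-homomorphism `M → M_k ⊗̄ R` with the kernel of `π_k`. It is onto because
norm-bounded sequences in the fiber that are Cauchy in the 2-norm converge in the fiber, and so it
induces a cocycle conjugacy for the fiber (`WStarBundle.cocycleConjugate_fiber`).

Conversely, suppose that the fibers are McDuff. The matrix units of `M_d^{⊗ N}`, placed far out in
the infinite tensor product, are almost central in `M_k ⊗̄ R`, and the action transforms them like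
`Ad(ν^{⊗ N})`. The cocycle does not matter, as they almost commute with it, so they can be pulled
back to the fiber and lifted to contractions in `M` (`exists_approxUnits_of_fiber`).

Such approximate matrix units, valid near a point, are patched to a single system for the whole
bundle. If `K` has covering dimension at most `n`, there are functions in `n + 2` levels, with
disjoint supports in each level, such that at each point one of them equals `1` (`exists_coloring`).
The local systems of a level, multiplied by these functions, are added up; at each point at most one
summand is nonzero. The systems of different levels are chosen to commute approximately. The levels
are then merged one after the other: two commuting systems `e` and `f` of matrix units are exchanged
by the symmetry `Φ = ∑ e_{rt} f_{tr}`, and conjugating `e` by the unitary `c - i s Φ`, with central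
`c² + s² = 1`, moves it continuously from `e` (where `c = 1`) to `f` (where `s = 1`). The formula
involves only `s f` and not `f` itself, so it makes sense globally (`rotate`). Where `s = 1` for
some level, one obtains matrix units regardless of what came before (`IsMatrixUnits.patched`). With
approximate relations the same holds up to a small error, which is seen by passing to sequences
modulo null sequences, where all relations are exact (`exists_patch_tolerance`). The number of
rotations depends only on `n`, which gives a uniform norm bound
(`LocallyApproximable.exists_approxUnits`).

For global approximate matrix units `e` in `M` and matrix units `E` of `M_d^{⊗ N} ⊆ R`, the flip
`∑ e_{rt} ⊗ E_{tr}` is close to a unitary of `M ⊗ R` (`exists_unitary_near`). This unitary almost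
commutes with given elements of `M`, is almost invariant, since the action transforms `e` and `E` by
the same unitary matrices, and moves `M ⊗ M_d^{⊗ N}` almost into `M ⊗ 1` (`exists_flip_unitary`). A
one-sided approximate intertwining with products `w_n = v_1 ⋯ v_n` of such unitaries yields the
isomorphism `φ(a) = lim w_n (a ⊗ 1) w_n*`, and the coboundaries of the `w_n` converge to the cocycle
(`cocycleConjugate_of_exists_unitary`). Separability of `M` and countability of `G` are used to
exhaust all requirements by a sequence.
-/

set_option linter.unusedSectionVars false

namespace EquivariantBundle

noncomputable section

/-! ### The 2-seminorms of a tracial expectation -/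

namespace TracialExpectation

section Pointwise

variable {K A : Type*} [TopologicalSpace K] [Ring A] [StarRing A] [Algebra ℂ A] [StarModule ℂ A]
  (T : TracialExpectation K A) (k : K)

theorem norm2_nonneg (a : A) : 0 ≤ T.norm2 k a := Real.sqrt_nonneg _

theorem E_star_mul_self (a : A) : T.E (star a * a) k = ((T.norm2 k a ^ 2 : ℝ) : ℂ) := by
  have h := Complex.nonneg_iff.1 (T.nonneg a k)
  rw [norm2, Real.sq_sqrt h.1]
  exact Complex.ext (by simp) (by simp [← h.2])

theorem norm2_sq (a : A) : T.norm2 k a ^ 2 = (T.E (star a * a) k).re := by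
  rw [E_star_mul_self, Complex.ofReal_re]

theorem norm2_star (a : A) : T.norm2 k (star a) = T.norm2 k a := by
  simp only [norm2, star_star, T.tracial a (star a)]

theorem norm2_smul (c : ℂ) (a : A) : T.norm2 k (c • a) = ‖c‖ * T.norm2 k a := by
  let _ := InnerProductSpace.Core.toSeminormedAddCommGroup (𝕜 := ℂ) (F := A) (c := T.core k)
  let _ := InnerProductSpace.ofCore (𝕜 := ℂ) (F := A) (T.core k)
  exact norm_smul c a

@[simp]
theorem norm2_zero : T.norm2 k 0 = 0 := by simp [norm2]

@[simp]
theorem norm2_neg (a : A) : T.norm2 k (-a) = T.norm2 k a := by simp [norm2]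

theorem norm2_sub_comm (a b : A) : T.norm2 k (a - b) = T.norm2 k (b - a) := by
  rw [← norm2_neg, neg_sub]

theorem norm2_sub_le_sub (a b c : A) :
    T.norm2 k (a - c) ≤ T.norm2 k (a - b) + T.norm2 k (b - c) := by
  simpa using T.norm2_add_le k (a - b) (b - c)

theorem norm2_sum_le {ι : Type*} (s : Finset ι) (f : ι → A) :
    T.norm2 k (∑ i ∈ s, f i) ≤ ∑ i ∈ s, T.norm2 k (f i) := by
  classical
  induction s using Finset.induction_on with
  | empty => simp
  | insert i s hi ih =>
    rw [Finset.sum_insert hi, Finset.sum_insert hi]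
    exact (T.norm2_add_le k _ _).trans (by gcongr)

theorem norm_E_star_mul_le (a b : A) : ‖T.E (star a * b) k‖ ≤ T.norm2 k a * T.norm2 k b :=
  @InnerProductSpace.Core.norm_inner_le_norm ℂ A _ _ _ (T.core k) a b

theorem continuous_norm2 (a : A) : Continuous fun k => T.norm2 k a :=
  Real.continuous_sqrt.comp (Complex.continuous_re.comp (T.E (star a * a)).continuous)

/-- Left multiplication by `a` has norm at most `C` for the 2-seminorm at `k`. -/
def OpNormLEAt (C : ℝ) (a : A) : Prop := ∀ b : A, T.norm2 k (a * b) ≤ C * T.norm2 k b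

variable {T k}

theorem OpNormLEAt.right {C : ℝ} {a : A} (h : T.OpNormLEAt k C (star a)) (b : A) :
    T.norm2 k (b * a) ≤ C * T.norm2 k b := by
  have := h (star b)
  rwa [← star_mul, T.norm2_star, T.norm2_star] at this

theorem OpNormLEAt.mul {C D : ℝ} {a b : A} (hC : 0 ≤ C) (ha : T.OpNormLEAt k C a)
    (hb : T.OpNormLEAt k D b) : T.OpNormLEAt k (C * D) (a * b) := by
  intro c
  rw [mul_assoc, mul_assoc]
  exact (ha _).trans (mul_le_mul_of_nonneg_left (hb c) hC)

theorem OpNormLEAt.add {C D : ℝ} {a b : A} (ha : T.OpNormLEAt k C a) (hb : T.OpNormLEAt k D b) :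
    T.OpNormLEAt k (C + D) (a + b) := by
  intro c
  rw [add_mul, add_mul]
  exact (T.norm2_add_le k _ _).trans (add_le_add (ha c) (hb c))

/-- An element `a` with `C² - a* a = b* b` acts on `L²` with norm at most `C`. -/
theorem OpNormLEAt.of_add_eq {C : ℝ} (hC : 0 ≤ C) {a b : A}
    (h : star a * a + star b * b = ((C ^ 2 : ℝ) : ℂ) • 1) : T.OpNormLEAt k C a := by
  intro c
  have h1 : T.E (star (a * c) * (a * c)) k + T.E (star (b * c) * (b * c)) k
      = ((C ^ 2 : ℝ) : ℂ) * T.E (star c * c) k := by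
    rw [← ContinuousMap.add_apply, ← map_add]
    have : star (a * c) * (a * c) + star (b * c) * (b * c)
        = star c * (star a * a + star b * b) * c := by
      simp only [star_mul]; noncomm_ring
    rw [this, h, mul_smul_comm, smul_mul_assoc, mul_one, map_smul]
    rfl
  simp only [E_star_mul_self] at h1
  norm_cast at h1
  refine abs_le_of_sq_le_sq' ?_ (mul_nonneg hC (norm2_nonneg _ _ _)) |>.2
  nlinarith [sq_nonneg (T.norm2 k (b * c))]

theorem OpNormLEAt.of_star_mul_self {a : A} (h : star a * a = 1) : T.OpNormLEAt k 1 a :=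
  OpNormLEAt.of_add_eq zero_le_one (b := 0) (by simp [h])

/-- A partial isometry acts on `L²` as a contraction. -/
theorem OpNormLEAt.of_isIdempotent {a : A} (h : star a * a * (star a * a) = star a * a) :
    T.OpNormLEAt k 1 a := by
  refine OpNormLEAt.of_add_eq zero_le_one (b := 1 - star a * a) ?_
  have : star (1 - star a * a) * (1 - star a * a) = 1 - star a * a := by
    simp only [star_sub, star_one, star_mul, star_star]
    rw [sub_mul, mul_sub (star a * a), h]; noncomm_ring
  rw [this]; simp

theorem norm2_unitary_mul {u : A} (hu : star u * u = 1) (a : A) :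
    T.norm2 k (u * a) = T.norm2 k a := by
  have : star (u * a) * (u * a) = star a * (star u * u) * a := by
    rw [star_mul]; noncomm_ring
  rw [norm2, this, hu, mul_one]; rfl

theorem norm2_mul_unitary {u : A} (hu : u * star u = 1) (a : A) :
    T.norm2 k (a * u) = T.norm2 k a := by
  rw [← norm2_star, star_mul, norm2_unitary_mul (by simpa using hu), norm2_star]

end Pointwise

section Uniform

variable {K A : Type*} [TopologicalSpace K] [CompactSpace K] [Ring A] [StarRing A] [Algebra ℂ A]
  [StarModule ℂ A] (T : TracialExpectation K A)

theorem norm2u_congr {L B : Type*} [TopologicalSpace L] [CompactSpace L] [Ring B] [StarRing B]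
    [Algebra ℂ B] [StarModule ℂ B] {S : TracialExpectation L B} {a : A} {b : B}
    (h : ‖T.E (star a * a)‖ = ‖S.E (star b * b)‖) : T.norm2u a = S.norm2u b := by
  rw [norm2u, h]; rfl

@[simp]
theorem norm2u_zero : T.norm2u 0 = 0 := by simp [norm2u]

theorem norm2u_sub_le (a b : A) : T.norm2u (a - b) ≤ T.norm2u a + T.norm2u b := by
  rw [sub_eq_add_neg, ← T.norm2u_neg b]
  exact T.norm2u_add_le a _

theorem norm2u_sub_le_sub (a b c : A) :
    T.norm2u (a - c) ≤ T.norm2u (a - b) + T.norm2u (b - c) := by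
  simpa using T.norm2u_add_le (a - b) (b - c)

theorem norm2u_sum_le {ι : Type*} (s : Finset ι) (f : ι → A) :
    T.norm2u (∑ i ∈ s, f i) ≤ ∑ i ∈ s, T.norm2u (f i) := by
  classical
  induction s using Finset.induction_on with
  | empty => simp
  | insert i s hi ih =>
    rw [Finset.sum_insert hi, Finset.sum_insert hi]
    exact (T.norm2u_add_le _ _).trans (by gcongr)

theorem norm2u_unit (S : TracialExpectation Unit A) (a : A) : S.norm2u a = S.norm2 () a :=
  le_antisymm ((S.norm2u_le_iff a (S.norm2_nonneg () a)).2 fun _ => le_rfl) (S.norm2_le () a)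

variable {T}

theorem norm2u_le_of_norm2_le {B : Type*} [Ring B] [StarRing B] [Algebra ℂ B] [StarModule ℂ B]
    {S : TracialExpectation K B} {C : ℝ} (hC : 0 ≤ C) {a : A} {b : B}
    (h : ∀ k, T.norm2 k a ≤ C * S.norm2 k b) : T.norm2u a ≤ C * S.norm2u b :=
  (T.norm2u_le_iff a (mul_nonneg hC (S.norm2u_nonneg b))).2 fun k =>
    (h k).trans (mul_le_mul_of_nonneg_left (S.norm2_le k b) hC)

theorem norm2u_eq_of_norm2_eq {B : Type*} [Ring B] [StarRing B] [Algebra ℂ B] [StarModule ℂ B]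
    {S : TracialExpectation K B} {a : A} {b : B}
    (h : ∀ k, T.norm2 k a = S.norm2 k b) : T.norm2u a = S.norm2u b :=
  le_antisymm
    (by simpa using norm2u_le_of_norm2_le zero_le_one fun k => (by simpa using (h k).le))
    (by simpa using norm2u_le_of_norm2_le zero_le_one fun k => (by simpa using (h k).ge))

theorem opNormLE_of_opNormLEAt {C : ℝ} (hC : 0 ≤ C) {a : A} (h : ∀ k, T.OpNormLEAt k C a) :
    T.OpNormLE C a := fun b => norm2u_le_of_norm2_le hC fun k => h k b

theorem OpNormLE.mono {C D : ℝ} (hCD : C ≤ D) {a : A} (h : T.OpNormLE C a) : T.OpNormLE D a :=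
  fun b => (h b).trans (mul_le_mul_of_nonneg_right hCD (T.norm2u_nonneg b))

theorem norm2u_unitary_mul {u : A} (hu : star u * u = 1) (a : A) :
    T.norm2u (u * a) = T.norm2u a := norm2u_eq_of_norm2_eq fun _ => norm2_unitary_mul hu a

theorem norm2u_mul_unitary {u : A} (hu : u * star u = 1) (a : A) :
    T.norm2u (a * u) = T.norm2u a := norm2u_eq_of_norm2_eq fun _ => norm2_mul_unitary hu a

theorem norm2u_sub_le_of_le_geometric {y : ℕ → A} {m : ℕ}
    (h : ∀ n ≥ m, T.norm2u (y (n + 1) - y n) ≤ (1 / 2) ^ n) {n n' : ℕ} (hn : m ≤ n)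
    (hn' : n ≤ n') : T.norm2u (y n' - y n) ≤ 2 * (1 / 2) ^ n := by
  have key : ∀ j, T.norm2u (y (n + j) - y n) ≤ 2 * (1 / 2) ^ n - 2 * (1 / 2) ^ (n + j) := by
    intro j
    induction j with
    | zero => simp
    | succ j ih =>
      have h1 := T.norm2u_sub_le_sub (y (n + (j + 1))) (y (n + j)) (y n)
      have h2 := h (n + j) (by omega)
      have h3 : (1 / 2 : ℝ) ^ (n + (j + 1)) = (1 / 2) ^ (n + j) / 2 := by
        rw [← add_assoc, pow_succ]
        ring
      rw [add_assoc] at h2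
      rw [h3]
      linarith
  obtain ⟨j, rfl⟩ := Nat.exists_eq_add_of_le hn'
  have : (0 : ℝ) < (1 / 2) ^ (n + j) := by positivity
  linarith [key j]

theorem cauchySeq2_of_le_geometric {y : ℕ → A} {m : ℕ}
    (h : ∀ n ≥ m, T.norm2u (y (n + 1) - y n) ≤ (1 / 2) ^ n) : T.CauchySeq2 y := by
  intro ε hε
  obtain ⟨N, hN⟩ := exists_pow_lt_of_lt_one (show 0 < ε / 4 by positivity)
    (show (1 / 2 : ℝ) < 1 by norm_num)
  have h1 : (1 / 2 : ℝ) ^ max m N ≤ (1 / 2) ^ N :=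
    pow_le_pow_of_le_one (by norm_num) (by norm_num) (le_max_right _ _)
  refine ⟨max m N, fun p hp q hq => ?_⟩
  have h2 := norm2u_sub_le_of_le_geometric h (le_max_left m N) hp
  have h3 := norm2u_sub_le_of_le_geometric h (le_max_left m N) hq
  have h4 := T.norm2u_sub_le_sub (y p) (y (max m N)) (y q)
  rw [T.norm2u_sub_comm (y (max m N))] at h4
  linarith

/-! ### Elements of the strict completion -/

variable (T) in
/-- Bounded elements: `a` and `a*` act boundedly on `L²(A, E)`. -/
def Bdd (a : A) : Prop := ∃ C : ℝ, 0 ≤ C ∧ T.OpNormLE C a ∧ T.OpNormLE C (star a)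

theorem Bdd.bddSeq {a : A} (h : T.Bdd a) : T.BddSeq fun _ => a := by
  obtain ⟨C, hC, h⟩ := h
  exact ⟨C, hC, fun _ => h⟩

theorem Bdd.of_opNormLEAt {C D : ℝ} {a : A} (hC : 0 ≤ C) (hD : 0 ≤ D)
    (h : ∀ k, T.OpNormLEAt k C a) (h' : ∀ k, T.OpNormLEAt k D (star a)) : T.Bdd a :=
  ⟨max C D, hC.trans (le_max_left _ _), (opNormLE_of_opNormLEAt hC h).mono (le_max_left _ _),
    (opNormLE_of_opNormLEAt hD h').mono (le_max_right _ _)⟩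

theorem BddSeq.bdd {x : ℕ → A} (h : T.BddSeq x) (n : ℕ) : T.Bdd (x n) := by
  obtain ⟨C, hC, h⟩ := h
  exact ⟨C, hC, h n⟩

theorem Bdd.mul {a b : A} (ha : T.Bdd a) (hb : T.Bdd b) : T.Bdd (a * b) := by
  obtain ⟨C, hC, h1, h2⟩ := ha
  obtain ⟨D, hD, h3, h4⟩ := hb
  refine ⟨C * D, mul_nonneg hC hD, h1.mul hC h3, ?_⟩
  rw [star_mul, mul_comm C D]
  exact h4.mul hD h2

theorem Bdd.add {a b : A} (ha : T.Bdd a) (hb : T.Bdd b) : T.Bdd (a + b) := by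
  obtain ⟨C, hC, h1, h2⟩ := ha
  obtain ⟨D, hD, h3, h4⟩ := hb
  refine ⟨C + D, add_nonneg hC hD, h1.add h3, ?_⟩
  rw [star_add]
  exact h2.add h4

theorem Bdd.algebraMap (c : ℂ) : T.Bdd (algebraMap ℂ A c) := by
  refine ⟨‖c‖, norm_nonneg _, T.opNormLE_algebraMap c, ?_⟩
  have h := T.opNormLE_algebraMap (star c)
  rwa [norm_star, algebraMap_star_comm] at h

theorem Bdd.smul {a : A} (c : ℂ) (ha : T.Bdd a) : T.Bdd (c • a) := by
  rw [Algebra.smul_def]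
  exact (Bdd.algebraMap c).mul ha

theorem Bdd.star {a : A} (ha : T.Bdd a) : T.Bdd (star a) := by
  obtain ⟨C, hC, h1, h2⟩ := ha
  exact ⟨C, hC, h2, by rwa [star_star]⟩

theorem Bdd.zero : T.Bdd (0 : A) := by simpa using Bdd.algebraMap (T := T) 0

theorem Bdd.sum {ι : Type*} (s : Finset ι) (f : ι → A) (h : ∀ i ∈ s, T.Bdd (f i)) :
    T.Bdd (∑ i ∈ s, f i) :=
  Finset.sum_induction f T.Bdd (fun _ _ => Bdd.add) Bdd.zero h

variable (T) in
/-- The class in the strict completion of a bounded Cauchy sequence. -/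
def cls (x : T.bddCauchy) : T.Completion := Quotient.mk'' x

theorem cls_surjective (q : T.Completion) : ∃ x, T.cls x = q := Quotient.mk''_surjective q

theorem cls_eq_iff {x y : T.bddCauchy} :
    T.cls x = T.cls y ↔ T.NullSeq ((x : ℕ → A) - (y : ℕ → A)) :=
  Quotient.eq''

theorem completion_E_cls (x : T.bddCauchy) :
    Tendsto (fun n => T.E ((x : ℕ → A) n)) atTop (𝓝 (T.completion.E (T.cls x))) :=
  T.tendsto_limE x

theorem cls_sub (x y : T.bddCauchy) : T.cls (x - y) = T.cls x - T.cls y := rfl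
theorem cls_one : T.cls 1 = 1 := rfl
theorem cls_zero : T.cls 0 = 0 := rfl

theorem tendsto_norm2u_cls (x : T.bddCauchy) :
    Tendsto (fun n => T.norm2u ((x : ℕ → A) n)) atTop (𝓝 (T.completion.norm2u (T.cls x))) :=
  (Real.continuous_sqrt.tendsto _).comp (completion_E_cls (star x * x)).norm

theorem eq_zero_of_norm2u_eq_zero {q : T.Completion} (h : T.completion.norm2u q = 0) : q = 0 := by
  obtain ⟨x, rfl⟩ := cls_surjective q
  rw [← cls_zero, cls_eq_iff]
  have := tendsto_norm2u_cls x
  rw [h] at this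
  simpa [NullSeq] using this

theorem eq_of_norm2u_sub_eq_zero {p q : T.Completion} (h : T.completion.norm2u (p - q) = 0) :
    p = q := sub_eq_zero.1 (eq_zero_of_norm2u_eq_zero h)

theorem Bdd.mem_bddCauchy {a : A} (h : T.Bdd a) : (fun _ => a) ∈ T.bddCauchy :=
  ⟨h.bddSeq, fun ε hε => ⟨0, fun m _ n _ => by simpa using hε⟩⟩

variable (T) in
/-- A bounded element of `A`, as an element of the strict completion. -/
def const (a : A) (h : T.Bdd a) : T.Completion := T.cls ⟨fun _ => a, h.mem_bddCauchy⟩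

theorem completion_E_const {a : A} (h : T.Bdd a) : T.completion.E (T.const a h) = T.E a :=
  tendsto_nhds_unique (completion_E_cls _) tendsto_const_nhds

theorem norm2u_const {a : A} (h : T.Bdd a) : T.completion.norm2u (T.const a h) = T.norm2u a :=
  tendsto_nhds_unique (tendsto_norm2u_cls _) tendsto_const_nhds

theorem const_mul {a b : A} (ha : T.Bdd a) (hb : T.Bdd b) :
    T.const a ha * T.const b hb = T.const (a * b) (ha.mul hb) := rfl

theorem const_add {a b : A} (ha : T.Bdd a) (hb : T.Bdd b) :
    T.const a ha + T.const b hb = T.const (a + b) (ha.add hb) := rfl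

theorem Bdd.neg {a : A} (ha : T.Bdd a) : T.Bdd (-a) := by simpa using ha.smul (-1)

theorem Bdd.sub {a b : A} (ha : T.Bdd a) (hb : T.Bdd b) : T.Bdd (a - b) := by
  rw [sub_eq_add_neg]
  exact ha.add hb.neg

theorem const_sub {a b : A} (ha : T.Bdd a) (hb : T.Bdd b) :
    T.const a ha - T.const b hb = T.const (a - b) (ha.sub hb) := rfl

theorem const_star {a : A} (ha : T.Bdd a) : star (T.const a ha) = T.const (star a) ha.star := rfl

theorem bddCauchy_bddSeq (x : T.bddCauchy) : T.BddSeq (x : ℕ → A) := x.2.1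

theorem bddCauchy_cauchySeq2 (x : T.bddCauchy) : T.CauchySeq2 (x : ℕ → A) := x.2.2

theorem bddCauchy_bdd (x : T.bddCauchy) (n : ℕ) : T.Bdd ((x : ℕ → A) n) :=
  (bddCauchy_bddSeq x).bdd n

theorem tendsto_norm2u_cls_sub_const (x : T.bddCauchy) :
    Tendsto (fun n => T.completion.norm2u (T.cls x - T.const ((x : ℕ → A) n) (bddCauchy_bdd x n)))
      atTop (𝓝 0) := by
  rw [Metric.tendsto_atTop]
  intro ε hε
  obtain ⟨N, hN⟩ := bddCauchy_cauchySeq2 x (ε / 2) (half_pos hε)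
  refine ⟨N, fun n hn => ?_⟩
  rw [Real.dist_eq, sub_zero, abs_of_nonneg (norm2u_nonneg _ _)]
  have h := tendsto_norm2u_cls (x - ⟨fun _ => (x : ℕ → A) n, (bddCauchy_bdd x n).mem_bddCauchy⟩)
  refine lt_of_le_of_lt (le_of_tendsto h ?_) (half_lt_self hε)
  filter_upwards [eventually_ge_atTop N] with m hm
  exact (hN m hm n hn).le

/-- Bounds for left multiplication pass from `A` to the strict completion. -/
theorem OpNormLE.completion_cls {C : ℝ} {x : T.bddCauchy}
    (h : ∀ n, T.OpNormLE C ((x : ℕ → A) n)) : T.completion.OpNormLE C (T.cls x) := by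
  intro q
  obtain ⟨y, rfl⟩ := cls_surjective q
  exact le_of_tendsto_of_tendsto' (tendsto_norm2u_cls (x * y))
    ((tendsto_norm2u_cls y).const_mul C) fun n => h n _

theorem OpNormLE.completion_const {C : ℝ} {a : A} (h : T.OpNormLE C a) (ha : T.Bdd a) :
    T.completion.OpNormLE C (T.const a ha) :=
  OpNormLE.completion_cls fun _ => h

end Uniform

end TracialExpectation

end

end EquivariantBundle

namespace EquivariantBundle

noncomputable section

/-! ### Norm estimates in tensor products -/

namespace TracialExpectation

section Tensor

variable {K A B : Type*} [TopologicalSpace K] [Ring A] [StarRing A] [Algebra ℂ A] [StarModule ℂ A]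
  [Ring B] [StarRing B] [Algebra ℂ B] [StarModule ℂ B]
  (T : TracialExpectation K A) (S : TracialExpectation Unit B)

theorem tensor_E_tmul (a : A) (b : B) : (T.tensor S).E (a ⊗ₜ b) = S.E b () • T.E a := rfl

theorem norm2_tmul (k : K) (a : A) (b : B) :
    (T.tensor S).norm2 k (a ⊗ₜ b) = T.norm2 k a * S.norm2 () b := by
  rw [norm2, TensorProduct.star_tmul, Algebra.TensorProduct.tmul_mul_tmul, tensor_E_tmul,
    ContinuousMap.smul_apply, E_star_mul_self, E_star_mul_self, smul_eq_mul, ← Complex.ofReal_mul,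
    Complex.ofReal_re, Real.sqrt_mul (sq_nonneg _), Real.sqrt_sq (norm2_nonneg _ _ _),
    Real.sqrt_sq (norm2_nonneg _ _ _), mul_comm]

theorem norm2_tmul_one (hS : S.E 1 () = 1) (k : K) (a : A) :
    (T.tensor S).norm2 k (a ⊗ₜ 1) = T.norm2 k a := by
  have h : S.norm2 () 1 = 1 := by simp [norm2, hS]
  rw [norm2_tmul, h, mul_one]

variable {T S}

theorem OpNormLEAt.gram_posSemidef {k : K} {C : ℝ} {x : A}
    (h : T.OpNormLEAt k C x) {ι : Type*} [Fintype ι] (a : ι → A) :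
    (Matrix.of fun i j => ((C ^ 2 : ℝ) : ℂ) * T.E (star (a i) * a j) k
      - T.E (star (x * a i) * (x * a j)) k).PosSemidef := by
  rw [Matrix.posSemidef_iff_dotProduct_mulVec]
  refine ⟨Matrix.ext fun i j => ?_, fun y => ?_⟩
  · show (starRingEnd ℂ) _ = _
    simp only [Matrix.transpose_apply, Matrix.of_apply, map_sub, map_mul, T.conj_symm,
      Complex.conj_ofReal]
  have h1 : 0 ≤ ((C ^ 2 : ℝ) : ℂ) * T.E (star (∑ j, y j • a j) * ∑ j, y j • a j) k
      - T.E (star (x * ∑ j, y j • a j) * (x * ∑ j, y j • a j)) k := by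
    rw [E_star_mul_self, E_star_mul_self, ← Complex.ofReal_mul, ← Complex.ofReal_sub,
      Complex.zero_le_real, sub_nonneg, ← mul_pow]
    exact pow_le_pow_left₀ (norm2_nonneg _ _ _) (h _) 2
  convert h1 using 1
  simp only [dotProduct, Matrix.mulVec, Matrix.of_apply, star_sum, Finset.sum_mul,
    Finset.mul_sum, map_sum, ContinuousMap.coe_sum, Finset.sum_apply, star_smul,
    smul_mul_assoc, mul_smul_comm, map_smul, ContinuousMap.smul_apply, smul_eq_mul,
    Pi.star_apply, ← Finset.sum_sub_distrib]
  rw [Finset.sum_comm]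
  refine Finset.sum_congr rfl fun i _ => Finset.sum_congr rfl fun j _ => ?_
  ring

/-- Bounds for left multiplication by `b` on `L²(B, τ)` carry over to `1 ⊗ b`: the difference
of the two quadratic forms is a Hadamard product of positive matrices. -/
theorem OpNormLEAt.one_tmul {C : ℝ} (hC : 0 ≤ C) {b : B} (h : S.OpNormLEAt () C b) (k : K) :
    (T.tensor S).OpNormLEAt k C ((1 : A) ⊗ₜ b) := by
  intro z
  obtain ⟨s, rfl⟩ := TensorProduct.exists_finset z
  have h1 := ((EquivariantBundle.gram_posSemidef T k fun i : s => i.1.1).hadamard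
    (h.gram_posSemidef fun i : s => i.1.2)).dotProduct_mulVec_nonneg 1
  have h2 : 0 ≤ ((C ^ 2 : ℝ) : ℂ) * (T.tensor S).E (star (∑ j ∈ s, j.1 ⊗ₜ[ℂ] j.2)
      * ∑ j ∈ s, j.1 ⊗ₜ[ℂ] j.2) k - (T.tensor S).E (star ((1 ⊗ₜ b) * ∑ j ∈ s, j.1 ⊗ₜ[ℂ] j.2)
        * ((1 ⊗ₜ b) * ∑ j ∈ s, j.1 ⊗ₜ[ℂ] j.2)) k := by
    convert h1 using 1
    rw [← Finset.sum_coe_sort s]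
    simp only [star_sum, Finset.sum_mul, Finset.mul_sum, dotProduct, Matrix.mulVec, map_sum,
      ContinuousMap.coe_sum, Finset.sum_apply, TensorProduct.star_tmul,
      Algebra.TensorProduct.tmul_mul_tmul, one_mul, tensor_E_tmul, ContinuousMap.smul_apply,
      Matrix.hadamard_apply, Matrix.of_apply, Pi.star_apply, Pi.one_apply, star_one, mul_one,
      smul_eq_mul, ← Finset.sum_sub_distrib]
    rw [Finset.sum_comm]
    refine Finset.sum_congr rfl fun i _ => Finset.sum_congr rfl fun j _ => ?_
    ring
  rw [E_star_mul_self, E_star_mul_self, ← Complex.ofReal_mul, ← Complex.ofReal_sub,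
      Complex.zero_le_real, sub_nonneg, ← mul_pow] at h2
  exact abs_le_of_sq_le_sq' h2 (mul_nonneg hC (norm2_nonneg _ _ _)) |>.2

/-- Bounds for left multiplication by `a` on `L²(A, E)` carry over to `a ⊗ 1`. -/
theorem OpNormLEAt.tmul_one {C : ℝ} (hC : 0 ≤ C) {k : K} {a : A} (h : T.OpNormLEAt k C a) :
    (T.tensor S).OpNormLEAt k C (a ⊗ₜ (1 : B)) := by
  intro z
  obtain ⟨s, rfl⟩ := TensorProduct.exists_finset z
  have h1 := ((h.gram_posSemidef fun i : s => i.1.1).hadamard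
    (EquivariantBundle.gram_posSemidef S () fun i : s => i.1.2)).dotProduct_mulVec_nonneg 1
  have h2 : 0 ≤ ((C ^ 2 : ℝ) : ℂ) * (T.tensor S).E (star (∑ j ∈ s, j.1 ⊗ₜ[ℂ] j.2)
      * ∑ j ∈ s, j.1 ⊗ₜ[ℂ] j.2) k - (T.tensor S).E (star ((a ⊗ₜ 1) * ∑ j ∈ s, j.1 ⊗ₜ[ℂ] j.2)
        * ((a ⊗ₜ 1) * ∑ j ∈ s, j.1 ⊗ₜ[ℂ] j.2)) k := by
    convert h1 using 1
    rw [← Finset.sum_coe_sort s]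
    simp only [star_sum, Finset.sum_mul, Finset.mul_sum, dotProduct, Matrix.mulVec, map_sum,
      ContinuousMap.coe_sum, Finset.sum_apply, TensorProduct.star_tmul,
      Algebra.TensorProduct.tmul_mul_tmul, one_mul, tensor_E_tmul, ContinuousMap.smul_apply,
      Matrix.hadamard_apply, Matrix.of_apply, Pi.star_apply, Pi.one_apply, star_one, mul_one,
      smul_eq_mul, ← Finset.sum_sub_distrib]
    rw [Finset.sum_comm]
    refine Finset.sum_congr rfl fun i _ => Finset.sum_congr rfl fun j _ => ?_
    ring
  rw [E_star_mul_self, E_star_mul_self, ← Complex.ofReal_mul, ← Complex.ofReal_sub,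
      Complex.zero_le_real, sub_nonneg, ← mul_pow] at h2
  exact abs_le_of_sq_le_sq' h2 (mul_nonneg hC (norm2_nonneg _ _ _)) |>.2

theorem OpNormLEAt.tmul {C D : ℝ} (hC : 0 ≤ C) (hD : 0 ≤ D) {k : K} {a : A} {b : B}
    (ha : T.OpNormLEAt k C a) (hb : S.OpNormLEAt () D b) :
    (T.tensor S).OpNormLEAt k (C * D) (a ⊗ₜ b) := by
  have h := (ha.tmul_one (S := S) hC).mul hC (hb.one_tmul (T := T) hD k)
  rwa [Algebra.TensorProduct.tmul_mul_tmul, one_mul, mul_one] at h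

variable (A S) in
/-- The slice map `id ⊗ τ : A ⊗ B → A`. -/
def slice : A ⊗[ℂ] B →ₗ[ℂ] A :=
  TensorProduct.lift (LinearMap.mk₂ ℂ (fun (a : A) (b : B) => S.E b () • a)
    (fun _ _ _ => smul_add _ _ _) (fun _ _ _ => smul_comm _ _ _)
    (fun _ _ _ => by rw [LinearMap.map_add, ContinuousMap.add_apply, add_smul])
    (fun _ _ _ => by rw [LinearMap.map_smul, ContinuousMap.smul_apply, smul_assoc]))

@[simp]
theorem slice_tmul (a : A) (b : B) : slice A S (a ⊗ₜ b) = S.E b () • a := rfl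

theorem slice_tmul_one (hS : S.E 1 () = 1) (a : A) : slice A S (a ⊗ₜ 1) = a := by
  rw [slice_tmul, hS, one_smul]

theorem E_star_mul_slice (c : A) (z : A ⊗[ℂ] B) :
    T.E (star c * slice A S z) = (T.tensor S).E (star (c ⊗ₜ (1 : B)) * z) := by
  induction z with
  | zero => simp only [map_zero, mul_zero]
  | add x y hx hy => simp only [map_add, mul_add, hx, hy]
  | tmul a b =>
    rw [slice_tmul, TensorProduct.star_tmul, Algebra.TensorProduct.tmul_mul_tmul, star_one,
      one_mul, tensor_E_tmul, mul_smul_comm, map_smul]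

theorem slice_mul_tmul_one (z : A ⊗[ℂ] B) (b : A) :
    slice A S (z * (b ⊗ₜ 1)) = slice A S z * b := by
  induction z with
  | zero => simp only [map_zero, zero_mul]
  | add x y hx hy => simp only [map_add, add_mul, hx, hy]
  | tmul a c => simp

/-- The slice map is a contraction for the 2-seminorms. -/
theorem norm2_slice_le (hS : S.E 1 () = 1) (k : K) (z : A ⊗[ℂ] B) :
    T.norm2 k (slice A S z) ≤ (T.tensor S).norm2 k z := by
  have h := (T.tensor S).norm_E_star_mul_le k (slice A S z ⊗ₜ (1 : B)) z
  rw [← E_star_mul_slice, E_star_mul_self, Complex.norm_real,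
    Real.norm_of_nonneg (sq_nonneg _), norm2_tmul_one T S hS, sq] at h
  rcases (T.norm2_nonneg k (slice A S z)).eq_or_lt with h0 | h0
  · rw [← h0]; exact norm2_nonneg _ _ _
  · exact le_of_mul_le_mul_left h h0

theorem norm2u_slice_le [CompactSpace K] (hS : S.E 1 () = 1) (z : A ⊗[ℂ] B) :
    T.norm2u (slice A S z) ≤ (T.tensor S).norm2u z := by
  simpa using norm2u_le_of_norm2_le (S := T.tensor S) (b := z) zero_le_one
    fun k => by simpa using norm2_slice_le hS k z

theorem norm2u_tmul_one [CompactSpace K] (hS : S.E 1 () = 1) (a : A) :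
    (T.tensor S).norm2u (a ⊗ₜ (1 : B)) = T.norm2u a :=
  norm2u_eq_of_norm2_eq fun k => norm2_tmul_one T S hS k a

theorem norm2u_tmul [CompactSpace K] (a : A) (b : B) :
    (T.tensor S).norm2u (a ⊗ₜ b) = T.norm2u a * S.norm2u b := by
  have h : star (a ⊗ₜ[ℂ] b) * a ⊗ₜ b = (star a * a) ⊗ₜ (star b * b) := by
    rw [TensorProduct.star_tmul, Algebra.TensorProduct.tmul_mul_tmul]
  rw [norm2u, h, tensor_E_tmul, norm_smul, E_star_mul_self, Complex.norm_real,
    Real.norm_of_nonneg (sq_nonneg _), Real.sqrt_mul (sq_nonneg _),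
    Real.sqrt_sq (norm2_nonneg _ _ _), norm2u_unit, mul_comm]
  rfl

/-- The slice map does not increase bounds for left multiplication. -/
theorem OpNormLE.slice [CompactSpace K] (hS : S.E 1 () = 1) {C : ℝ} {z : A ⊗[ℂ] B}
    (h : (T.tensor S).OpNormLE C z) : T.OpNormLE C (slice A S z) := by
  intro b
  rw [← slice_mul_tmul_one]
  refine (norm2u_slice_le hS _).trans ((h _).trans_eq ?_)
  rw [norm2u_tmul_one hS]

/-- The `*`-homomorphism `ρ ⊗ id`. -/
def tensorMap {A' : Type*} [Ring A'] [StarRing A'] [Algebra ℂ A'] [StarModule ℂ A']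
    (B : Type*) [Ring B] [StarRing B] [Algebra ℂ B] [StarModule ℂ B]
    (ρ : A →⋆ₐ[ℂ] A') : A ⊗[ℂ] B →⋆ₐ[ℂ] A' ⊗[ℂ] B where
  __ := Algebra.TensorProduct.map ρ.toAlgHom (AlgHom.id ℂ B)
  map_star' x := by
    show Algebra.TensorProduct.map ρ.toAlgHom (AlgHom.id ℂ B) (star x)
      = star (Algebra.TensorProduct.map ρ.toAlgHom (AlgHom.id ℂ B) x)
    induction x with
    | zero => simp only [star_zero, map_zero]
    | add x y hx hy => simp only [star_add, map_add, hx, hy]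
    | tmul a b =>
      simp only [TensorProduct.star_tmul, Algebra.TensorProduct.map_tmul, AlgHom.id_apply]
      congr 1
      exact map_star ρ a

@[simp]
theorem tensorMap_tmul {A' : Type*} [Ring A'] [StarRing A'] [Algebra ℂ A'] [StarModule ℂ A']
    (ρ : A →⋆ₐ[ℂ] A') (a : A) (b : B) : tensorMap B ρ (a ⊗ₜ b) = ρ a ⊗ₜ b := rfl

/-- A unital inclusion of `C(K)` into the center of `A` for which the expectation is a module
map. -/
structure CentralFunctions (T : TracialExpectation K A) where
  incl : C(K, ℂ) →⋆ₐ[ℂ] A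
  central : ∀ f a, incl f * a = a * incl f
  E_mul : ∀ f a, T.E (incl f * a) = f * T.E a

namespace CentralFunctions

variable (J : CentralFunctions T)

theorem norm2_incl_mul (k : K) (f : C(K, ℂ)) (a : A) :
    T.norm2 k (J.incl f * a) = ‖f k‖ * T.norm2 k a := by
  have h : star (J.incl f * a) * (J.incl f * a) = J.incl (star f * f) * (star a * a) := by
    rw [star_mul, ← map_star, mul_assoc, ← mul_assoc _ _ a, ← map_mul, ← mul_assoc,
      ← J.central, mul_assoc]
  rw [norm2, h, J.E_mul, ContinuousMap.mul_apply, E_star_mul_self]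
  have h2 : (star f * f) k = ((‖f k‖ ^ 2 : ℝ) : ℂ) := by
    simp [Complex.conj_mul']
  rw [h2, ← Complex.ofReal_mul, Complex.ofReal_re, ← mul_pow, Real.sqrt_sq]
  exact mul_nonneg (norm_nonneg _) (norm2_nonneg _ _ _)

/-- In the fiber over `k`, central functions act by their value at `k`. -/
theorem norm2_incl_mul_sub_smul (k : K) (f : C(K, ℂ)) (a : A) :
    T.norm2 k (J.incl f * a - f k • a) = 0 := by
  have h : J.incl f * a - f k • a = J.incl (f - algebraMap ℂ _ (f k)) * a := by
    rw [map_sub, sub_mul, AlgHomClass.commutes, Algebra.smul_def]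
  rw [h, norm2_incl_mul]
  simp

/-- Any element can be cut off by a central function that is `1` at `k` in such a way that its
2-seminorms are at most a given number, not smaller than the 2-seminorm at `k`. -/
theorem exists_truncation (k : K) (a : A) {δ : ℝ} (hδ : 0 < δ) (h : T.norm2 k a ≤ δ) :
    ∃ f : C(K, ℝ), (∀ l, 0 ≤ f l) ∧ (∀ l, f l ≤ 1) ∧ f k = 1 ∧
      ∀ l, T.norm2 l (J.incl ((Complex.ofRealCLM : C(ℝ, ℂ)).comp f) * a) ≤ δ := by
  have hpos : ∀ l, 0 < max (T.norm2 l a) δ := fun l => lt_max_of_lt_right hδ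
  refine ⟨⟨fun l => δ / max (T.norm2 l a) δ,
    continuous_const.div ((T.continuous_norm2 a).max continuous_const) fun l => (hpos l).ne'⟩,
    fun l => div_nonneg hδ.le (hpos l).le, fun l => (div_le_one (hpos l)).2 (le_max_right _ _),
    ?_, fun l => ?_⟩
  · show δ / max (T.norm2 k a) δ = 1
    rw [max_eq_right h, div_self hδ.ne']
  · rw [norm2_incl_mul]
    show ‖((δ / max (T.norm2 l a) δ : ℝ) : ℂ)‖ * _ ≤ _
    rw [Complex.norm_real, Real.norm_of_nonneg (div_nonneg hδ.le (hpos l).le),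
      div_mul_eq_mul_div, div_le_iff₀ (hpos l)]
    exact mul_le_mul_of_nonneg_left (le_max_left _ _) hδ.le

/-- A uniform bound for left multiplication holds in each fiber. -/
theorem opNormLEAt_of_opNormLE [CompactSpace K] (J : CentralFunctions T) {C : ℝ} (hC : 0 ≤ C)
    {a : A}
    (h : T.OpNormLE C a) (k : K) : T.OpNormLEAt k C a := by
  intro b
  have key : ∀ δ > 0, T.norm2 k (a * b) ≤ C * (T.norm2 k b + δ) := by
    intro δ hδ
    have hpos : 0 < T.norm2 k b + δ := add_pos_of_nonneg_of_pos (T.norm2_nonneg k b) hδ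
    obtain ⟨f, -, -, hfk, hf⟩ := J.exists_truncation k b hpos (by linarith)
    have h1 := (T.norm2_le k _).trans (h (J.incl ((Complex.ofRealCLM : C(ℝ, ℂ)).comp f) * b))
    have e : a * (J.incl ((Complex.ofRealCLM : C(ℝ, ℂ)).comp f) * b)
        = J.incl ((Complex.ofRealCLM : C(ℝ, ℂ)).comp f) * (a * b) := by
      rw [← mul_assoc, ← J.central, mul_assoc]
    have hfk' : ‖((Complex.ofRealCLM : C(ℝ, ℂ)).comp f) k‖ = 1 := by
      simp [hfk]
    rw [e, norm2_incl_mul, hfk', one_mul] at h1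
    exact h1.trans (mul_le_mul_of_nonneg_left ((T.norm2u_le_iff _ hpos.le).2 hf) hC)
  refine le_of_forall_pos_le_add fun ε hε => ?_
  refine (key (ε / (C + 1)) (by positivity)).trans ?_
  rw [mul_add]
  gcongr
  rw [mul_div_assoc', div_le_iff₀ (by positivity)]
  nlinarith

/-- The inclusion `f ↦ f ⊗ 1` of `C(K)` into the center of `A ⊗ B`. -/
def tensor (S : TracialExpectation Unit B) : CentralFunctions (T.tensor S) where
  incl :=
    { toFun := fun f => J.incl f ⊗ₜ 1
      map_one' := by rw [map_one]; rfl
      map_mul' := fun f g => by rw [map_mul, Algebra.TensorProduct.tmul_mul_tmul, one_mul]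
      map_zero' := by rw [map_zero, TensorProduct.zero_tmul]
      map_add' := fun f g => by rw [map_add, TensorProduct.add_tmul]
      commutes' := fun c => by rw [AlgHomClass.commutes]; rfl
      map_star' := fun f => by rw [map_star, TensorProduct.star_tmul, star_one] }
  central f z := by
    show (J.incl f ⊗ₜ 1) * z = z * (J.incl f ⊗ₜ 1)
    induction z with
    | zero => simp only [mul_zero, zero_mul]
    | add x y hx hy => simp only [mul_add, add_mul, hx, hy]
    | tmul a b => simp only [Algebra.TensorProduct.tmul_mul_tmul, one_mul, mul_one, J.central]
  E_mul f z := by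
    show (T.tensor S).E ((J.incl f ⊗ₜ 1) * z) = f * (T.tensor S).E z
    induction z with
    | zero => simp only [mul_zero, map_zero]
    | add x y hx hy => simp only [mul_add, map_add, hx, hy]
    | tmul a b =>
      simp only [Algebra.TensorProduct.tmul_mul_tmul, one_mul, tensor_E_tmul, J.E_mul,
        mul_smul_comm]

end CentralFunctions

end Tensor

end TracialExpectation

end

end EquivariantBundle

namespace EquivariantBundle

noncomputable section

open TracialExpectation

/-! ### Norms in a `W*`-bundle -/

namespace WStarBundle

section

variable {K M : Type*} [TopologicalSpace K] [CompactSpace K] [CStarAlgebra M]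
  [PartialOrder M] [StarOrderedRing M] (B : WStarBundle K M)

/-- Left multiplication by `a` on `L²(M, τ_k)` has norm at most `‖a‖`: `‖a‖² - a* a` is positive. -/
theorem opNormLEAt (k : K) (a : M) : B.OpNormLEAt k ‖a‖ a := by
  have h : star a * a ≤ algebraMap ℝ M (‖a‖ ^ 2) := by
    rw [sq, ← CStarRing.norm_star_mul_self]
    exact (IsSelfAdjoint.star_mul_self a).le_algebraMap_norm_self
  obtain ⟨b, hb⟩ := CStarAlgebra.nonneg_iff_eq_star_mul_self.1 (sub_nonneg.2 h)
  refine OpNormLEAt.of_add_eq (norm_nonneg a) (b := b) ?_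
  rw [← hb, add_sub_cancel, Complex.coe_smul, Algebra.algebraMap_eq_smul_one]

theorem opNormLE (a : M) : B.OpNormLE ‖a‖ a :=
  opNormLE_of_opNormLEAt (norm_nonneg a) fun k => B.opNormLEAt k a

theorem norm2_mul_le (k : K) (a b : M) : B.norm2 k (a * b) ≤ ‖a‖ * B.norm2 k b :=
  B.opNormLEAt k a b

theorem norm2_mul_le' (k : K) (a b : M) : B.norm2 k (a * b) ≤ B.norm2 k a * ‖b‖ := by
  have := B.opNormLEAt k (star b)
  rw [norm_star] at this
  rw [mul_comm (B.norm2 k a)]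
  exact this.right a

theorem E_one (k : K) : B.E 1 k = 1 := by
  have := B.E_incl 1
  rw [map_one] at this
  rw [this]; rfl

theorem norm2_one (k : K) : B.norm2 k 1 = 1 := by
  simp [norm2, B.E_one]

/-- The copy of `C(K)` in the center of `M`. -/
def centralFunctions : CentralFunctions B.toTracialExpectation where
  incl := B.incl
  central := B.incl_central
  E_mul := B.E_incl_mul

theorem faithful_norm2u {a : M} (h : B.norm2u a = 0) : a = 0 := by
  refine B.faithful a (norm_eq_zero.1 ?_)
  rw [norm2u, Real.sqrt_eq_zero (norm_nonneg _)] at h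
  exact h

/-- The norm of `M` is the norm of the representation on `L²(M, E)`. If `‖a‖ > C`, then the part
of `a* a` above a level `> C²` is a nonzero element on which `a` has norm more than `C`. -/
theorem norm_le_of_opNormLE {C : ℝ} (hC : 0 ≤ C) {a : M} (h : B.OpNormLE C a) : ‖a‖ ≤ C := by
  by_contra! hlt
  set x : M := star a * a with hx
  have hxs : IsSelfAdjoint x := IsSelfAdjoint.star_mul_self a
  obtain ⟨D, hCD, hDa⟩ : ∃ D, C < D ∧ D < ‖a‖ := exists_between hlt
  have hD : 0 < D := hC.trans_lt hCD
  let f : ℝ → ℝ := fun t => max (t - D ^ 2) 0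
  have hf : Continuous f := by fun_prop
  -- `b = (a* a - D²)⁺`, and `c = b^{3/2}` makes up for the difference: `|ab|² = D² |b|² + |c|²`
  set b : M := cfc f x with hb
  have hbs : star b = b := (cfc_predicate f x : IsSelfAdjoint (cfc f x)).star_eq
  let r : ℝ → ℝ := fun t => Real.sqrt (max (t - D ^ 2) 0) * max (t - D ^ 2) 0
  have hr : Continuous r := by fun_prop
  set c : M := cfc r x with hc
  have hcs : star c = c := (cfc_predicate r x : IsSelfAdjoint (cfc r x)).star_eq
  have key : star (a * b) * (a * b) = ((D ^ 2 : ℝ) : ℂ) • (star b * b) + star c * c := by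
    have e1 : star (a * b) * (a * b) = b * x * b := by
      rw [star_mul, hbs, hx]; noncomm_ring
    rw [e1, hbs, hcs, Complex.coe_smul]
    have e2 : b * x * b = cfc (fun t => f t * t * f t) x := by
      rw [cfc_mul (fun t => f t * t) f x (by fun_prop) (by fun_prop),
        cfc_mul f (fun t => t) x (by fun_prop) (by fun_prop), cfc_id' ℝ x]
    have e3 : (D ^ 2) • (b * b) + c * c = cfc (fun t => (D ^ 2) • (f t * f t) + r t * r t) x := by
      rw [cfc_add x (fun t => (D ^ 2) • (f t * f t)) (fun t => r t * r t) (by fun_prop)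
        (by fun_prop), cfc_smul (D ^ 2) (fun t => f t * f t) x (by fun_prop),
        cfc_mul f f x (by fun_prop) (by fun_prop), cfc_mul r r x (by fun_prop) (by fun_prop)]
    rw [e2, e3]
    refine cfc_congr fun t _ => ?_
    show max (t - D ^ 2) 0 * t * max (t - D ^ 2) 0
      = D ^ 2 * (max (t - D ^ 2) 0 * max (t - D ^ 2) 0)
        + Real.sqrt (max (t - D ^ 2) 0) * max (t - D ^ 2) 0
          * (Real.sqrt (max (t - D ^ 2) 0) * max (t - D ^ 2) 0)
    have h1 := Real.mul_self_sqrt (le_max_right (t - D ^ 2) 0)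
    rw [mul_mul_mul_comm, h1]
    rcases le_total (t - D ^ 2) 0 with h2 | h2
    · rw [max_eq_right h2]; ring
    · rw [max_eq_left h2]; ring
  have hle : ∀ k, D * B.norm2 k b ≤ B.norm2 k (a * b) := by
    intro k
    have h1 : B.norm2 k (a * b) ^ 2 = D ^ 2 * B.norm2 k b ^ 2 + B.norm2 k c ^ 2 := by
      rw [norm2_sq, key, map_add, ContinuousMap.add_apply, map_smul, ContinuousMap.smul_apply,
        Complex.add_re, smul_eq_mul, Complex.re_ofReal_mul, ← norm2_sq, ← norm2_sq]
    refine abs_le_of_sq_le_sq' ?_ (norm2_nonneg _ _ _) |>.2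
    nlinarith [sq_nonneg (B.norm2 k c)]
  -- `D ‖b‖ ≤ ‖ab‖ ≤ C ‖b‖` with `C < D`
  have hb0 : B.norm2u b = 0 := by
    have h1 : B.norm2u b ≤ (C / D) * B.norm2u b := by
      refine (B.norm2u_le_iff b (by have := B.norm2u_nonneg b; positivity)).2 fun k => ?_
      have h2 := (hle k).trans ((B.norm2_le k _).trans (h b))
      rw [div_mul_eq_mul_div, le_div_iff₀ hD]
      linarith
    have h2 : C / D < 1 := (div_lt_one hD).2 hCD
    nlinarith [B.norm2u_nonneg b]
  have hb1 : b = 0 := B.faithful_norm2u hb0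
  have hnt : Nontrivial M := by
    by_contra hn
    rw [not_nontrivial_iff_subsingleton] at hn
    rw [Subsingleton.elim a 0, norm_zero] at hDa
    linarith
  -- but the spectrum of `b` contains `‖a‖² - D² > 0`
  have hmem : ‖a‖ ^ 2 ∈ spectrum ℝ x := by
    have h1 := CStarAlgebra.norm_mem_spectrum_of_nonneg (a := x) (star_mul_self_nonneg a)
    rwa [hx, CStarRing.norm_star_mul_self, ← sq] at h1
  have h3 : f (‖a‖ ^ 2) ∈ spectrum ℝ b := by
    rw [hb, cfc_map_spectrum f x]
    exact ⟨_, hmem, rfl⟩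
  rw [hb1, spectrum.zero_eq] at h3
  have h4 : max (‖a‖ ^ 2 - D ^ 2) 0 = 0 := h3
  have h5 : D ^ 2 < ‖a‖ ^ 2 := by gcongr
  have h6 := le_max_left (‖a‖ ^ 2 - D ^ 2) 0
  linarith

/-- Completeness of bounded subsets of `M` for the uniform 2-norm. -/
theorem exists_limit {x : ℕ → M} {C : ℝ} (hx : ∀ n, ‖x n‖ ≤ C) (hc : B.CauchySeq2 x) :
    ∃ a, ‖a‖ ≤ C ∧ B.NullSeq fun n => x n - a := by
  have hC : 0 ≤ C := (norm_nonneg _).trans (hx 0)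
  -- the unit ball is complete; rescale by `C + 1`, since `C` may be `0`
  set D : ℝ := C + 1
  have hD : 0 < D := by positivity
  have hnorm : ‖((D⁻¹ : ℝ) : ℂ)‖ = D⁻¹ := by
    rw [Complex.norm_real, Real.norm_of_nonneg (by positivity)]
  have hnormD : ‖((D : ℝ) : ℂ)‖ = D := by
    rw [Complex.norm_real, Real.norm_of_nonneg (by positivity)]
  obtain ⟨a, -, ha⟩ := B.complete (fun n => ((D⁻¹ : ℝ) : ℂ) • x n) (fun n => by
      rw [norm_smul, hnorm, inv_mul_le_iff₀ hD]
      linarith [hx n]) (fun ε hε => by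
      obtain ⟨N, hN⟩ := hc (D * ε) (by positivity)
      refine ⟨N, fun m hm n hn => ?_⟩
      rw [← smul_sub, norm2u_smul, hnorm, inv_mul_lt_iff₀ hD]
      exact hN m hm n hn)
  have hlim : B.NullSeq fun n => x n - (D : ℂ) • a := by
    have h := Tendsto.const_mul D ha
    rw [mul_zero] at h
    refine h.congr fun n => ?_
    calc D * B.norm2u (((D⁻¹ : ℝ) : ℂ) • x n - a)
        = ‖(D : ℂ)‖ * B.norm2u (((D⁻¹ : ℝ) : ℂ) • x n - a) := by rw [hnormD]
      _ = B.norm2u (x n - (D : ℂ) • a) := by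
        rw [← norm2u_smul, smul_sub, smul_smul, ← Complex.ofReal_mul, mul_inv_cancel₀ hD.ne',
          Complex.ofReal_one, one_smul]
  -- rescaling gives `‖D a‖ ≤ D` only; the bound `C` holds for left multiplication by the `x n`
  -- and passes to the limit
  refine ⟨(D : ℂ) • a, B.norm_le_of_opNormLE hC fun b => ?_, hlim⟩
  have h1 : Tendsto (fun n => C * B.norm2u b + B.norm2u (x n - (D : ℂ) • a) * ‖b‖) atTop
      (𝓝 (C * B.norm2u b + 0 * ‖b‖)) := (hlim.mul_const _).const_add _
  rw [zero_mul, add_zero] at h1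
  refine ge_of_tendsto' h1 fun n => ?_
  have e : (D : ℂ) • a * b = x n * b - (x n - (D : ℂ) • a) * b := by noncomm_ring
  rw [e]
  refine (norm2u_sub_le _ _ _).trans (add_le_add ?_ ?_)
  · exact (B.opNormLE (x n) b).trans (mul_le_mul_of_nonneg_right (hx n) (B.norm2u_nonneg b))
  · have := B.opNormLE (star b)
    rw [norm_star] at this
    rw [mul_comm (B.norm2u _)]
    exact this.right _

/-! ### Lifting from a fiber, and completeness of the fibers -/

/-- An element of the fiber over `k` of operator norm at most `C` has a lift of norm at most `C`:
cut off `b = v |b|` to `v min(|b|, C)`. -/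
theorem exists_norm_le_of_opNormLEAt (k : K) {C : ℝ} (hC : 0 < C) {b : M}
    (hb : B.OpNormLEAt k C b) : ∃ a, ‖a‖ ≤ C ∧ B.norm2 k (b - a) = 0 := by
  set x : M := star b * b with hx
  have hx0 : 0 ≤ x := star_mul_self_nonneg b
  have hxs : IsSelfAdjoint x := IsSelfAdjoint.star_mul_self b
  -- with `s = √t`: `s h(t) = min(s, C)`, and `t (1 - h)² = (t - C²) g²`, so that
  -- `|b - b h|² = |b g|² - C² |g|²`, which vanishes at `k` by the bound on `b`
  let h : ℝ → ℝ := fun t => C / max (Real.sqrt t) C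
  have hpos : ∀ t : ℝ, 0 < max (Real.sqrt t) C := fun t => lt_max_of_lt_right hC
  have hh : Continuous h := continuous_const.div (by fun_prop) fun t => (hpos t).ne'
  let g : ℝ → ℝ := fun t => Real.sqrt (max (Real.sqrt t - C) 0 / (Real.sqrt t + C))
  have hg : Continuous g := by
    refine Real.continuous_sqrt.comp (Continuous.div (by fun_prop) (by fun_prop) fun t => ?_)
    have := Real.sqrt_nonneg t
    positivity
  have hsa : ∀ p : ℝ → ℝ, star (cfc p x) = cfc p x := fun p =>
    (cfc_predicate p x : IsSelfAdjoint (cfc p x)).star_eq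
  have hmul : ∀ p : ℝ → ℝ, Continuous p →
      star (b * cfc p x) * (b * cfc p x) = cfc (fun t => p t * t * p t) x := by
    intro p hp
    rw [cfc_mul (fun t => p t * t) p x (by fun_prop) (by fun_prop),
      cfc_mul p (fun t => t) x (by fun_prop) (by fun_prop), cfc_id' ℝ x, star_mul, hsa, hx]
    noncomm_ring
  refine ⟨b * cfc h x, ?_, ?_⟩
  · have h1 : ‖b * cfc h x‖ ^ 2 ≤ C ^ 2 := by
      rw [sq, ← CStarRing.norm_star_mul_self, hmul h hh]
      refine norm_cfc_le (by positivity) fun t ht => ?_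
      have ht0 : 0 ≤ t := spectrum_nonneg_of_nonneg hx0 ht
      have e : h t * t * h t = (C * Real.sqrt t / max (Real.sqrt t) C) ^ 2 := by
        show C / max (Real.sqrt t) C * t * (C / max (Real.sqrt t) C) = _
        nth_rewrite 2 [← Real.mul_self_sqrt ht0]
        ring
      rw [e, Real.norm_of_nonneg (sq_nonneg _)]
      have h2 : C * Real.sqrt t / max (Real.sqrt t) C ≤ C := by
        rw [div_le_iff₀ (hpos t)]
        exact mul_le_mul_of_nonneg_left (le_max_left _ _) hC.le
      exact pow_le_pow_left₀ (div_nonneg (by positivity) (hpos t).le) h2 2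
    exact abs_le_of_sq_le_sq' h1 hC.le |>.2
  · have e1 : b - b * cfc h x = b * cfc (fun t => 1 - h t) x := by
      rw [cfc_sub (fun _ => (1 : ℝ)) h x (by fun_prop) (by fun_prop), cfc_const_one ℝ x, mul_sub,
        mul_one]
    have e2 : star (b - b * cfc h x) * (b - b * cfc h x)
        = star (b * cfc g x) * (b * cfc g x)
          - ((C ^ 2 : ℝ) : ℂ) • (star (cfc g x) * cfc g x) := by
      rw [e1, hmul _ (by fun_prop), hmul _ hg, hsa, ← cfc_mul g g x (by fun_prop) (by fun_prop),
        Complex.coe_smul, ← cfc_smul (C ^ 2) (fun t => g t * g t) x (by fun_prop),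
        ← cfc_sub (fun t => g t * t * g t) (fun t => (C ^ 2) • (g t * g t)) x (by fun_prop)
          (by fun_prop)]
      refine cfc_congr fun t ht => ?_
      have ht0 : 0 ≤ t := spectrum_nonneg_of_nonneg hx0 ht
      have hs := Real.sqrt_nonneg t
      have hst := Real.mul_self_sqrt ht0
      have hgg : g t * g t = max (Real.sqrt t - C) 0 / (Real.sqrt t + C) :=
        Real.mul_self_sqrt (div_nonneg (le_max_right _ _) (by positivity))
      show (1 - h t) * t * (1 - h t) = g t * t * g t - C ^ 2 * (g t * g t)
      have e3 : g t * t * g t - C ^ 2 * (g t * g t) = (t - C ^ 2) * (g t * g t) := by ring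
      rw [e3, hgg]
      show (1 - C / max (Real.sqrt t) C) * t * (1 - C / max (Real.sqrt t) C) = _
      set s := Real.sqrt t
      rcases le_total s C with h1 | h1
      · rw [max_eq_right h1, max_eq_right (by linarith), div_self hC.ne']; ring
      · have hs0 : 0 < s := hC.trans_le h1
        rw [max_eq_left h1, max_eq_left (by linarith), ← hst]
        field_simp
        ring
    have h1 : B.norm2 k (b - b * cfc h x) ^ 2 ≤ 0 := by
      rw [norm2_sq, e2, map_sub, ContinuousMap.sub_apply, map_smul, ContinuousMap.smul_apply,
        Complex.sub_re, smul_eq_mul, Complex.re_ofReal_mul, ← norm2_sq, ← norm2_sq, ← mul_pow,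
        sub_nonpos]
      exact pow_le_pow_left₀ (norm2_nonneg _ _ _) (hb _) 2
    exact pow_eq_zero_iff two_ne_zero |>.1 (le_antisymm h1 (sq_nonneg _))

/-- A convex combination, with coefficients depending on the point, of elements of norm at most `C`
acts on `L²` with norm at most `C`. -/
theorem norm2_incl_add_le (k : K) {C : ℝ} {b c : M} (hb : ‖b‖ ≤ C) (hc : ‖c‖ ≤ C) {f : C(K, ℝ)}
    (h0 : 0 ≤ f k) (h1 : f k ≤ 1) :
    B.OpNormLEAt k C (c + B.incl ((Complex.ofRealCLM : C(ℝ, ℂ)).comp f) * (b - c)) := by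
  intro y
  set F := (Complex.ofRealCLM : C(ℝ, ℂ)).comp f
  have e : (c + B.incl F * (b - c)) * y = B.incl (1 - F) * (c * y) + B.incl F * (b * y) := by
    rw [map_sub, map_one]; noncomm_ring
  rw [e]
  refine (norm2_add_le _ _ _ _).trans ?_
  have n1 := B.centralFunctions.norm2_incl_mul k (1 - F) (c * y)
  have n2 := B.centralFunctions.norm2_incl_mul k F (b * y)
  have f1 : ‖(1 - F) k‖ = 1 - f k := by
    have : (1 - F) k = ((1 - f k : ℝ) : ℂ) := by simp [F]
    rw [this, Complex.norm_real, Real.norm_of_nonneg (by linarith)]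
  have f2 : ‖F k‖ = f k := by
    have : F k = ((f k : ℝ) : ℂ) := rfl
    rw [this, Complex.norm_real, Real.norm_of_nonneg h0]
  rw [f1] at n1
  rw [f2] at n2
  refine (add_le_add n1.le n2.le).trans ?_
  have hy := norm2_nonneg B.toTracialExpectation k y
  have b1 : B.norm2 k (c * y) ≤ C * B.norm2 k y :=
    (B.norm2_mul_le k c y).trans (mul_le_mul_of_nonneg_right hc hy)
  have b2 : B.norm2 k (b * y) ≤ C * B.norm2 k y :=
    (B.norm2_mul_le k b y).trans (mul_le_mul_of_nonneg_right hb hy)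
  have h3 := mul_le_mul_of_nonneg_left b1 (sub_nonneg.2 h1)
  have h4 := mul_le_mul_of_nonneg_left b2 h0
  linarith

/-- Norm-bounded sequences in `M` that are Cauchy for the 2-seminorm at `k` converge: lifts of the
terms are corrected, one after the other, by central cut-off functions to a sequence that is Cauchy
for the uniform 2-norm. -/
theorem exists_fiber_limit (k : K) {x : ℕ → M} {C : ℝ} (hx : ∀ n, B.OpNormLEAt k C (x n))
    (hc : ∀ ε > 0, ∃ N, ∀ m ≥ N, ∀ n ≥ N, B.norm2 k (x m - x n) < ε) :
    ∃ a, Tendsto (fun n => B.norm2 k (x n - a)) atTop (𝓝 0) := by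
  -- a subsequence with summable increments
  choose N hN using fun j : ℕ => hc ((1 / 2) ^ j) (by positivity)
  let m : ℕ → ℕ := fun j => j + ∑ i ∈ Finset.range (j + 1), N i
  have hm : ∀ j, N j ≤ m j := fun j =>
    (Finset.single_le_sum (f := N) (fun _ _ => Nat.zero_le _) (Finset.self_mem_range_succ j)).trans
      (Nat.le_add_left _ _)
  have hm' : ∀ j, N j ≤ m (j + 1) := fun j => by
    refine (hm j).trans ?_
    simp only [m]
    rw [Finset.sum_range_succ _ (j + 1)]
    omega
  have hD : 0 < max C 1 := lt_max_of_lt_right one_pos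
  choose b hb1 hb2 using fun j => B.exists_norm_le_of_opNormLEAt k hD (b := x (m j))
    fun y => (hx (m j) y).trans
      (mul_le_mul_of_nonneg_right (le_max_left C 1) (norm2_nonneg _ _ _))
  have hbx : ∀ j, B.norm2 k (b (j + 1) - b j) ≤ (1 / 2) ^ j := by
    intro j
    have e : b (j + 1) - b j
        = -(x (m (j + 1)) - b (j + 1)) + (x (m j) - b j) + (x (m (j + 1)) - x (m j)) := by abel
    rw [e]
    refine (norm2_add_le _ _ _ _).trans (add_le_of_nonpos_of_le ?_ (hN j _ (hm' j) _ (hm j)).le)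
    refine (norm2_add_le _ _ _ _).trans ?_
    rw [norm2_neg, hb2, hb2, add_zero]
  -- if `c` represents the `j`-th term in the fiber, then moving `c` towards `b_{j+1}` by a cut-off
  -- function `f` with `f(k) = 1` changes it uniformly by at most `2^{-j}`
  have step : ∀ (c : M) (j : ℕ), ∃ c' : M, ‖c‖ ≤ max C 1 → B.norm2 k (c - b j) = 0 →
      ‖c'‖ ≤ max C 1 ∧ B.norm2 k (c' - b (j + 1)) = 0 ∧ B.norm2u (c' - c) ≤ (1 / 2) ^ j := by
    intro c j
    by_cases hcj : B.norm2 k (c - b j) = 0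
    swap
    · exact ⟨0, fun _ h => absurd h hcj⟩
    have h1 : B.norm2 k (b (j + 1) - c) ≤ (1 / 2) ^ j := by
      have := B.norm2_sub_le_sub k (b (j + 1)) (b j) c
      rw [norm2_sub_comm _ _ (b j) c, hcj, add_zero] at this
      exact this.trans (hbx j)
    obtain ⟨f, f0, f1, fk, hf⟩ := B.centralFunctions.exists_truncation k _ (by positivity) h1
    refine ⟨c + B.incl ((Complex.ofRealCLM : C(ℝ, ℂ)).comp f) * (b (j + 1) - c), fun hcn _ =>
      ⟨?_, ?_, ?_⟩⟩
    · exact B.norm_le_of_opNormLE hD.le (opNormLE_of_opNormLEAt hD.le fun l =>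
        B.norm2_incl_add_le l (hb1 _) hcn (f0 l) (f1 l))
    · have h2 := B.centralFunctions.norm2_incl_mul_sub_smul k
        ((Complex.ofRealCLM : C(ℝ, ℂ)).comp f) (b (j + 1) - c)
      have h3 : ((Complex.ofRealCLM : C(ℝ, ℂ)).comp f) k = 1 := by simp [fk]
      rw [h3, one_smul] at h2
      rw [← h2]
      congr 1
      show _ = B.incl _ * _ - _
      abel
    · rw [add_sub_cancel_left]
      exact (B.norm2u_le_iff _ (by positivity)).2 hf
  choose F hF using step
  let c : ℕ → M := fun j => Nat.rec (b 0) (fun j c => F c j) j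
  have hc0 : ∀ j, ‖c j‖ ≤ max C 1 ∧ B.norm2 k (c j - b j) = 0 := by
    intro j
    induction j with
    | zero => exact ⟨hb1 0, by simp [c]⟩
    | succ j ih => exact ⟨(hF _ j ih.1 ih.2).1, (hF _ j ih.1 ih.2).2.1⟩
  have hcs : ∀ j, B.norm2u (c (j + 1) - c j) ≤ (1 / 2) ^ j := fun j =>
    (hF _ j (hc0 j).1 (hc0 j).2).2.2
  have hcc : B.CauchySeq2 c := cauchySeq2_of_le_geometric (m := 0) fun j _ => hcs j
  obtain ⟨a, -, ha⟩ := B.exists_limit (fun j => (hc0 j).1) hcc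
  refine ⟨a, ?_⟩
  have hma : Tendsto (fun j => B.norm2 k (x (m j) - a)) atTop (𝓝 0) := by
    refine squeeze_zero (fun _ => norm2_nonneg _ _ _) (fun j => ?_) ha
    refine le_trans ?_ (B.norm2_le k _)
    have e : x (m j) - a = (x (m j) - b j) + (-(c j - b j)) + (c j - a) := by abel
    rw [e]
    refine (norm2_add_le _ _ _ _).trans (add_le_of_nonpos_of_le ?_ le_rfl)
    refine (norm2_add_le _ _ _ _).trans ?_
    rw [norm2_neg, hb2, (hc0 j).2, add_zero]
  -- the whole sequence converges along with its subsequence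
  rw [Metric.tendsto_atTop]
  intro ε hε
  obtain ⟨j0, hj0⟩ := hc (ε / 2) (half_pos hε)
  refine ⟨j0, fun n hn => ?_⟩
  rw [Real.dist_eq, sub_zero, abs_of_nonneg (norm2_nonneg _ _ _)]
  have hmj : Tendsto m atTop atTop := tendsto_atTop_mono (fun j => Nat.le_add_right _ _) tendsto_id
  obtain ⟨j, hj1, hj2⟩ := ((hma.eventually (gt_mem_nhds (half_pos hε))).and
    (hmj.eventually_ge_atTop j0)).exists
  linarith [B.norm2_sub_le_sub k (x n) (x (m j)) a, hj0 n hn (m j) hj2]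

end

end WStarBundle

end

end EquivariantBundle

namespace EquivariantBundle

noncomputable section

open TracialExpectation

/-! ### Maps between strict completions -/

namespace TracialExpectation

section

variable {K A : Type*} [TopologicalSpace K] [CompactSpace K] [Ring A] [StarRing A] [Algebra ℂ A]
  [StarModule ℂ A] {T : TracialExpectation K A}

theorem completion_bdd (q : T.Completion) : T.completion.Bdd q := by
  obtain ⟨x, rfl⟩ := cls_surjective q
  obtain ⟨C, hC, h⟩ := bddCauchy_bddSeq x
  exact ⟨C, hC, OpNormLE.completion_cls fun n => (h n).1,
    OpNormLE.completion_cls (x := star x) fun n => (h n).2⟩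

variable {L A' : Type*} [TopologicalSpace L] [CompactSpace L] [Ring A'] [StarRing A']
  [Algebra ℂ A'] [StarModule ℂ A'] {T' : TracialExpectation L A'}

/-- A `*`-homomorphism that is bounded for the uniform 2-norms and for the norms of left
multiplication acts on bounded Cauchy sequences. -/
def bddCauchyHom (ρ : A →⋆ₐ[ℂ] A') (h2 : ∀ a, T'.norm2u (ρ a) ≤ T.norm2u a)
    (hop : ∀ C a, 0 ≤ C → T.OpNormLE C a → T'.OpNormLE C (ρ a)) (x : T.bddCauchy) :
    T'.bddCauchy :=
  ⟨fun n => ρ ((x : ℕ → A) n), by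
    obtain ⟨⟨C, hC, h⟩, h'⟩ := x.2
    refine ⟨⟨C, hC, fun n => ⟨hop C _ hC (h n).1, ?_⟩⟩, fun ε hε => ?_⟩
    · rw [← map_star]
      exact hop C _ hC (h n).2
    · obtain ⟨N, hN⟩ := h' ε hε
      refine ⟨N, fun m hm n hn => ?_⟩
      rw [← map_sub]
      exact (h2 _).trans_lt (hN m hm n hn)⟩

/-- The `*`-homomorphism induced on strict completions. -/
def completionHom (ρ : A →⋆ₐ[ℂ] A') (h2 : ∀ a, T'.norm2u (ρ a) ≤ T.norm2u a)
    (hop : ∀ C a, 0 ≤ C → T.OpNormLE C a → T'.OpNormLE C (ρ a)) :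
    T.Completion →⋆ₐ[ℂ] T'.Completion where
  toFun := Quotient.map' (bddCauchyHom ρ h2 hop) fun x y (h : T.NullSeq _) => by
    show T'.NullSeq _
    refine squeeze_zero (fun _ => norm2u_nonneg _ _) (fun n => ?_) h
    have := h2 ((x : ℕ → A) n - (y : ℕ → A) n)
    rw [map_sub] at this
    exact this
  map_one' := congrArg T'.cls (Subtype.ext (funext fun _ => map_one ρ))
  map_mul' := by
    rintro ⟨x⟩ ⟨y⟩
    exact congrArg T'.cls (Subtype.ext (funext fun _ => map_mul ρ _ _))
  map_zero' := congrArg T'.cls (Subtype.ext (funext fun _ => map_zero ρ))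
  map_add' := by
    rintro ⟨x⟩ ⟨y⟩
    exact congrArg T'.cls (Subtype.ext (funext fun _ => map_add ρ _ _))
  commutes' c := congrArg T'.cls (Subtype.ext (funext fun _ => AlgHomClass.commutes ρ c))
  map_star' := by
    rintro ⟨x⟩
    exact congrArg T'.cls (Subtype.ext (funext fun _ => map_star ρ _))

theorem completionHom_cls (ρ : A →⋆ₐ[ℂ] A') (h2 : ∀ a, T'.norm2u (ρ a) ≤ T.norm2u a)
    (hop : ∀ C a, 0 ≤ C → T.OpNormLE C a → T'.OpNormLE C (ρ a)) (x : T.bddCauchy) :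
    completionHom ρ h2 hop (T.cls x) = T'.cls (bddCauchyHom ρ h2 hop x) := rfl

end

end TracialExpectation

/-- Two surjective `*`-homomorphisms with the same kernel have isomorphic images. -/
theorem exists_starAlgEquiv_of_ker_eq {A B C : Type*} [Ring A] [StarRing A] [Algebra ℂ A]
    [Ring B] [StarRing B] [Algebra ℂ B] [Ring C] [StarRing C] [Algebra ℂ C]
    (p : A →⋆ₐ[ℂ] B) (q : A →⋆ₐ[ℂ] C) (hp : Function.Surjective p) (hq : Function.Surjective q)
    (h : ∀ a, p a = 0 ↔ q a = 0) : ∃ e : B ≃⋆ₐ[ℂ] C, ∀ a, e (p a) = q a := by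
  have hpq : ∀ a b, p a = p b ↔ q a = q b := fun a b => by
    rw [← sub_eq_zero, ← map_sub, h, map_sub, sub_eq_zero]
  choose s hs using hp
  choose t ht using hq
  have key : ∀ a, q (s (p a)) = q a := fun a => (hpq _ _).1 (hs _)
  refine ⟨
    { toFun := fun b => q (s b)
      invFun := fun c => p (t c)
      left_inv := fun b => ((hpq _ (s b)).2 (ht _)).trans (hs b)
      right_inv := fun c => (key _).trans (ht c)
      map_mul' := fun x y => by rw [← map_mul, ← hpq, map_mul, hs, hs, hs]
      map_add' := fun x y => by rw [← map_add, ← hpq, map_add, hs, hs, hs]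
      map_star' := fun x => by rw [← map_star, ← hpq, map_star, hs, hs]
      map_smul' := fun c x => by rw [← map_smul, ← hpq, map_smul, hs, hs] }, key⟩

/-! ### Fibers -/

namespace WStarBundle

section

variable {K M : Type*} [TopologicalSpace K] [CompactSpace K] [CStarAlgebra M]
  [PartialOrder M] [StarOrderedRing M] (B : WStarBundle K M) (k : K)

theorem norm2_proj (a : M) : (B.fiberTrace k).norm2 () (B.proj k a) = B.norm2 k a := by
  rw [norm2, ← map_star, ← map_mul, B.fiberTrace_proj]
  rfl

theorem proj_eq_zero_iff (a : M) : B.proj k a = 0 ↔ B.norm2 k a = 0 := by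
  constructor
  · intro h
    rw [← B.norm2_proj, h, norm2_zero]
  · intro h
    refine B.fiberVal_injective k ?_
    rw [map_zero, B.fiberVal_proj, B.gns_eq_zero_iff]
    intro b
    have h1 : B.norm2 k (a * b) = 0 :=
      le_antisymm ((B.norm2_mul_le' k a b).trans_eq (by rw [h, zero_mul])) (norm2_nonneg _ _ _)
    rw [E_star_mul_self, h1]
    simp

theorem opNormLEAt_proj {C : ℝ} {a : M} :
    (B.fiberTrace k).OpNormLEAt () C (B.proj k a) ↔ B.OpNormLEAt k C a := by
  constructor
  · intro h b
    simpa only [← map_mul, norm2_proj] using h (B.proj k b)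
  · intro h x
    obtain ⟨b, rfl⟩ := B.proj_surjective k x
    simpa only [← map_mul, norm2_proj] using h b

/-- A `*`-homomorphism from `M` to a strict completion that is isometric for the 2-seminorm at `k`
is onto if its range contains the bounded elements of the algebra that is completed, since bounded
subsets of the fiber are complete. -/
theorem surjective_of_const_mem_range {D : Type*} [Ring D] [StarRing D] [Algebra ℂ D]
    [StarModule ℂ D] {T : TracialExpectation Unit D} (ψ : M →⋆ₐ[ℂ] T.Completion)
    (hψ : ∀ a, T.completion.norm2u (ψ a) = B.norm2 k a)
    (hm : ∀ x (hx : T.Bdd x), ∃ m, ψ m = T.const x hx) : Function.Surjective ψ := by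
  intro q
  obtain ⟨y, rfl⟩ := cls_surjective q
  obtain ⟨C, hC, hy⟩ := bddCauchy_bddSeq y
  choose m hm using fun n => hm ((y : ℕ → D) n) (bddCauchy_bdd y n)
  have hmC : ∀ n, B.OpNormLEAt k C (m n) := by
    intro n b
    rw [← hψ, ← hψ, map_mul, hm]
    exact OpNormLE.completion_const (hy n).1 _ (ψ b)
  have hmc : ∀ ε > 0, ∃ N, ∀ i ≥ N, ∀ j ≥ N, B.norm2 k (m i - m j) < ε := by
    intro ε hε
    obtain ⟨N, hN⟩ := bddCauchy_cauchySeq2 y ε hε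
    refine ⟨N, fun i hi j hj => ?_⟩
    rw [← hψ, map_sub, hm, hm, const_sub, norm2u_const]
    exact hN i hi j hj
  obtain ⟨a, ha⟩ := B.exists_fiber_limit k hmC hmc
  refine ⟨a, (eq_of_norm2u_sub_eq_zero ?_).symm⟩
  have h1 := (tendsto_norm2u_cls_sub_const y).add ha
  rw [add_zero] at h1
  refine le_antisymm (ge_of_tendsto' h1 fun n => ?_) (norm2u_nonneg _ _)
  refine (norm2u_sub_le_sub _ _ _ _).trans (add_le_add le_rfl ?_)
  rw [← hm n, ← map_sub, hψ]

variable {R : Type*} [Ring R] [StarRing R] [Algebra ℂ R] [StarModule ℂ R]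
  (S : TracialExpectation Unit R)

theorem tensor_E_tensorMap_proj (z : M ⊗[ℂ] R) :
    ((B.fiberTrace k).tensor S).E (tensorMap R (B.proj k) z) ()
      = (B.toTracialExpectation.tensor S).E z k := by
  induction z with
  | zero => simp only [map_zero]; rfl
  | add x y hx hy => simp only [map_add, ContinuousMap.add_apply, hx, hy]
  | tmul a r =>
    rw [tensorMap_tmul, tensor_E_tmul, tensor_E_tmul, B.fiberTrace_proj]
    rfl

theorem norm2_tensorMap_proj (z : M ⊗[ℂ] R) :
    ((B.fiberTrace k).tensor S).norm2 () (tensorMap R (B.proj k) z)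
      = (B.toTracialExpectation.tensor S).norm2 k z := by
  rw [norm2, ← map_star, ← map_mul, B.tensor_E_tensorMap_proj]
  rfl

theorem tensorMap_proj_surjective : Function.Surjective (tensorMap R (B.proj k)) := by
  intro z
  induction z with
  | zero => exact ⟨0, map_zero _⟩
  | add x y hx hy =>
    obtain ⟨a, rfl⟩ := hx
    obtain ⟨b, rfl⟩ := hy
    exact ⟨a + b, map_add _ _ _⟩
  | tmul x r =>
    obtain ⟨a, rfl⟩ := B.proj_surjective k x
    exact ⟨a ⊗ₜ r, rfl⟩

theorem bdd_tensor (hR : ∀ r, S.Bdd r) (z : M ⊗[ℂ] R) :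
    (B.toTracialExpectation.tensor S).Bdd z := by
  induction z with
  | zero => exact Bdd.zero
  | add x y hx hy => exact hx.add hy
  | tmul a r =>
    obtain ⟨C, hC, h1, h2⟩ := hR r
    have h (b : R) (hb : S.OpNormLE C b) : S.OpNormLEAt () C b := fun c => by
      simpa only [norm2u_unit] using hb c
    rw [show a ⊗ₜ[ℂ] r = (a ⊗ₜ 1) * (1 ⊗ₜ r) by simp]
    refine Bdd.mul (Bdd.of_opNormLEAt (norm_nonneg a) (norm_nonneg (star a))
      (fun l => (B.opNormLEAt l a).tmul_one (norm_nonneg a)) fun l => ?_)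
      (Bdd.of_opNormLEAt hC hC (fun l => (h r h1).one_tmul hC l) fun l => ?_)
    · rw [TensorProduct.star_tmul, star_one]
      exact (B.opNormLEAt l (star a)).tmul_one (norm_nonneg _)
    · rw [TensorProduct.star_tmul, star_one]
      exact (h (star r) h2).one_tmul hC l

theorem norm2u_tensorMap_proj_le (z : M ⊗[ℂ] R) :
    ((B.fiberTrace k).tensor S).norm2u (tensorMap R (B.proj k) z)
      ≤ (B.toTracialExpectation.tensor S).norm2u z := by
  rw [norm2u_unit, B.norm2_tensorMap_proj]
  exact norm2_le _ _ _

theorem opNormLE_tensorMap_proj (C : ℝ) (z : M ⊗[ℂ] R) (hC : 0 ≤ C)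
    (hz : (B.toTracialExpectation.tensor S).OpNormLE C z) :
    ((B.fiberTrace k).tensor S).OpNormLE C (tensorMap R (B.proj k) z) := fun w => by
  obtain ⟨w, rfl⟩ := B.tensorMap_proj_surjective k w
  rw [norm2u_unit, norm2u_unit, ← map_mul, B.norm2_tensorMap_proj, B.norm2_tensorMap_proj]
  exact (B.centralFunctions.tensor S).opNormLEAt_of_opNormLE hC hz k w

/-- Restriction to the fiber over `k`, from the strict completion of `M ⊗ R` to that of
`M_k ⊗ R`. -/
def fiberCompletionHom : (B.toTracialExpectation.tensor S).Completion →⋆ₐ[ℂ]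
    ((B.fiberTrace k).tensor S).Completion :=
  completionHom (tensorMap R (B.proj k))
    (B.norm2u_tensorMap_proj_le k S) (B.opNormLE_tensorMap_proj k S)

theorem fiberCompletionHom_const {w : M ⊗[ℂ] R} (hw : (B.toTracialExpectation.tensor S).Bdd w)
    {z : B.Fiber k ⊗[ℂ] R} (hz : ((B.fiberTrace k).tensor S).Bdd z)
    (h : tensorMap R (B.proj k) w = z) :
    B.fiberCompletionHom k S ((B.toTracialExpectation.tensor S).const w hw)
      = ((B.fiberTrace k).tensor S).const z hz :=
  congrArg ((B.fiberTrace k).tensor S).cls (Subtype.ext (funext fun _ => h))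

theorem completion_E_fiberCompletionHom (q : (B.toTracialExpectation.tensor S).Completion) :
    ((B.fiberTrace k).tensor S).completion.E (B.fiberCompletionHom k S q) ()
      = (B.toTracialExpectation.tensor S).completion.E q k := by
  obtain ⟨x, rfl⟩ := cls_surjective q
  rw [fiberCompletionHom, completionHom_cls]
  refine tendsto_nhds_unique
    (((continuous_eval_const (F := C(Unit, ℂ)) ()).tendsto _).comp (completion_E_cls _)) ?_
  refine (((continuous_eval_const (F := C(K, ℂ)) k).tendsto _).comp (completion_E_cls x)).congr
    fun n => ?_
  exact (B.tensor_E_tensorMap_proj k S _).symm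

/-- Cocycle conjugacy of a system with its tensor product by a given action passes to the fibers.
The isomorphism `φ` induces a map `M → M_k ⊗̄ R` with the kernel of `π_k`, and this map is onto
because bounded subsets of the fiber are complete. -/
theorem cocycleConjugate_fiber {G : Type*} [Group G] (γ : FiberwiseAction G B)
    (hR : ∀ r, S.Bdd r) (δ : TracialAction G S)
    (h : CocycleConjugate γ.toTracialAction (γ.toTracialAction.tensor δ).completion) :
    CocycleConjugate (γ.fiber k) ((γ.fiber k).tensor δ).completion := by
  obtain ⟨u, hu, φ, hφE, hφ⟩ := h
  set r := B.fiberCompletionHom k S with hr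
  -- `ψ` is `φ` followed by restriction to the fiber
  let ψ : M →⋆ₐ[ℂ] ((B.fiberTrace k).tensor S).Completion := r.comp (φ : M →⋆ₐ[ℂ] _)
  have hψ : ∀ a, ψ a = r (φ a) := fun a => rfl
  have hψE : ∀ a, ((B.fiberTrace k).tensor S).completion.E (ψ a) () = B.E a k := fun a => by
    rw [hψ, hr, completion_E_fiberCompletionHom, hφE]
  have hψ2 : ∀ a, ((B.fiberTrace k).tensor S).completion.norm2 () (ψ a) = B.norm2 k a := fun a => by
    rw [norm2, ← map_star, ← map_mul, hψE]
    rfl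
  have hker : ∀ a, B.proj k a = 0 ↔ ψ a = 0 := fun a => by
    rw [proj_eq_zero_iff, ← hψ2]
    refine ⟨fun h0 => eq_zero_of_norm2u_eq_zero (by rw [norm2u_unit, h0]), fun h0 => ?_⟩
    rw [h0, norm2_zero]
  have hsurj : Function.Surjective ψ := by
    refine B.surjective_of_const_mem_range k ψ (fun a => by rw [norm2u_unit, hψ2]) fun x hx => ?_
    obtain ⟨w, hw⟩ := B.tensorMap_proj_surjective k x
    obtain ⟨m, hm⟩ : ∃ m, φ m = (B.toTracialExpectation.tensor S).const w (B.bdd_tensor S hR w) :=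
      φ.surjective _
    refine ⟨m, ?_⟩
    rw [hψ, hm]
    exact B.fiberCompletionHom_const k S _ _ hw
  -- `ψ` factors through an isomorphism `e` on the fiber, which intertwines the actions
  obtain ⟨e, he⟩ := exists_starAlgEquiv_of_ker_eq (B.proj k) ψ (B.proj_surjective k) hsurj hker
  have hact : ∀ g q, ((γ.fiber k).tensor δ).completion.act g (r q)
      = r ((γ.toTracialAction.tensor δ).completion.act g q) := by
    intro g q
    obtain ⟨x, rfl⟩ := cls_surjective q
    refine congrArg ((B.fiberTrace k).tensor S).cls (Subtype.ext (funext fun n => ?_))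
    show tensorEquiv ((γ.fiber k).act g) (δ.act g) (tensorMap R (B.proj k) _)
      = tensorMap R (B.proj k) (tensorEquiv (γ.act g) (δ.act g) _)
    generalize (x : ℕ → M ⊗[ℂ] R) n = z
    induction z with
    | zero => simp only [map_zero]
    | add x y hx hy => simp only [map_add, hx, hy]
    | tmul a b =>
      simp only [tensorMap_tmul, tensorEquiv_tmul]
      congr 1
      exact γ.fiberMap_apply k g a
  refine ⟨fun g => ⟨B.proj k (u g), Unitary.mem_iff.2
    ⟨by rw [← map_star, ← map_mul, Unitary.coe_star_mul_self, map_one],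
      by rw [← map_star, ← map_mul, Unitary.mul_star_self_of_mem (u g).2, map_one]⟩⟩,
    fun g h => ?_, e, fun x => ?_, fun g x => ?_⟩
  · show B.proj k (u (g * h)) = B.proj k (u g) * γ.fiberMap k g (B.proj k (u h))
    rw [γ.fiberMap_apply, hu, map_mul]
  · obtain ⟨a, rfl⟩ := B.proj_surjective k x
    ext
    rw [he, hψE, B.fiberTrace_proj]
    rfl
  · obtain ⟨a, rfl⟩ := B.proj_surjective k x
    have h1 : (γ.fiber k).act g (B.proj k a) = B.proj k (γ.act g a) := γ.fiberMap_apply k g a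
    have h2 : B.proj k (u g * γ.act g a * star (u g : M))
        = B.proj k (u g) * (γ.fiber k).act g (B.proj k a) * star (B.proj k (u g)) := by
      rw [map_mul, map_mul, map_star, h1]
    rw [he, hψ, hact, hφ, ← hψ, ← he]
    exact congrArg e h2

end

end WStarBundle

end

end EquivariantBundle

namespace EquivariantBundle

noncomputable section

open TracialExpectation

/-! ### Matrix subalgebras of the hyperfinite factor -/

/-- The element of `⋃ₙ M_d^{⊗ n}` given by a matrix in `M_d^{⊗ N}`, as a sequence that is zero
below level `N`. -/
def levelSeq (d N : ℕ) (X : MatrixTensor d N) : ∀ k, MatrixTensor d k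
  | 0 => if h : N = 0 then h ▸ X else 0
  | k + 1 => if h : N = k + 1 then h ▸ X else ampl d k (levelSeq d N X k)

theorem levelSeq_self (d N : ℕ) (X : MatrixTensor d N) : levelSeq d N X N = X := by
  cases N <;> simp [levelSeq]

theorem levelSeq_succ (d N : ℕ) (X : MatrixTensor d N) {k : ℕ} (hk : N ≤ k) :
    levelSeq d N X (k + 1) = ampl d k (levelSeq d N X k) := by
  rw [levelSeq, dif_neg (by omega)]

/-- `levelSeq` as an element of `⋃ₙ M_d^{⊗ n}`. -/
def levelUnion (d N : ℕ) (X : MatrixTensor d N) : matrixUnion d :=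
  ⟨levelSeq d N X, N, fun _ hn => levelSeq_succ d N X hn⟩

theorem levelSeq_mul (d N : ℕ) (X Y : MatrixTensor d N) (k : ℕ) :
    levelSeq d N (X * Y) k = levelSeq d N X k * levelSeq d N Y k := by
  induction k with
  | zero =>
    by_cases h : N = 0
    · subst h; rfl
    · simp [levelSeq, h]
  | succ k ih =>
    by_cases h : N = k + 1
    · subst h; simp [levelSeq]
    · rw [levelSeq, levelSeq, levelSeq, dif_neg h, dif_neg h, dif_neg h, ih, ampl_mul]

theorem levelSeq_add (d N : ℕ) (X Y : MatrixTensor d N) (k : ℕ) :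
    levelSeq d N (X + Y) k = levelSeq d N X k + levelSeq d N Y k := by
  induction k with
  | zero =>
    by_cases h : N = 0
    · subst h; rfl
    · simp [levelSeq, h]
  | succ k ih =>
    by_cases h : N = k + 1
    · subst h; simp [levelSeq]
    · rw [levelSeq, levelSeq, levelSeq, dif_neg h, dif_neg h, dif_neg h, ih, ampl_add]

theorem levelSeq_smul (d N : ℕ) (c : ℂ) (X : MatrixTensor d N) (k : ℕ) :
    levelSeq d N (c • X) k = c • levelSeq d N X k := by
  induction k with
  | zero =>
    by_cases h : N = 0
    · subst h; rfl
    · simp [levelSeq, h]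
  | succ k ih =>
    by_cases h : N = k + 1
    · subst h; simp [levelSeq]
    · rw [levelSeq, levelSeq, dif_neg h, dif_neg h, ih, ampl, ampl, Matrix.smul_kronecker]

theorem levelSeq_star (d N : ℕ) (X : MatrixTensor d N) (k : ℕ) :
    levelSeq d N (star X) k = star (levelSeq d N X k) := by
  induction k with
  | zero =>
    by_cases h : N = 0
    · subst h; rfl
    · simp [levelSeq, h]
  | succ k ih =>
    by_cases h : N = k + 1
    · subst h; simp [levelSeq]
    · rw [levelSeq, levelSeq, dif_neg h, dif_neg h, ih, ampl_star]

theorem levelUnion_mul (d N : ℕ) (X Y : MatrixTensor d N) :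
    levelUnion d N (X * Y) = levelUnion d N X * levelUnion d N Y :=
  Subtype.ext (funext (levelSeq_mul d N X Y))

theorem levelUnion_add (d N : ℕ) (X Y : MatrixTensor d N) :
    levelUnion d N (X + Y) = levelUnion d N X + levelUnion d N Y :=
  Subtype.ext (funext (levelSeq_add d N X Y))

theorem levelUnion_smul (d N : ℕ) (c : ℂ) (X : MatrixTensor d N) :
    levelUnion d N (c • X) = c • levelUnion d N X :=
  Subtype.ext (funext (levelSeq_smul d N c X))

theorem levelUnion_star (d N : ℕ) (X : MatrixTensor d N) :
    levelUnion d N (star X) = star (levelUnion d N X) :=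
  Subtype.ext (funext (levelSeq_star d N X))

/-- Sequences that vanish eventually represent zero. -/
theorem norm2u_eq_zero_of_eventually (d : ℕ) (x : matrixUnion d) (h : ∀ᶠ n in atTop, x.1 n = 0) :
    (unionExpectation d).norm2u x = 0 := by
  have h1 : unionTrace d (star x * x) = 0 := by
    refine tendsto_nhds_unique (tendsto_unionTrace d _) (tendsto_const_nhds.congr' ?_)
    filter_upwards [h] with n hn
    show 0 = normTrace d n (star (x.1 n) * x.1 n)
    rw [hn]
    simp [normTrace]
  rw [norm2u_unit, norm2]
  show Real.sqrt (unionTrace d (star x * x)).re = 0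
  rw [h1, Complex.zero_re, Real.sqrt_zero]

theorem bdd_levelUnion (d N : ℕ) (X : MatrixTensor d N) :
    (unionExpectation d).Bdd (levelUnion d N X) := by
  have hone : ∀ p q, (unionExpectation d).Bdd (levelUnion d N (Matrix.single p q 1)) := by
    have key : ∀ p q (k : Unit),
        (unionExpectation d).OpNormLEAt k 1 (levelUnion d N (Matrix.single p q 1)) := by
      intro p q k
      refine OpNormLEAt.of_isIdempotent ?_
      rw [← levelUnion_star, ← levelUnion_mul, ← levelUnion_mul, Matrix.star_eq_conjTranspose,
        Matrix.conjTranspose_single, star_one, Matrix.single_mul_single_same,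
        Matrix.single_mul_single_same, one_mul, one_mul]
    refine fun p q => Bdd.of_opNormLEAt zero_le_one zero_le_one (key p q) ?_
    rw [← levelUnion_star, Matrix.star_eq_conjTranspose, Matrix.conjTranspose_single, star_one]
    exact key q p
  let L : MatrixTensor d N →ₗ[ℂ] matrixUnion d :=
    { toFun := levelUnion d N
      map_add' := levelUnion_add d N
      map_smul' := levelUnion_smul d N }
  have : levelUnion d N X = ∑ p, ∑ q, X p q • levelUnion d N (Matrix.single p q 1) := by
    show L X = ∑ p, ∑ q, X p q • L (Matrix.single p q 1)
    conv_lhs => rw [Matrix.matrix_eq_sum_single X]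
    simp only [map_sum, ← map_smul, Matrix.smul_single, smul_eq_mul, mul_one]
  rw [this]
  exact Bdd.sum _ _ fun p _ => Bdd.sum _ _ fun q _ => (hone p q).smul _

theorem const_eq_const_of_eventually (d : ℕ) {x y : matrixUnion d}
    (hx : (unionExpectation d).Bdd x) (hy : (unionExpectation d).Bdd y)
    (h : ∀ᶠ n in atTop, x.1 n = y.1 n) :
    (unionExpectation d).const x hx = (unionExpectation d).const y hy := by
  refine eq_of_norm2u_sub_eq_zero ?_
  rw [const_sub, norm2u_const]
  refine norm2u_eq_zero_of_eventually d _ ?_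
  filter_upwards [h] with n hn
  exact sub_eq_zero.2 hn

theorem levelSeq_algebraMap (d N : ℕ) (c : ℂ) {k : ℕ} (hk : N ≤ k) :
    levelSeq d N (algebraMap ℂ _ c) k = algebraMap ℂ _ c := by
  induction k, hk using Nat.le_induction with
  | base => exact levelSeq_self d N _
  | succ k hk ih => rw [levelSeq_succ d N _ hk, ih, ampl_algebraMap]

/-- The inclusion of `M_d^{⊗ N}` into the hyperfinite factor. -/
def level (d N : ℕ) : MatrixTensor d N →⋆ₐ[ℂ] Hyperfinite d where
  toFun X := (unionExpectation d).const (levelUnion d N X) (bdd_levelUnion d N X)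
  map_one' := by
    rw [← cls_one]
    have h := const_eq_const_of_eventually d (bdd_levelUnion d N 1)
      (by simpa using Bdd.algebraMap (T := unionExpectation d) 1 :
        (unionExpectation d).Bdd 1) (eventually_atTop.2 ⟨N, fun k hk => by
          have := levelSeq_algebraMap d N 1 hk
          rw [map_one, map_one] at this
          exact this⟩)
    exact h
  map_mul' X Y := by
    simp only [levelUnion_mul]
    exact (const_mul _ _).symm
  map_zero' := by
    have h := const_eq_const_of_eventually d (bdd_levelUnion d N 0) Bdd.zero
      (eventually_atTop.2 ⟨N, fun k hk => by
          have := levelSeq_algebraMap d N 0 hk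
          rw [map_zero, map_zero] at this
          exact this⟩)
    exact h
  map_add' X Y := by
    simp only [levelUnion_add]
    exact (const_add _ _).symm
  commutes' c :=
    const_eq_const_of_eventually d (bdd_levelUnion d N _) (Bdd.algebraMap c)
      (eventually_atTop.2 ⟨N, fun k hk => levelSeq_algebraMap d N c hk⟩)
  map_star' X := by
    simp only [levelUnion_star]
    exact (const_star _).symm

theorem level_apply (d N : ℕ) (X : MatrixTensor d N) :
    level d N X = (unionExpectation d).const (levelUnion d N X) (bdd_levelUnion d N X) := rfl

/-- Elements of `⋃ₙ M_d^{⊗ n}` that are stationary from level `N` on. -/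
theorem const_eq_level (d N : ℕ) {x : matrixUnion d} (hx : (unionExpectation d).Bdd x)
    (hN : ∀ n ≥ N, x.1 (n + 1) = ampl d n (x.1 n)) :
    (unionExpectation d).const x hx = level d N (x.1 N) := by
  refine const_eq_const_of_eventually d hx (bdd_levelUnion d N _)
    (eventually_atTop.2 ⟨N, fun k hk => ?_⟩)
  induction k, hk using Nat.le_induction with
  | base => exact (levelSeq_self d N _).symm
  | succ k hk ih =>
    rw [hN k hk, ih]
    exact (levelSeq_succ d N _ hk).symm

theorem level_range_mono (d : ℕ) {N N' : ℕ} (h : N ≤ N') (X : MatrixTensor d N) :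
    ∃ Y, level d N X = level d N' Y :=
  ⟨_, const_eq_level d N' (bdd_levelUnion d N X) fun _ hn => levelSeq_succ d N X (h.trans hn)⟩

/-- The matrix algebras are dense in the hyperfinite factor. -/
theorem exists_level_near (d : ℕ) (r : Hyperfinite d) {ε : ℝ} (hε : 0 < ε) :
    ∃ N X, (hyperfiniteTrace d).norm2u (r - level d N X) < ε := by
  obtain ⟨y, rfl⟩ := cls_surjective r
  obtain ⟨n, hn⟩ := ((tendsto_norm2u_cls_sub_const y).eventually (gt_mem_nhds hε)).exists
  obtain ⟨N, hN⟩ := ((y : ℕ → matrixUnion d) n).2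
  refine ⟨N, ((y : ℕ → matrixUnion d) n).1 N, ?_⟩
  rw [← const_eq_level d N (bddCauchy_bdd y n) hN]
  exact hn

theorem hyperfiniteTrace_one {d : ℕ} (hd : d ≠ 0) : (hyperfiniteTrace d).E 1 () = 1 := by
  have h0 : ∀ n, normTrace d n 1 = 1 := by
    intro n
    induction n with
    | zero => simp [normTrace, Matrix.trace_one]
    | succ n ih =>
      have := ampl_algebraMap d n 1
      rw [map_one, map_one] at this
      rw [← this, normTrace_ampl d n hd, ih]
  have h1 : unionTrace d 1 = 1 :=
    tendsto_nhds_unique (tendsto_unionTrace d 1) (tendsto_const_nhds.congr fun n => (h0 n).symm)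
  have hb : (unionExpectation d).Bdd 1 := by
    simpa using Bdd.algebraMap (T := unionExpectation d) 1
  have h2 : (hyperfiniteTrace d).E 1 = (unionExpectation d).E 1 := completion_E_const hb
  rw [h2]
  exact h1

section Action

variable {G : Type*} [Group G] {d : ℕ} (ν : G →* Matrix.unitaryGroup (Fin d) ℂ)

theorem productTypeAction_level (g : G) (N : ℕ) (X : MatrixTensor d N) :
    (productTypeAction ν).act g (level d N X)
      = level d N (repPow ν g N * X * star (repPow ν g N)) := by
  have hb : (unionExpectation d).Bdd (adMap ν g (levelUnion d N X)) := by
    obtain ⟨C, hC, h1, h2⟩ := bdd_levelUnion d N X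
    refine ⟨C, hC, opNormLE_map ((unionAction ν).act g) ((unionAction ν).E_act g) h1, ?_⟩
    have := opNormLE_map ((unionAction ν).act g) ((unionAction ν).E_act g) h2
    rw [map_star] at this
    exact this
  have h1 := const_eq_level d N hb (fun n hn => by
    show repPow ν g (n + 1) * levelSeq d N X (n + 1) * _ = ampl d n (repPow ν g n * _ * _)
    rw [levelSeq_succ d N X hn, ampl_conj]
    rfl)
  have h2 : (adMap ν g (levelUnion d N X)).1 N = repPow ν g N * X * star (repPow ν g N) := by
    show repPow ν g N * levelSeq d N X N * star (repPow ν g N) = _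
    rw [levelSeq_self]
  rw [h2] at h1
  exact h1

end Action

/-! ### Tails of the infinite tensor product -/

/-- `M_d^{⊗ (m + N)} = M_d^{⊗ m} ⊗ M_d^{⊗ N}` on index sets. -/
def splitIndex (d m : ℕ) : ∀ N, TensorIndex d (m + N) ≃ TensorIndex d m × TensorIndex d N
  | 0 => (Equiv.prodPUnit (TensorIndex d m)).symm
  | N + 1 => ((splitIndex d m N).prodCongr (Equiv.refl (Fin d))).trans (Equiv.prodAssoc _ _ _)

/-- The embedding `X ↦ 1 ⊗ X` of `M_d^{⊗ N}` into `M_d^{⊗ (m + N)}`. -/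
def shift (d m N : ℕ) : MatrixTensor d N →⋆ₐ[ℂ] MatrixTensor d (m + N) where
  toFun X := ((1 : MatrixTensor d m) ⊗ₖ X).submatrix (splitIndex d m N) (splitIndex d m N)
  map_one' := by
    rw [Matrix.one_kronecker_one, Matrix.submatrix_one_equiv]
  map_mul' X Y := by
    rw [Matrix.submatrix_mul_equiv, ← Matrix.mul_kronecker_mul, one_mul]
  map_zero' := by
    rw [Matrix.kronecker_zero]; rfl
  map_add' X Y := by
    rw [Matrix.kronecker_add]; rfl
  commutes' c := by
    rw [Algebra.algebraMap_eq_smul_one, Algebra.algebraMap_eq_smul_one, Matrix.kronecker_smul,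
      Matrix.one_kronecker_one, Matrix.submatrix_smul, Pi.smul_apply, Pi.smul_apply,
      Matrix.submatrix_one_equiv]
  map_star' X := by
    rw [Matrix.star_eq_conjTranspose, Matrix.star_eq_conjTranspose, Matrix.conjTranspose_submatrix,
      Matrix.conjTranspose_kronecker, Matrix.conjTranspose_one]

theorem shift_apply (d m N : ℕ) (X : MatrixTensor d N) : shift d m N X
    = ((1 : MatrixTensor d m) ⊗ₖ X).submatrix (splitIndex d m N) (splitIndex d m N) := rfl

theorem apply_add_of_stationary (d m N : ℕ) {x : ∀ n, MatrixTensor d n}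
    (hx : ∀ n ≥ m, x (n + 1) = ampl d n (x n)) : x (m + N)
      = (x m ⊗ₖ (1 : MatrixTensor d N)).submatrix (splitIndex d m N) (splitIndex d m N) := by
  induction N with
  | zero =>
    ext i j
    show x m i j = x m i j * (1 : Matrix Unit Unit ℂ) _ _
    rw [Matrix.one_apply_eq, mul_one]
  | succ N ih =>
    have h := hx (m + N) (Nat.le_add_right _ _)
    show x (m + N + 1) = _
    rw [h, ih]
    ext ⟨i, a⟩ ⟨j, b⟩
    show x m (splitIndex d m N i).1 (splitIndex d m N j).1
        * (1 : MatrixTensor d N) (splitIndex d m N i).2 (splitIndex d m N j).2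
        * (1 : Matrix (Fin d) (Fin d) ℂ) a b
      = x m (splitIndex d m N i).1 (splitIndex d m N j).1
        * (1 : Matrix (TensorIndex d N × Fin d) (TensorIndex d N × Fin d) ℂ)
          ((splitIndex d m N i).2, a) ((splitIndex d m N j).2, b)
    rw [← Matrix.one_kronecker_one, mul_assoc]
    rfl

theorem repPow_add {G : Type*} [Group G] {d : ℕ} (ν : G →* Matrix.unitaryGroup (Fin d) ℂ) (g : G)
    (m N : ℕ) : repPow ν g (m + N)
      = (repPow ν g m ⊗ₖ repPow ν g N).submatrix (splitIndex d m N) (splitIndex d m N) := by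
  induction N with
  | zero =>
    ext i j
    show repPow ν g m i j = repPow ν g m i j * (1 : Matrix Unit Unit ℂ) _ _
    rw [Matrix.one_apply_eq, mul_one]
  | succ N ih =>
    show repPow ν g (m + N) ⊗ₖ (ν g : Matrix (Fin d) (Fin d) ℂ) = _
    rw [ih]
    ext ⟨i, a⟩ ⟨j, b⟩
    exact mul_assoc _ _ _

theorem shift_conj {G : Type*} [Group G] {d : ℕ} (ν : G →* Matrix.unitaryGroup (Fin d) ℂ) (g : G)
    (m N : ℕ) (X : MatrixTensor d N) :
    repPow ν g (m + N) * shift d m N X * star (repPow ν g (m + N))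
      = shift d m N (repPow ν g N * X * star (repPow ν g N)) := by
  have h : repPow ν g m * star (repPow ν g m) = 1 := by
    rw [repPow_star, ← repPow_mul, mul_inv_cancel, repPow_one]
  rw [shift_apply, shift_apply, repPow_add, Matrix.star_eq_conjTranspose,
    Matrix.conjTranspose_submatrix, Matrix.submatrix_mul_equiv, Matrix.submatrix_mul_equiv,
    Matrix.conjTranspose_kronecker, ← Matrix.mul_kronecker_mul, ← Matrix.mul_kronecker_mul, mul_one,
    ← Matrix.star_eq_conjTranspose, h]
  rfl

/-- The embedding of `M_d^{⊗ N}` into the hyperfinite factor as the tensor factors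
`m + 1, …, m + N`. -/
def tail (d m N : ℕ) : MatrixTensor d N →⋆ₐ[ℂ] Hyperfinite d := (level d (m + N)).comp (shift d m N)

theorem tail_apply (d m N : ℕ) (X : MatrixTensor d N) :
    tail d m N X = level d (m + N) (shift d m N X) := rfl

theorem productTypeAction_tail {G : Type*} [Group G] {d : ℕ}
    (ν : G →* Matrix.unitaryGroup (Fin d) ℂ) (g : G) (m N : ℕ) (X : MatrixTensor d N) :
    (productTypeAction ν).act g (tail d m N X)
      = tail d m N (repPow ν g N * X * star (repPow ν g N)) := by
  rw [tail_apply, productTypeAction_level, shift_conj]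
  rfl

theorem tail_mul_level (d : ℕ) {m n N : ℕ} (h : n ≤ m) (X : MatrixTensor d N)
    (Y : MatrixTensor d n) : tail d m N X * level d n Y = level d n Y * tail d m N X := by
  have h1 := const_eq_level d (m + N) (bdd_levelUnion d n Y) fun k hk =>
    levelSeq_succ d n Y (h.trans ((Nat.le_add_right _ _).trans hk))
  rw [← level_apply] at h1
  have h2 : (levelUnion d n Y).1 (m + N) = _ := apply_add_of_stationary d m N
    (x := levelSeq d n Y) fun k hk => levelSeq_succ d n Y (h.trans hk)
  rw [h1, tail_apply, ← map_mul, ← map_mul, h2, shift_apply, Matrix.submatrix_mul_equiv,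
    Matrix.submatrix_mul_equiv, ← Matrix.mul_kronecker_mul, ← Matrix.mul_kronecker_mul, one_mul,
    one_mul, mul_one, mul_one]

theorem norm2u_single_mul_le {d : ℕ} {I : Type*} [Fintype I] [DecidableEq I]
    (θ : Matrix I I ℂ →⋆ₐ[ℂ] Hyperfinite d) (p q : I) (r : Hyperfinite d) :
    (hyperfiniteTrace d).norm2u (θ (Matrix.single p q 1) * r) ≤ (hyperfiniteTrace d).norm2u r := by
  rw [norm2u_unit, norm2u_unit]
  have h : (hyperfiniteTrace d).OpNormLEAt () 1 (θ (Matrix.single p q 1)) := by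
    refine OpNormLEAt.of_isIdempotent ?_
    rw [← map_star, ← map_mul, ← map_mul, Matrix.star_eq_conjTranspose,
        Matrix.conjTranspose_single, star_one, Matrix.single_mul_single_same,
        Matrix.single_mul_single_same, one_mul, one_mul]
  simpa using h r

theorem norm2u_mul_single_le {d : ℕ} {I : Type*} [Fintype I] [DecidableEq I]
    (θ : Matrix I I ℂ →⋆ₐ[ℂ] Hyperfinite d) (p q : I) (r : Hyperfinite d) :
    (hyperfiniteTrace d).norm2u (r * θ (Matrix.single p q 1)) ≤ (hyperfiniteTrace d).norm2u r := by
  rw [← norm2u_star, star_mul, ← map_star, Matrix.star_eq_conjTranspose,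
        Matrix.conjTranspose_single, star_one, ← norm2u_star _ r]
  exact norm2u_single_mul_le θ q p (star r)

/-- The matrix units in the tails of the tensor product are asymptotically central. -/
theorem tail_asymptotically_central (d N : ℕ) (p q : TensorIndex d N) (r : Hyperfinite d) :
    Tendsto (fun m => (hyperfiniteTrace d).norm2u
      (tail d m N (Matrix.single p q 1) * r - r * tail d m N (Matrix.single p q 1)))
      atTop (𝓝 0) := by
  rw [Metric.tendsto_atTop]
  intro ε hε
  obtain ⟨n, X, hX⟩ := exists_level_near d r (half_pos hε)
  refine ⟨n, fun m hm => ?_⟩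
  rw [Real.dist_eq, sub_zero, abs_of_nonneg (norm2u_nonneg _ _)]
  set e := tail d m N (Matrix.single p q 1) with he
  have h1 : e * r - r * e = e * (r - level d n X) - (r - level d n X) * e := by
    have := tail_mul_level d hm (Matrix.single p q 1) X
    rw [mul_sub, sub_mul, he, this]
    abel
  rw [h1]
  have h2 := norm2u_single_mul_le (tail d m N) p q (r - level d n X)
  have h3 := norm2u_mul_single_le (tail d m N) p q (r - level d n X)
  have h4 := (hyperfiniteTrace d).norm2u_sub_le (e * (r - level d n X)) ((r - level d n X) * e)
  linarith

/-- Conjugation of a matrix unit. -/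
theorem conj_single {I : Type*} [Fintype I] [DecidableEq I] (U : Matrix I I ℂ) (p q : I) :
    U * Matrix.single p q 1 * star U
      = ∑ r, ∑ s, (U r p * star (U s q)) • Matrix.single r s (1 : ℂ) := by
  ext i j
  simp [Matrix.mul_apply, Matrix.single_apply, Matrix.sum_apply, Matrix.star_apply, ite_and,
    Finset.sum_ite_eq]

end

end EquivariantBundle

namespace EquivariantBundle

noncomputable section

open TracialExpectation

/-! ### Approximate equivariant matrix units in a fiber -/

/-- The family `∑ U_{rp} conj(U_{sq}) e_{rs}`, into which `Ad(U)` transforms a system of matrix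
units `e`. -/
def conjFam {I A : Type*} [Fintype I] [AddCommMonoid A] [Module ℂ A] (U : Matrix I I ℂ)
    (e : I → I → A) (p q : I) : A := ∑ r, ∑ s, (U r p * star (U s q)) • e r s

theorem map_conjFam {I A A' F : Type*} [Fintype I] [AddCommMonoid A] [Module ℂ A]
    [AddCommMonoid A'] [Module ℂ A'] [FunLike F A A'] [LinearMapClass F ℂ A A'] (φ : F)
    (U : Matrix I I ℂ) (e : I → I → A) (p q : I) :
    φ (conjFam U e p q) = conjFam U (fun r s => φ (e r s)) p q := by
  simp only [conjFam, map_sum, map_smul]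

/-- Up to `ε` in the 2-seminorm at `k`, the `e_{pq}` are matrix units, they commute with `F`, and
`γ_g` acts on them like `Ad(μ_g)` for `g ∈ H`. -/
structure ApproxUnits {K A G I : Type*} [TopologicalSpace K] [Ring A] [StarRing A] [Algebra ℂ A]
    [StarModule ℂ A] [Group G] [Fintype I] [DecidableEq I] {T : TracialExpectation K A}
    (γ : TracialAction G T) (μ : G → Matrix I I ℂ) (F : Set A) (H : Set G) (k : K) (ε : ℝ)
    (e : I → I → A) : Prop where
  mul : ∀ p q r s, T.norm2 k (e p q * e r s - if q = r then e p s else 0) ≤ ε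
  one : T.norm2 k (∑ p, e p p - 1) ≤ ε
  star_sub : ∀ p q, T.norm2 k (star (e p q) - e q p) ≤ ε
  comm : ∀ a ∈ F, ∀ p q, T.norm2 k (e p q * a - a * e p q) ≤ ε
  equiv : ∀ g ∈ H, ∀ p q, T.norm2 k (γ.act g (e p q) - conjFam (μ g) e p q) ≤ ε

section Completion

variable {K A : Type*} [TopologicalSpace K] [CompactSpace K] [Ring A] [StarRing A] [Algebra ℂ A]
  [StarModule ℂ A] (T : TracialExpectation K A)
  {R : Type*} [Ring R] [StarRing R] [Algebra ℂ R] [StarModule ℂ R] {S : TracialExpectation Unit R}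

theorem bdd_one_tmul {r : R} (hr : S.Bdd r) : (T.tensor S).Bdd ((1 : A) ⊗ₜ r) := by
  obtain ⟨C, hC, h1, h2⟩ := hr
  have h (b : R) (hb : S.OpNormLE C b) : S.OpNormLEAt () C b := fun c => by
    simpa only [norm2u_unit] using hb c
  refine Bdd.of_opNormLEAt hC hC (fun l => (h r h1).one_tmul hC l) fun l => ?_
  rw [TensorProduct.star_tmul, star_one]
  exact (h (star r) h2).one_tmul hC l

/-- The embedding `r ↦ 1 ⊗ r` of `R` into the strict completion of `A ⊗ R`. -/
def oneTmulHom (hR : ∀ r, S.Bdd r) : R →⋆ₐ[ℂ] (T.tensor S).Completion where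
  toFun r := (T.tensor S).const (1 ⊗ₜ r) (bdd_one_tmul T (hR r))
  map_one' := rfl
  map_mul' x y := by
    rw [const_mul]
    exact congrArg (T.tensor S).cls (Subtype.ext (funext fun _ => by simp))
  map_zero' := congrArg (T.tensor S).cls (Subtype.ext (funext fun _ => TensorProduct.tmul_zero _ _))
  map_add' x y := congrArg (T.tensor S).cls
    (Subtype.ext (funext fun _ => TensorProduct.tmul_add _ _ _))
  commutes' c := congrArg (T.tensor S).cls (Subtype.ext (funext fun _ => by
    show (1 : A) ⊗ₜ[ℂ] algebraMap ℂ R c = algebraMap ℂ (A ⊗[ℂ] R) c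
    rw [Algebra.algebraMap_eq_smul_one, TensorProduct.tmul_smul, Algebra.algebraMap_eq_smul_one]
    rfl))
  map_star' r := by
    rw [const_star]
    exact congrArg (T.tensor S).cls (Subtype.ext (funext fun _ => by
      show (1 : A) ⊗ₜ[ℂ] star r = star (1 ⊗ₜ[ℂ] r)
      rw [TensorProduct.star_tmul, star_one]))

/-- The image of a matrix unit under a `*`-homomorphism is a contraction. -/
theorem opNormLE_single {I : Type*} [Fintype I] [DecidableEq I] (θ : Matrix I I ℂ →⋆ₐ[ℂ] A)
    (p q : I) (k : K) : T.OpNormLEAt k 1 (θ (Matrix.single p q 1)) := by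
  refine OpNormLEAt.of_isIdempotent ?_
  rw [← map_star, ← map_mul, ← map_mul, Matrix.star_eq_conjTranspose,
    Matrix.conjTranspose_single, star_one, Matrix.single_mul_single_same,
    Matrix.single_mul_single_same, one_mul, one_mul]

/-- Contractions that are asymptotically central in `A` are so in the strict completion. -/
theorem completion_asymptotically_central {T : TracialExpectation K A} {f : ℕ → A}
    (hf : ∀ m, T.Bdd (f m)) (h1 : ∀ m, T.OpNormLE 1 (f m)) (h2 : ∀ m, T.OpNormLE 1 (star (f m)))
    (h : ∀ a, Tendsto (fun m => T.norm2u (f m * a - a * f m)) atTop (𝓝 0)) (x : T.Completion) :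
    Tendsto (fun m => T.completion.norm2u (T.const (f m) (hf m) * x - x * T.const (f m) (hf m)))
      atTop (𝓝 0) := by
  obtain ⟨y, rfl⟩ := cls_surjective x
  rw [Metric.tendsto_atTop]
  intro ε hε
  obtain ⟨n, hn⟩ := ((tendsto_norm2u_cls_sub_const y).eventually
    (gt_mem_nhds (show 0 < ε / 4 by positivity))).exists
  obtain ⟨m0, hm0⟩ := eventually_atTop.1
    ((h ((y : ℕ → A) n)).eventually (gt_mem_nhds (half_pos hε)))
  refine ⟨m0, fun m hm => ?_⟩
  rw [Real.dist_eq, sub_zero, abs_of_nonneg (norm2u_nonneg _ _)]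
  have h4 : T.completion.norm2u (T.const (f m) (hf m) * T.const ((y : ℕ → A) n) (bddCauchy_bdd y n)
      - T.const ((y : ℕ → A) n) (bddCauchy_bdd y n) * T.const (f m) (hf m)) < ε / 2 := by
    rw [const_mul, const_mul, const_sub, norm2u_const]
    exact hm0 m hm
  have hop := OpNormLE.completion_const (h1 m) (hf m)
  have hop' := OpNormLE.completion_const (h2 m) (hf m).star
  rw [← const_star (hf m)] at hop'
  set c := T.const ((y : ℕ → A) n) (bddCauchy_bdd y n)
  set w := T.cls y
  set e := T.const (f m) (hf m)
  have e1 : e * w - w * e = (e * (w - c) - (w - c) * e) + (e * c - c * e) := by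
    rw [mul_sub, sub_mul]; abel
  have h2 := hop (w - c)
  have h3 := hop'.right (w - c)
  have h5 := T.completion.norm2u_add_le (e * (w - c) - (w - c) * e) (e * c - c * e)
  have h6 := T.completion.norm2u_sub_le (e * (w - c)) ((w - c) * e)
  rw [e1]
  linarith

/-- If the elements `r_m` are asymptotically central in `R`, then the elements `1 ⊗ r_m` are
asymptotically central in `A ⊗ R`. -/
theorem one_tmul_asymptotically_central {r : ℕ → R}
    (h : ∀ x, Tendsto (fun m => S.norm2u (r m * x - x * r m)) atTop (𝓝 0)) (z : A ⊗[ℂ] R) :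
    Tendsto (fun m => (T.tensor S).norm2u ((1 ⊗ₜ r m) * z - z * (1 ⊗ₜ r m))) atTop (𝓝 0) := by
  induction z with
  | zero => simp
  | add x y hx hy =>
    have h := hx.add hy
    rw [add_zero] at h
    refine squeeze_zero (fun _ => norm2u_nonneg _ _) (fun m => ?_) h
    refine le_trans (le_of_eq ?_) (norm2u_add_le _ _ _)
    congr 1
    rw [mul_add, add_mul]
    abel
  | tmul a x =>
    have h := (h x).const_mul (T.norm2u a)
    rw [mul_zero] at h
    refine h.congr fun m => ?_
    rw [← norm2u_tmul, TensorProduct.tmul_sub, Algebra.TensorProduct.tmul_mul_tmul,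
      Algebra.TensorProduct.tmul_mul_tmul, one_mul, mul_one]

theorem oneTmulHom_asymptotically_central (hR : ∀ r, S.Bdd r) {r : ℕ → R}
    (h1 : ∀ m, S.OpNormLEAt () 1 (r m)) (h2 : ∀ m, S.OpNormLEAt () 1 (star (r m)))
    (h : ∀ x, Tendsto (fun m => S.norm2u (r m * x - x * r m)) atTop (𝓝 0))
    (x : (T.tensor S).Completion) :
    Tendsto (fun m => (T.tensor S).completion.norm2u
      (oneTmulHom T hR (r m) * x - x * oneTmulHom T hR (r m))) atTop (𝓝 0) := by
  refine completion_asymptotically_central (fun m => bdd_one_tmul T (hR (r m)))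
    (fun m => opNormLE_of_opNormLEAt zero_le_one fun k => (h1 m).one_tmul zero_le_one k)
    (fun m => ?_) (one_tmul_asymptotically_central T h) x
  rw [TensorProduct.star_tmul, star_one]
  exact opNormLE_of_opNormLEAt zero_le_one fun k => (h2 m).one_tmul zero_le_one k

theorem tensor_completion_act_oneTmulHom {G : Type*} [Group G] {T : TracialExpectation K A}
    (γ : TracialAction G T) (δ : TracialAction G S) (hR : ∀ r, S.Bdd r) (g : G) (r : R) :
    (γ.tensor δ).completion.act g (oneTmulHom T hR r) = oneTmulHom T hR (δ.act g r) := by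
  refine congrArg (T.tensor S).cls (Subtype.ext (funext fun _ => ?_))
  show tensorEquiv (γ.act g) (δ.act g) (1 ⊗ₜ r) = _
  rw [tensorEquiv_tmul, map_one]

end Completion

section Local

variable {K A C : Type*} [TopologicalSpace K] [CompactSpace K] [Ring A] [StarRing A] [Algebra ℂ A]
  [StarModule ℂ A] [Ring C] [StarRing C] [Algebra ℂ C] [StarModule ℂ C]
  {T : TracialExpectation K A} {T' : TracialExpectation K C}

/-- Almost central equivariant matrix units can be pulled back along a cocycle conjugacy: they
commute approximately with the unitaries of the cocycle. -/
theorem CocycleConjugate.exists_hom {G I : Type*} [Group G] [Fintype I] [DecidableEq I]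
    {γ : TracialAction G T} {β : TracialAction G T'} (h : CocycleConjugate γ β)
    (μ : G → Matrix I I ℂ) (Θ : ℕ → Matrix I I ℂ →⋆ₐ[ℂ] C)
    (hcen : ∀ p q x, Tendsto (fun m => T'.norm2u
      (Θ m (Matrix.single p q 1) * x - x * Θ m (Matrix.single p q 1))) atTop (𝓝 0))
    (hequi : ∀ m g X, β.act g (Θ m X) = Θ m (μ g * X * star (μ g))) {F : Set A}
    (hF : F.Finite) {H : Set G} (hH : H.Finite) {ε : ℝ} (hε : 0 < ε) :
    ∃ θ : Matrix I I ℂ →⋆ₐ[ℂ] A,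
      (∀ a ∈ F, ∀ p q, T.norm2u (θ (Matrix.single p q 1) * a - a * θ (Matrix.single p q 1)) ≤ ε) ∧
      ∀ g ∈ H, ∀ p q, T.norm2u (γ.act g (θ (Matrix.single p q 1))
        - conjFam (μ g) (fun r s => θ (Matrix.single r s 1)) p q) ≤ ε := by
  obtain ⟨u, -, φ, hφE, hφ⟩ := h
  have hφ2 : ∀ a, T'.norm2u (φ a) = T.norm2u a := by
    intro a
    rw [TracialExpectation.norm2u, ← map_star, ← map_mul, hφE]
    rfl
  -- a bound for the sum of the absolute values of the coefficients of `Ad(μ_g)`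
  obtain ⟨D, hD0, hD⟩ : ∃ D : ℝ, 0 < D ∧ ∀ g ∈ H, ∀ p q : I,
      ∑ r, ∑ s, ‖μ g r p * star (μ g s q)‖ ≤ D := by
    refine ⟨1 + ∑ g ∈ hH.toFinset, ∑ p : I, ∑ q : I,
      ∑ r, ∑ s, ‖μ g r p * star (μ g s q)‖, by positivity, fun g hg p q => ?_⟩
    have h1 := Finset.single_le_sum (f := fun g => ∑ p : I, ∑ q : I,
      ∑ r, ∑ s, ‖μ g r p * star (μ g s q)‖) (fun _ _ => by positivity)
      (hH.mem_toFinset.2 hg)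
    have h2 := Finset.single_le_sum (f := fun p => ∑ q : I,
      ∑ r, ∑ s, ‖μ g r p * star (μ g s q)‖) (fun _ _ => by positivity)
      (Finset.mem_univ p)
    have h3 := Finset.single_le_sum (f := fun q =>
      ∑ r, ∑ s, ‖μ g r p * star (μ g s q)‖) (fun _ _ => by positivity)
      (Finset.mem_univ q)
    linarith
  set P : Set C := φ '' F ∪ (fun g => φ (u g : A)) '' H with hP
  have hPfin : P.Finite := (hF.image _).union (hH.image _)
  have hev : ∀ᶠ m in atTop, ∀ x ∈ P, ∀ p q : I, T'.norm2u
      (Θ m (Matrix.single p q 1) * x - x * Θ m (Matrix.single p q 1)) < min ε (ε / D) := by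
    rw [eventually_all_finite hPfin]
    intro x _
    rw [eventually_all]
    intro p
    rw [eventually_all]
    intro q
    exact (hcen p q x).eventually (gt_mem_nhds (lt_min hε (by positivity)))
  obtain ⟨m, hm⟩ := hev.exists
  let θ : Matrix I I ℂ →⋆ₐ[ℂ] A := (φ.symm : C →⋆ₐ[ℂ] A).comp (Θ m)
  have hθ : ∀ X, φ (θ X) = Θ m X := fun X => φ.apply_symm_apply _
  refine ⟨θ, fun a ha p q => ?_, fun g hg p q => ?_⟩
  · rw [← hφ2, map_sub, map_mul, map_mul, hθ]
    exact ((hm (φ a) (Or.inl ⟨a, ha, rfl⟩) p q).trans_le (min_le_left _ _)).le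
  · set c := φ (u g : A) with hc
    have hc1 : star c * c = 1 := by
      rw [hc, ← map_star, ← map_mul, Unitary.coe_star_mul_self, map_one]
    have hc2 : c * star c = 1 := by
      rw [hc, ← map_star, ← map_mul, Unitary.mul_star_self_of_mem (u g).2, map_one]
    set X := Θ m (μ g * Matrix.single p q 1 * star (μ g)) with hX
    have h1 : c * φ (γ.act g (θ (Matrix.single p q 1))) * star c = X := by
      rw [hc, ← map_star, ← map_mul, ← map_mul, ← hφ, hθ, hequi]
    have h2 : φ (conjFam (μ g) (fun r s => θ (Matrix.single r s 1)) p q) = X := by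
      rw [map_conjFam, hX, conj_single]
      simp only [hθ, map_sum, map_smul, conjFam]
    have h3 : φ (γ.act g (θ (Matrix.single p q 1))) = star c * X * c := by
      rw [← h1]
      calc _ = (star c * c) * φ (γ.act g (θ (Matrix.single p q 1))) * (star c * c) := by
            rw [hc1, one_mul, mul_one]
        _ = _ := by simp only [mul_assoc]
    -- `γ_g(θ(e_{pq})) = c* X c` differs from `X = Ad(μ_g)` of the matrix units by a commutator with
    -- the cocycle unitary `c`
    have h4 : star c * X * c - X = star c * (X * c - c * X) := by
      rw [mul_sub, ← mul_assoc (star c) c X, hc1, one_mul, mul_assoc]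
    have h5 : X * c - c * X = ∑ r, ∑ s, (μ g r p * star (μ g s q)) •
        (Θ m (Matrix.single r s 1) * c - c * Θ m (Matrix.single r s 1)) := by
      rw [hX, conj_single]
      simp only [map_sum, map_smul, Finset.sum_mul, Finset.mul_sum, ← Finset.sum_sub_distrib,
        smul_sub, smul_mul_assoc, mul_smul_comm]
    rw [← hφ2, map_sub, h2, h3, h4, norm2u_unitary_mul (by rw [star_star, hc2]), h5]
    have h6 : ∀ r s, T'.norm2u
        (Θ m (Matrix.single r s 1) * c - c * Θ m (Matrix.single r s 1)) ≤ ε / D := fun r s =>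
      ((hm c (Or.inr ⟨g, hg, rfl⟩) r s).trans_le (min_le_right _ _)).le
    calc _ ≤ ∑ r, ∑ s, ‖μ g r p * star (μ g s q)‖ * (ε / D) := by
          refine (norm2u_sum_le _ _ _).trans (Finset.sum_le_sum fun r _ => ?_)
          refine (norm2u_sum_le _ _ _).trans (Finset.sum_le_sum fun s _ => ?_)
          rw [norm2u_smul]
          exact mul_le_mul_of_nonneg_left (h6 r s) (norm_nonneg _)
      _ = (∑ r, ∑ s, ‖μ g r p * star (μ g s q)‖) * (ε / D) := by
          simp only [Finset.sum_mul]
      _ ≤ D * (ε / D) := mul_le_mul_of_nonneg_right (hD g hg p q) (by positivity)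
      _ = ε := by field_simp

theorem hyperfinite_bdd (d : ℕ) (r : Hyperfinite d) : (hyperfiniteTrace d).Bdd r :=
  completion_bdd r

/-- A McDuff system contains exact matrix units that are almost central and almost equivariant:
pull back matrix units from a tail of `R`. -/
theorem IsMcDuff.exists_hom {G : Type*} [Group G] {d : ℕ} {ν : G →* Matrix.unitaryGroup (Fin d) ℂ}
    {γ : TracialAction G T} (h : IsMcDuff ν γ) (N : ℕ) {F : Set A}
    (hF : F.Finite) {H : Set G} (hH : H.Finite) {ε : ℝ} (hε : 0 < ε) :
    ∃ θ : MatrixTensor d N →⋆ₐ[ℂ] A,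
      (∀ a ∈ F, ∀ p q, T.norm2u (θ (Matrix.single p q 1) * a - a * θ (Matrix.single p q 1)) ≤ ε) ∧
      ∀ g ∈ H, ∀ p q, T.norm2u (γ.act g (θ (Matrix.single p q 1))
        - conjFam (repPow ν g N) (fun r s => θ (Matrix.single r s 1)) p q) ≤ ε := by
  refine CocycleConjugate.exists_hom h (fun g => repPow ν g N)
    (fun m => (oneTmulHom T (hyperfinite_bdd d)).comp (tail d m N)) (fun p q x => ?_)
    (fun m g X => ?_) hF hH hε
  · refine oneTmulHom_asymptotically_central T (hyperfinite_bdd d)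
      (r := fun m => tail d m N (Matrix.single p q 1))
      (fun m => opNormLE_single _ (tail d m N) p q ()) (fun m => ?_)
      (tail_asymptotically_central d N p q) x
    rw [← map_star, Matrix.star_eq_conjTranspose, Matrix.conjTranspose_single, star_one]
    exact opNormLE_single _ (tail d m N) q p ()
  · exact (tensor_completion_act_oneTmulHom γ (productTypeAction ν) (hyperfinite_bdd d) g
      (tail d m N X)).trans (congrArg (oneTmulHom T (hyperfinite_bdd d))
        (productTypeAction_tail ν g m N X))

end Local

section Bundle

variable {G : Type*} [Group G] {d : ℕ} (ν : G →* Matrix.unitaryGroup (Fin d) ℂ)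
  {K M : Type*} [TopologicalSpace K] [CompactSpace K] [CStarAlgebra M]
  [PartialOrder M] [StarOrderedRing M] {B : WStarBundle K M} (γ : FiberwiseAction G B)

/-- If the fiber over `k` is McDuff, then `M` contains contractions that are approximate
equivariant matrix units in the fiber over `k`. -/
theorem exists_approxUnits_of_fiber (k : K) (h : IsMcDuff ν (γ.fiber k)) (N : ℕ) {F : Set M}
    (hF : F.Finite) {H : Set G} (hH : H.Finite) {ε : ℝ} (hε : 0 < ε) :
    ∃ e : TensorIndex d N → TensorIndex d N → M, (∀ p q, ‖e p q‖ ≤ 1) ∧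
      ApproxUnits γ.toTracialAction (fun g => repPow ν g N) F H k ε e := by
  obtain ⟨θ, h1, h2⟩ := h.exists_hom N (hF.image (B.proj k)) hH hε
  -- the image of a matrix unit is a contraction in the fiber, so it lifts to a contraction in `M`
  have hlift : ∀ p q, ∃ a : M, ‖a‖ ≤ 1 ∧ B.proj k a = θ (Matrix.single p q 1) := by
    intro p q
    obtain ⟨b, hb⟩ := B.proj_surjective k (θ (Matrix.single p q 1))
    have hb' := opNormLE_single (B.fiberTrace k) θ p q ()
    rw [← hb, B.opNormLEAt_proj] at hb'
    obtain ⟨a, ha1, ha2⟩ := B.exists_norm_le_of_opNormLEAt k one_pos hb'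
    refine ⟨a, ha1, ?_⟩
    rw [← B.proj_eq_zero_iff, map_sub, sub_eq_zero] at ha2
    rw [← ha2, hb]
  -- the `e p q` are contractive lifts of exact matrix units, hence satisfy the relations at `k`
  choose e he1 he2 using hlift
  refine ⟨e, he1, fun p q r s => ?_, ?_, fun p q => ?_, fun a ha p q => ?_, fun g hg p q => ?_⟩
  · rw [← B.norm2_proj, map_sub, map_mul, he2, he2, ← map_mul]
    split_ifs with hqr
    · rw [hqr, he2, Matrix.single_mul_single_same, one_mul, sub_self, norm2_zero]
      exact hε.le
    · rw [Matrix.single_mul_single_of_ne _ _ _ _ hqr, map_zero, map_zero, sub_self, norm2_zero]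
      exact hε.le
  · rw [← B.norm2_proj, map_sub, map_sum, map_one]
    simp only [he2]
    rw [← map_sum, Matrix.sum_single_one, map_one, sub_self, norm2_zero]
    exact hε.le
  · rw [← B.norm2_proj, map_sub, map_star, he2, he2, ← map_star, Matrix.star_eq_conjTranspose,
      Matrix.conjTranspose_single, star_one, sub_self, norm2_zero]
    exact hε.le
  · rw [← B.norm2_proj, map_sub, map_mul, map_mul, he2, ← norm2u_unit]
    exact h1 _ ⟨a, ha, rfl⟩ p q
  · have h3 : (γ.fiber k).act g (B.proj k (e p q)) = B.proj k (γ.act g (e p q)) :=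
      γ.fiberMap_apply k g _
    rw [← B.norm2_proj, map_sub, ← h3, map_conjFam, he2, ← norm2u_unit]
    simp only [he2]
    exact h2 g hg p q

end Bundle

end

end EquivariantBundle

namespace EquivariantBundle

noncomputable section

open TracialExpectation

/-! ### Rotating one system of matrix units into another -/

section Rotation

variable {I Q : Type*} [Fintype I] [Ring Q] [Algebra ℂ Q]

/-- The flip `∑ e_{rt} f_{tr}` of two commuting systems of matrix units. -/
def flip (e f : I → I → Q) : Q := ∑ r, ∑ t, e r t * f t r

/-- If `x = s f` for a system of matrix units `f` commuting with `e`, and `c, s` are central with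
`c² + s² = 1`, then this is the conjugate of `e` by the unitary `c - i s (flip e f)`. It agrees
with `e` where `c = 1` and with `f` where `s = 1`. -/
def rotate (c s : Q) (e x : I → I → Q) (p q : I) : Q :=
  c * c * e p q + s * x p q + Complex.I • (c * (e p q * flip e x - flip e x * e p q))

/-- Successive rotation, starting from `0`, towards the systems `x_0 = s_0 f_0, x_1 = s_1 f_1, …`.
-/
def patched (c s : ℕ → Q) (x : ℕ → I → I → Q) : ℕ → I → I → Q
  | 0 => fun _ _ => 0
  | i + 1 => rotate (c i) (s i) (patched c s x i) (x i)

theorem map_patched {Q' : Type*} [Ring Q'] [Algebra ℂ Q'] (φ : Q →ₐ[ℂ] Q') (c s : ℕ → Q)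
    (x : ℕ → I → I → Q) (i : ℕ) (p q : I) : φ (patched c s x i p q)
      = patched (fun i => φ (c i)) (fun i => φ (s i)) (fun i p q => φ (x i p q)) i p q := by
  induction i generalizing p q with
  | zero => exact map_zero φ
  | succ i ih =>
    simp only [patched, rotate, flip, map_add, map_sub, map_mul, map_smul, map_sum, ih]

theorem sum_comm_pairs {A : Type*} [AddCommMonoid A] (F : I → I → I → I → A) :
    ∑ r, ∑ t, ∑ a, ∑ b, F r t a b = ∑ a, ∑ b, ∑ r, ∑ t, F r t a b := by
  calc ∑ r, ∑ t, ∑ a, ∑ b, F r t a b = ∑ r, ∑ a, ∑ t, ∑ b, F r t a b :=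
        Finset.sum_congr rfl fun r _ => Finset.sum_comm
    _ = ∑ a, ∑ r, ∑ t, ∑ b, F r t a b := Finset.sum_comm
    _ = ∑ a, ∑ r, ∑ b, ∑ t, F r t a b :=
        Finset.sum_congr rfl fun a _ => Finset.sum_congr rfl fun r _ => Finset.sum_comm
    _ = ∑ a, ∑ b, ∑ r, ∑ t, F r t a b := Finset.sum_congr rfl fun a _ => Finset.sum_comm

theorem patched_congr {c s : ℕ → Q} {x y : ℕ → I → I → Q} {i : ℕ} (h : ∀ j < i, x j = y j) :
    patched c s x i = patched c s y i := by
  induction i with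
  | zero => rfl
  | succ i ih =>
    rw [patched, patched, ih fun j hj => h j (hj.trans i.lt_succ_self), h i i.lt_succ_self]

theorem flip_conjFam {U : Matrix I I ℂ} [DecidableEq I] (hU : U * star U = 1) (e f : I → I → Q) :
    flip (conjFam U e) (conjFam U f) = flip e f := by
  have h : ∀ a b, ∑ r, U a r * star (U b r) = if a = b then 1 else 0 := fun a b => by
    have := congrFun (congrFun hU a) b
    rwa [Matrix.mul_apply, Matrix.one_apply] at this
  have h1 : ∀ r t, conjFam U e r t * conjFam U f t r = ∑ a, ∑ b, ∑ c, ∑ d,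
      ((U a r * star (U d r)) * (U c t * star (U b t))) • (e a b * f c d) := by
    intro r t
    simp only [conjFam, Finset.sum_mul]
    simp only [Finset.mul_sum, smul_mul_smul_comm]
    refine Finset.sum_congr rfl fun a _ => Finset.sum_congr rfl fun b _ =>
      Finset.sum_congr rfl fun c _ => Finset.sum_congr rfl fun d _ => ?_
    congr 1
    ring
  calc flip (conjFam U e) (conjFam U f)
      = ∑ a, ∑ b, ∑ c, ∑ d, ((∑ r, U a r * star (U d r)) * ∑ t, U c t * star (U b t)) •
          (e a b * f c d) := by
        simp only [flip, h1]
        rw [sum_comm_pairs]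
        refine Finset.sum_congr rfl fun a _ => Finset.sum_congr rfl fun b _ => ?_
        rw [sum_comm_pairs]
        refine Finset.sum_congr rfl fun c _ => Finset.sum_congr rfl fun d _ => ?_
        simp only [Finset.sum_mul_sum, Finset.sum_smul]
    _ = flip e f := by
        simp only [h, flip]
        refine Finset.sum_congr rfl fun a _ => Finset.sum_congr rfl fun b _ => ?_
        simp

theorem rotate_conjFam {U : Matrix I I ℂ} [DecidableEq I] (hU : U * star U = 1) (c s : Q)
    (e x : I → I → Q) :
    rotate c s (conjFam U e) (conjFam U x) = conjFam U (rotate c s e x) := by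
  funext p q
  rw [rotate, flip_conjFam hU]
  simp only [conjFam, Finset.mul_sum, Finset.sum_mul, ← Finset.sum_sub_distrib,
    ← Finset.sum_add_distrib, Finset.smul_sum]
  refine Finset.sum_congr rfl fun r _ => Finset.sum_congr rfl fun t _ => ?_
  rw [rotate]
  simp only [smul_add, smul_sub, mul_smul_comm, smul_mul_assoc, mul_sub, mul_assoc,
    smul_comm Complex.I]

theorem conjFam_zero (U : Matrix I I ℂ) : conjFam U (fun _ _ => (0 : Q)) = fun _ _ => 0 := by
  funext p q
  simp [conjFam]

theorem patched_conjFam {U : Matrix I I ℂ} [DecidableEq I] (hU : U * star U = 1) (c s : ℕ → Q)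
    (x : ℕ → I → I → Q) (i : ℕ) :
    patched c s (fun i => conjFam U (x i)) i = conjFam U (patched c s x i) := by
  induction i with
  | zero => exact (conjFam_zero U).symm
  | succ i ih => simp only [patched, ih, rotate_conjFam hU]

theorem Commute.flip {y : Q} {e f : I → I → Q} (he : ∀ p q, Commute y (e p q))
    (hf : ∀ p q, Commute y (f p q)) : Commute y (flip e f) :=
  Commute.sum_right _ _ _ fun r _ => Commute.sum_right _ _ _ fun t _ => (he r t).mul_right (hf t r)

theorem Commute.rotate {y c s : Q} {e x : I → I → Q} (hc : Commute y c) (hs : Commute y s)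
    (he : ∀ p q, Commute y (e p q)) (hx : ∀ p q, Commute y (x p q)) (p q : I) :
    Commute y (rotate c s e x p q) :=
  (((hc.mul_right hc).mul_right (he p q)).add_right (hs.mul_right (hx p q))).add_right
    ((hc.mul_right (((he p q).mul_right (Commute.flip he hx)).sub_right
      ((Commute.flip he hx).mul_right (he p q)))).smul_right _)

theorem Commute.patched {c s : ℕ → Q} {x : ℕ → I → I → Q} {y : Q} (hc : ∀ i, Commute y (c i))
    (hs : ∀ i, Commute y (s i)) {i : ℕ} (hx : ∀ j < i, ∀ p q, Commute y (x j p q)) (p q : I) :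
    Commute y (patched c s x i p q) := by
  induction i generalizing p q with
  | zero => exact Commute.zero_right y
  | succ i ih =>
    exact Commute.rotate (hc i) (hs i) (ih fun j hj => hx j (hj.trans i.lt_succ_self))
      (hx i i.lt_succ_self) p q

variable [DecidableEq I] [StarRing Q] [StarModule ℂ Q]

/-- Systems of matrix units. -/
structure IsMatrixUnits (e : I → I → Q) : Prop where
  mul : ∀ p q r s, e p q * e r s = if q = r then e p s else 0
  one : ∑ p, e p p = 1
  star_eq : ∀ p q, star (e p q) = e q p

namespace IsMatrixUnits

variable {e f : I → I → Q}

theorem flip_mul_flip (he : IsMatrixUnits e) (hf : IsMatrixUnits f)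
    (hef : ∀ p q r s, Commute (e p q) (f r s)) : flip e f * flip e f = 1 := by
  have h1 : ∀ r t r' t', e r t * f t r * (e r' t' * f t' r')
      = if t = r' then if r = t' then e r r * f t t else 0 else 0 := by
    intro r t r' t'
    have : e r t * f t r * (e r' t' * f t' r') = (e r t * e r' t') * (f t r * f t' r') := by
      rw [mul_assoc, ← mul_assoc (f t r), ← (hef r' t' t r).eq]
      simp only [mul_assoc]
    rw [this, he.mul, hf.mul]
    split_ifs with h1 h2 <;> simp_all
  have h2 : ∀ r t, e r t * f t r * flip e f = e r r * f t t := by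
    intro r t
    simp only [flip, Finset.mul_sum, h1]
    simp
  calc flip e f * flip e f = ∑ r, ∑ t, e r r * f t t := by
        rw [flip, Finset.sum_mul]
        refine Finset.sum_congr rfl fun r _ => ?_
        rw [Finset.sum_mul]
        exact Finset.sum_congr rfl fun t _ => h2 r t
    _ = 1 := by rw [← Finset.sum_mul_sum, he.one, hf.one, one_mul]

theorem star_flip (he : IsMatrixUnits e) (hf : IsMatrixUnits f)
    (hef : ∀ p q r s, Commute (e p q) (f r s)) : star (flip e f) = flip e f := by
  simp only [flip, star_sum, star_mul, he.star_eq, hf.star_eq]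
  rw [Finset.sum_comm]
  exact Finset.sum_congr rfl fun t _ => Finset.sum_congr rfl fun r _ => (hef t r r t).eq.symm

theorem flip_mul (he : IsMatrixUnits e) (hf : IsMatrixUnits f)
    (hef : ∀ p q r s, Commute (e p q) (f r s)) (p q : I) :
    flip e f * e p q = f p q * flip e f := by
  have h1 : ∀ r t, e r t * f t r * e p q = if t = p then e r q * f p r else 0 := by
    intro r t
    rw [mul_assoc, ← (hef p q t r).eq, ← mul_assoc, he.mul]
    split_ifs with h
    · rw [h]
    · rw [zero_mul]
  have h2 : ∀ r t, f p q * (e r t * f t r) = if q = t then e r q * f p r else 0 := by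
    intro r t
    rw [← mul_assoc, ← (hef r t p q).eq, mul_assoc, hf.mul]
    split_ifs with h
    · rw [h]
    · rw [mul_zero]
  simp only [flip, Finset.sum_mul, Finset.mul_sum, h1, h2, Finset.sum_ite_eq, Finset.sum_ite_eq',
    Finset.mem_univ, if_true]

/-- Rotation preserves matrix units. -/
theorem rotate (he : IsMatrixUnits e) (hf : IsMatrixUnits f)
    (hef : ∀ p q r s, Commute (e p q) (f r s)) {c s : Q} (hc : ∀ y, Commute c y)
    (hs : ∀ y, Commute s y) (hcs : c * c + s * s = 1) (hc' : star c = c) (hs' : star s = s) :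
    IsMatrixUnits (rotate c s e fun p q => s * f p q) := by
  -- the rotated system is `W e W*`, where `W = c - i s Φ` is unitary since `Φ² = 1` and `Φ* = Φ`
  set Φ := flip e f with hΦ
  have hΦ2 : Φ * Φ = 1 := he.flip_mul_flip hf hef
  have hΦs : star Φ = Φ := he.star_flip hf hef
  set W := c - Complex.I • (s * Φ) with hW
  set W' := c + Complex.I • (s * Φ) with hW'
  have hstar : star W = W' := by
    rw [hW, hW', star_sub, star_smul, star_mul, hc', hs', hΦs, ← (hs Φ).eq]
    simp
  have key : ∀ y, W * y * W' = c * c * y + s * (s * (Φ * y * Φ))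
      + Complex.I • (c * (s * (y * Φ - Φ * y))) := by
    intro y
    have e1 : c * y * c = c * c * y := by rw [mul_assoc, ← (hc y).eq, mul_assoc]
    have e2 : c * y * (s * Φ) = c * (s * (y * Φ)) := by
      rw [mul_assoc, ← mul_assoc y, ← (hs y).eq, mul_assoc]
    have e3 : s * Φ * y * c = c * (s * (Φ * y)) := by
      rw [← (hc _).eq, mul_assoc]
    have e4 : s * Φ * y * (s * Φ) = s * (s * (Φ * y * Φ)) := by
      rw [mul_assoc s Φ, mul_assoc s, ← mul_assoc (Φ * y) s, ← (hs (Φ * y)).eq, mul_assoc s (Φ * y)]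
    simp only [hW, hW', sub_mul, mul_add, smul_mul_assoc, mul_smul_comm, smul_smul, e1, e2, e3, e4,
      Complex.I_mul_I, mul_sub, smul_sub]
    rw [neg_smul, one_smul]
    abel
  have hWW' : W * W' = 1 := by
    have := key 1
    rw [mul_one, mul_one, mul_one, one_mul, sub_self, hΦ2, mul_one, mul_zero, mul_zero, smul_zero,
      add_zero, hcs] at this
    exact this
  have hcomm : Commute c (s * Φ) := hc _
  have hW'W : W' * W = 1 := by
    rw [← hWW', hW, hW', add_mul, mul_sub, mul_sub, sub_mul, mul_add, mul_add]
    simp only [smul_mul_assoc, mul_smul_comm, hcomm.eq]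
    abel
  have hrot : EquivariantBundle.rotate c s e (fun p q => s * f p q)
      = fun p q => W * e p q * W' := by
    funext p q
    have h1 : flip e (fun p q => s * f p q) = s * Φ := by
      simp only [flip, hΦ, Finset.mul_sum]
      refine Finset.sum_congr rfl fun r _ => Finset.sum_congr rfl fun t _ => ?_
      rw [← mul_assoc, ← (hs _).eq, mul_assoc]
    have h2 : Φ * e p q * Φ = f p q := by
      rw [he.flip_mul hf hef, mul_assoc, hΦ2, mul_one]
    rw [key, h2, EquivariantBundle.rotate, h1]
    congr 3
    rw [← mul_assoc (e p q), ← (hs (e p q)).eq, mul_sub]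
    simp only [mul_assoc]
  rw [hrot]
  refine ⟨fun p q r t => ?_, ?_, fun p q => ?_⟩
  · calc W * e p q * W' * (W * e r t * W') = W * e p q * (W' * W) * e r t * W' := by
          simp only [mul_assoc]
      _ = W * (e p q * e r t) * W' := by rw [hW'W]; simp only [mul_assoc, one_mul]
      _ = _ := by
          rw [he.mul]
          split_ifs <;> simp
  · rw [← Finset.sum_mul, ← Finset.mul_sum, he.one, mul_one, hWW']
  · rw [star_mul, star_mul, ← hstar, star_star, he.star_eq, hstar, mul_assoc]

/-- If the `f_i` are commuting systems of matrix units and `s_{i₀} = 1`, then the systems patched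
together from at least `f_0, …, f_{i₀}` consist of matrix units. -/
theorem patched {c s : ℕ → Q} {f : ℕ → I → I → Q} {N i₀ : ℕ} (hc : ∀ i y, Commute (c i) y)
    (hs : ∀ i y, Commute (s i) y) (hcs : ∀ i, c i * c i + s i * s i = 1)
    (hc' : ∀ i, star (c i) = c i) (hs' : ∀ i, star (s i) = s i)
    (hf : ∀ i < N, IsMatrixUnits (f i))
    (hff : ∀ j < N, ∀ i < j, ∀ p q r t, Commute (f i p q) (f j r t))
    (hc₀ : c i₀ = 0) (hs₀ : s i₀ = 1) {i : ℕ} (hi : i₀ < i) (hiN : i ≤ N) :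
    IsMatrixUnits (patched c s (fun i p q => s i * f i p q) i) := by
  induction i, hi using Nat.le_induction with
  -- `c_{i₀} = 0` and `s_{i₀} = 1`: the rotation at `i₀` yields `f_{i₀}`, whatever came before
  | base =>
    convert hf i₀ hiN using 1
    funext p q
    simp [EquivariantBundle.patched, EquivariantBundle.rotate, hc₀, hs₀]
  | succ i hi ih =>
    refine (ih (by omega)).rotate (hf i hiN) (fun p q r t => ?_) (hc i) (hs i) (hcs i) (hc' i)
      (hs' i)
    refine (Commute.patched (fun l => (hc l _).symm) (fun l => (hs l _).symm)
      (fun j hj a b => ?_) p q).symm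
    exact (((hs j _).symm).mul_right (hff i hiN j hj a b r t).symm)

end IsMatrixUnits

end Rotation

end

end EquivariantBundle

namespace EquivariantBundle

noncomputable section

open TracialExpectation

/-! ### Actions and 2-seminorms -/

section Action

variable {K A G : Type*} [TopologicalSpace K] [Ring A] [StarRing A] [Algebra ℂ A] [StarModule ℂ A]
  [Group G] {T : TracialExpectation K A} (γ : TracialAction G T) (g : G)

theorem norm2_act (k : K) (a : A) : T.norm2 k (γ.act g a) = T.norm2 k a := by
  rw [TracialExpectation.norm2, ← map_star, ← map_mul, γ.E_act]
  rfl

theorem TracialExpectation.OpNormLEAt.act {k : K} {C : ℝ} {a : A} (h : T.OpNormLEAt k C a) :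
    T.OpNormLEAt k C (γ.act g a) := fun b => by
  have h1 := h ((γ.act g).symm b)
  rwa [← norm2_act γ g, ← norm2_act γ g k ((γ.act g).symm b), map_mul,
    (γ.act g).apply_symm_apply] at h1

end Action

/-! ### Bounded sequences modulo null sequences for the 2-seminorms at varying points -/

section BoundedSequences

variable {K A : Type*} [TopologicalSpace K] [Ring A] [StarRing A] [Algebra ℂ A] [StarModule ℂ A]
  (T : TracialExpectation K A) (k : ℕ → K)

/-- The `*`-algebra of the sequences `x` for which the operators of multiplication by `x_n` and
`x_n*` on `L²(A, k_n)` are uniformly bounded. -/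
def boundedSeq : StarSubalgebra ℂ (ℕ → A) where
  carrier := {x | ∃ C, 0 ≤ C ∧ ∀ n, T.OpNormLEAt (k n) C (x n) ∧ T.OpNormLEAt (k n) C (star (x n))}
  mul_mem' := by
    rintro x y ⟨C, hC, hx⟩ ⟨D, hD, hy⟩
    refine ⟨C * D, mul_nonneg hC hD, fun n => ⟨(hx n).1.mul hC (hy n).1, ?_⟩⟩
    rw [Pi.mul_apply, star_mul, mul_comm C]
    exact (hy n).2.mul hD (hx n).2
  add_mem' := by
    rintro x y ⟨C, hC, hx⟩ ⟨D, hD, hy⟩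
    refine ⟨C + D, add_nonneg hC hD, fun n => ⟨(hx n).1.add (hy n).1, ?_⟩⟩
    rw [Pi.add_apply, star_add]
    exact (hx n).2.add (hy n).2
  algebraMap_mem' c := by
    refine ⟨‖c‖, norm_nonneg _, fun n => ⟨fun b => ?_, fun b => ?_⟩⟩
    · rw [Pi.algebraMap_apply, ← Algebra.smul_def, T.norm2_smul]
    · rw [Pi.algebraMap_apply, ← algebraMap_star_comm, ← Algebra.smul_def, T.norm2_smul, norm_star]
  star_mem' := by
    rintro x ⟨C, hC, hx⟩
    refine ⟨C, hC, fun n => ⟨(hx n).2, ?_⟩⟩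
    rw [Pi.star_apply, star_star]
    exact (hx n).1

variable {T k}

/-- Evaluation of a bounded sequence at `n`. -/
def boundedSeq.eval (n : ℕ) : boundedSeq T k →ₐ[ℂ] A :=
  (Pi.evalAlgHom ℂ (fun _ => A) n).comp (boundedSeq T k).subtype.toAlgHom

theorem boundedSeq.coe_sum {ι : Type*} (t : Finset ι) (f : ι → boundedSeq T k) (n : ℕ) :
    ((∑ i ∈ t, f i : boundedSeq T k) : ℕ → A) n = ∑ i ∈ t, (f i : ℕ → A) n :=
  (congrFun (AddSubmonoidClass.coe_finsetSum f t) n).trans (Finset.sum_apply n t _)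

theorem boundedSeq.coe_conjFam {I : Type*} [Fintype I] (U : Matrix I I ℂ)
    (e : I → I → boundedSeq T k) (p q : I) (n : ℕ) :
    ((conjFam U e p q : boundedSeq T k) : ℕ → A) n
      = conjFam U (fun r s => (e r s : ℕ → A) n) p q := by
  simp only [conjFam, boundedSeq.coe_sum]
  rfl

variable (T k)

/-- Two bounded sequences `x, y` are identified if `‖x_n - y_n‖_{2,k_n} → 0`. -/
def fiberCon : RingCon (boundedSeq T k) where
  r x y := Tendsto (fun n => T.norm2 (k n) ((x : ℕ → A) n - (y : ℕ → A) n)) atTop (𝓝 0)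
  iseqv :=
    { refl := fun x => by simp
      symm := fun {x y} h => by simpa only [T.norm2_sub_comm] using h
      trans := fun {x y z} h h' => by
        have h'' := h.add h'
        rw [add_zero] at h''
        exact squeeze_zero (fun _ => norm2_nonneg _ _ _) (fun _ => norm2_sub_le_sub _ _ _ _ _) h'' }
  add' := fun {w x y z} h h' => by
    have h'' := h.add h'
    rw [add_zero] at h''
    refine squeeze_zero (fun _ => norm2_nonneg _ _ _) (fun n => ?_) h''
    refine le_trans (le_of_eq ?_) (norm2_add_le _ _ _ _)
    congr 1
    exact add_sub_add_comm _ _ _ _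
  mul' := fun {w x y z} h h' => by
    obtain ⟨C, -, hC⟩ := w.2
    obtain ⟨D, -, hD⟩ := z.2
    have h'' := (h'.const_mul C).add (h.const_mul D)
    rw [mul_zero, mul_zero, add_zero] at h''
    refine squeeze_zero (fun _ => norm2_nonneg _ _ _) (fun n => ?_) h''
    have e : ((w * y : boundedSeq T k) : ℕ → A) n - ((x * z : boundedSeq T k) : ℕ → A) n
        = (w : ℕ → A) n * ((y : ℕ → A) n - (z : ℕ → A) n)
          + ((w : ℕ → A) n - (x : ℕ → A) n) * (z : ℕ → A) n := by
      show (w : ℕ → A) n * (y : ℕ → A) n - (x : ℕ → A) n * (z : ℕ → A) n = _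
      noncomm_ring
    rw [e]
    refine (norm2_add_le _ _ _ _).trans (add_le_add ?_ ?_)
    · exact (hC n).1 _
    · exact (hD n).2.right _

/-- The quotient of the bounded sequences by `fiberCon`. -/
abbrev FiberSeq : Type _ := (fiberCon T k).Quotient

instance : StarRing (FiberSeq T k) where
  star := Quotient.map' star fun x y (h : Tendsto _ _ _) => by
    show Tendsto (fun n => T.norm2 (k n) (star ((x : ℕ → A) n) - star ((y : ℕ → A) n))) _ _
    simpa only [← star_sub, T.norm2_star] using h
  star_involutive := by
    rintro ⟨x⟩
    exact congrArg (Quotient.mk'' : boundedSeq T k → FiberSeq T k) (star_star x)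
  star_mul := by
    rintro ⟨x⟩ ⟨y⟩
    exact congrArg (Quotient.mk'' : boundedSeq T k → FiberSeq T k) (star_mul x y)
  star_add := by
    rintro ⟨x⟩ ⟨y⟩
    exact congrArg (Quotient.mk'' : boundedSeq T k → FiberSeq T k) (star_add x y)

instance : StarModule ℂ (FiberSeq T k) where
  star_smul := by
    rintro c ⟨x⟩
    exact congrArg (Quotient.mk'' : boundedSeq T k → FiberSeq T k) (star_smul c x)

/-- The quotient map. -/
def FiberSeq.mk : boundedSeq T k →⋆ₐ[ℂ] FiberSeq T k where
  toFun x := Quotient.mk'' x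
  map_one' := rfl
  map_mul' _ _ := rfl
  map_zero' := rfl
  map_add' _ _ := rfl
  commutes' _ := rfl
  map_star' _ := rfl

variable {T k}

theorem FiberSeq.mk_eq_iff {x y : boundedSeq T k} : FiberSeq.mk T k x = FiberSeq.mk T k y ↔
    Tendsto (fun n => T.norm2 (k n) ((x : ℕ → A) n - (y : ℕ → A) n)) atTop (𝓝 0) :=
  Quotient.eq''

theorem FiberSeq.mk_surjective (q : FiberSeq T k) : ∃ x, FiberSeq.mk T k x = q :=
  Quotient.mk''_surjective q

theorem FiberSeq.mk_eq_of_le {x y : boundedSeq T k}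
    (h : ∀ n : ℕ, T.norm2 (k n) ((x : ℕ → A) n - (y : ℕ → A) n) ≤ 1 / (n + 1)) :
    FiberSeq.mk T k x = FiberSeq.mk T k y :=
  mk_eq_iff.2 (squeeze_zero (fun _ => norm2_nonneg _ _ _) h tendsto_one_div_add_atTop_nhds_zero_nat)

theorem FiberSeq.mk_eq_of_eq_zero {x y : boundedSeq T k}
    (h : ∀ n : ℕ, T.norm2 (k n) ((x : ℕ → A) n - (y : ℕ → A) n) = 0) :
    FiberSeq.mk T k x = FiberSeq.mk T k y :=
  mk_eq_of_le fun n => (h n).le.trans (by positivity)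

theorem FiberSeq.eventually_le {x y : boundedSeq T k} (h : FiberSeq.mk T k x = FiberSeq.mk T k y)
    {ε : ℝ} (hε : 0 < ε) :
    ∀ᶠ n in atTop, T.norm2 (k n) ((x : ℕ → A) n - (y : ℕ → A) n) ≤ ε :=
  ((mk_eq_iff.1 h).eventually (gt_mem_nhds hε)).mono fun _ h => h.le

end BoundedSequences

/-! ### Patching approximate matrix units in a fiber -/

section Patching

variable {K M : Type*} [TopologicalSpace K] [CompactSpace K] [CStarAlgebra M]
  [PartialOrder M] [StarOrderedRing M] (B : WStarBundle K M)

/-- A real function on `K`, as a central element of `M`. -/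
def WStarBundle.real (f : C(K, ℝ)) : M := B.incl ((Complex.ofRealCLM : C(ℝ, ℂ)).comp f)

theorem WStarBundle.real_comm (f : C(K, ℝ)) (a : M) : B.real f * a = a * B.real f :=
  B.incl_central _ a

theorem WStarBundle.star_real (f : C(K, ℝ)) : star (B.real f) = B.real f := by
  rw [WStarBundle.real, ← map_star]
  congr 1
  ext l
  exact Complex.conj_ofReal _

theorem WStarBundle.real_mul (f g : C(K, ℝ)) : B.real (f * g) = B.real f * B.real g := by
  rw [WStarBundle.real, WStarBundle.real, WStarBundle.real, ← map_mul]
  congr 1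
  ext l
  exact Complex.ofReal_mul _ _

theorem WStarBundle.real_add (f g : C(K, ℝ)) : B.real (f + g) = B.real f + B.real g := by
  rw [WStarBundle.real, WStarBundle.real, WStarBundle.real, ← map_add]
  congr 1
  ext l
  exact Complex.ofReal_add _ _

theorem WStarBundle.real_one : B.real 1 = 1 := by
  rw [WStarBundle.real, ← map_one B.incl]
  congr 1

theorem WStarBundle.real_sub (f g : C(K, ℝ)) : B.real (f - g) = B.real f - B.real g := by
  rw [eq_sub_iff_add_eq, ← B.real_add, sub_add_cancel]

theorem WStarBundle.norm2_real_mul (k : K) (f : C(K, ℝ)) (a : M) :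
    B.norm2 k (B.real f * a) = |f k| * B.norm2 k a := by
  have h := B.centralFunctions.norm2_incl_mul k ((Complex.ofRealCLM : C(ℝ, ℂ)).comp f) a
  have h2 : ‖((Complex.ofRealCLM : C(ℝ, ℂ)).comp f) k‖ = |f k| := Complex.norm_real _
  rw [h2] at h
  exact h

theorem WStarBundle.norm2_real (k : K) (f : C(K, ℝ)) : B.norm2 k (B.real f) = |f k| := by
  have := B.norm2_real_mul k f 1
  rwa [mul_one, B.norm2_one, mul_one] at this

theorem WStarBundle.norm_real_le {f : C(K, ℝ)} {C : ℝ} (hC : 0 ≤ C) (h : ∀ l, |f l| ≤ C) :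
    ‖B.real f‖ ≤ C :=
  (NonUnitalStarAlgHom.norm_apply_le B.incl _).trans
    ((ContinuousMap.norm_le _ hC).2 fun l => (Complex.norm_real _).trans_le (h l))

/-- The function `(1 - s²)^{1/2}`. -/
def coFun (s : C(K, ℝ)) : C(K, ℝ) := ⟨fun l => Real.sqrt (1 - s l ^ 2), by fun_prop⟩

variable {B} {G I : Type*} [Group G] [Fintype I] [DecidableEq I] (γ : FiberwiseAction G B)

theorem FiberwiseAction.act_real (g : G) (f : C(K, ℝ)) : γ.act g (B.real f) = B.real f := by
  have h := γ.act_E g (B.incl ((Complex.ofRealCLM : C(ℝ, ℂ)).comp f))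
  rw [B.E_incl] at h
  exact h

variable (B) in
/-- The systems patched together with the coefficients `s_i` and `(1 - s_i²)^{1/2}`. -/
def patch (s : ℕ → C(K, ℝ)) (x : ℕ → I → I → M) : ℕ → I → I → M :=
  patched (fun i => B.real (coFun (s i))) (fun i => B.real (s i)) x

/-- At `k`, the `x_i` are `s_i(k)` times approximate equivariant matrix units `e_i` that commute
approximately with each other, and `s_{i₀}(k) = 1`. -/
structure PatchData (μ : G → Matrix I I ℂ) (F : Set M) (H : Set G) (N i₀ : ℕ) (δ : ℝ)
    (s : ℕ → C(K, ℝ)) (x : ℕ → I → I → M) (k : K) (e : ℕ → I → I → M) : Prop where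
  nonneg : ∀ i l, 0 ≤ s i l
  le_one : ∀ i l, s i l ≤ 1
  norm_x : ∀ i p q, ‖x i p q‖ ≤ 1
  norm_e : ∀ i p q, ‖e i p q‖ ≤ 1
  x_sub : ∀ i p q, B.norm2 k (x i p q - B.real (s i) * e i p q) = 0
  units : ∀ i < N, ApproxUnits γ.toTracialAction μ F H k δ (e i)
  comm : ∀ j < N, ∀ i < j, ∀ p q r t, B.norm2 k (e j r t * e i p q - e i p q * e j r t) ≤ δ
  eq_one : s i₀ k = 1

theorem WStarBundle.mem_boundedSeq (B : WStarBundle K M) (k : ℕ → K) {x : ℕ → M} {C : ℝ}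
    (h : ∀ n, ‖x n‖ ≤ C) : x ∈ boundedSeq B.toTracialExpectation k := by
  have key : ∀ n (a : M), ‖a‖ ≤ C → B.OpNormLEAt (k n) C a := fun n a ha b =>
    (B.norm2_mul_le (k n) a b).trans (mul_le_mul_of_nonneg_right ha (norm2_nonneg _ _ _))
  exact ⟨C, (norm_nonneg _).trans (h 0), fun n => ⟨key n _ (h n),
    key n _ (by rw [norm_star]; exact h n)⟩⟩

/-- In the limit `δ → 0` the relations hold exactly in an algebra of sequences, where the `c_i` and
`s_i` are central, so that the rotations are unitary conjugations. -/
theorem exists_patch_tolerance {μ : G → Matrix I I ℂ} (hμ : ∀ g, μ g * star (μ g) = 1) {F : Set M}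
    (hF : F.Finite) {H : Set G} (hH : H.Finite) {N i₀ : ℕ} (hi₀ : i₀ < N) {ε : ℝ} (hε : 0 < ε) :
    ∃ δ > 0, ∀ s x k e, PatchData γ μ F H N i₀ δ s x k e →
      ApproxUnits γ.toTracialAction μ F H k ε (patch B s x N) := by
  -- otherwise take counterexamples for `δ = 1/(m+1)`, and collect them in sequences
  by_contra! hcon
  choose s x k e hd hbad using fun m : ℕ => hcon (1 / ((m : ℝ) + 1)) (by positivity)
  have hco : ∀ (f : C(K, ℝ)) l, |coFun f l| ≤ 1 := fun f l => by
    show |Real.sqrt (1 - f l ^ 2)| ≤ 1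
    rw [abs_of_nonneg (Real.sqrt_nonneg _)]
    exact Real.sqrt_le_one.2 (by nlinarith [sq_nonneg (f l)])
  let sS : ℕ → boundedSeq B.toTracialExpectation k := fun i =>
    ⟨fun m => B.real (s m i), B.mem_boundedSeq k fun m =>
    B.norm_real_le zero_le_one fun l => abs_le.2 ⟨by linarith [(hd m).nonneg i l],
      (hd m).le_one i l⟩⟩
  let cS : ℕ → boundedSeq B.toTracialExpectation k := fun i =>
    ⟨fun m => B.real (coFun (s m i)), B.mem_boundedSeq k fun m =>
    B.norm_real_le zero_le_one (hco _)⟩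
  let xS : ℕ → I → I → boundedSeq B.toTracialExpectation k := fun i p q =>
    ⟨fun m => x m i p q, B.mem_boundedSeq k fun m => (hd m).norm_x i p q⟩
  let eS : ℕ → I → I → boundedSeq B.toTracialExpectation k := fun i p q =>
    ⟨fun m => e m i p q, B.mem_boundedSeq k fun m => (hd m).norm_e i p q⟩
  let γS : G → boundedSeq B.toTracialExpectation k → boundedSeq B.toTracialExpectation k :=
    fun g y => ⟨fun m => γ.act g ((y : ℕ → M) m), by
      obtain ⟨C, hC, h⟩ := y.2
      refine ⟨C, hC, fun m => ⟨(h m).1.act γ.toTracialAction g, ?_⟩⟩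
      rw [← map_star]
      exact (h m).2.act γ.toTracialAction g⟩
  -- `θ` is the sequence of the patched systems, and `π` the passage to the quotient
  let θ : I → I → boundedSeq B.toTracialExpectation k := patched cS sS xS N
  have hθ : ∀ p q m, (θ p q : ℕ → M) m = patch B (s m) (x m) N p q := fun p q m =>
    map_patched (boundedSeq.eval m) cS sS xS N p q
  let π := FiberSeq.mk B.toTracialExpectation k
  let E : ℕ → I → I → FiberSeq B.toTracialExpectation k := fun i p q => π (eS i p q)
  -- central functions remain central, and the `E i` are commuting systems of matrix units
  have hcen : ∀ (f : ℕ → C(K, ℝ))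
      (hf : (fun m => B.real (f m)) ∈ boundedSeq B.toTracialExpectation k)
      (y : FiberSeq B.toTracialExpectation k),
      Commute (π ⟨_, hf⟩) y := by
    intro f hf y
    obtain ⟨y, rfl⟩ := FiberSeq.mk_surjective y
    show π _ * π y = π y * π _
    rw [← map_mul, ← map_mul]
    exact congrArg π (Subtype.ext (funext fun m => B.real_comm (f m) _))
  have hE : ∀ i < N, IsMatrixUnits (E i) := by
    intro i hi
    refine ⟨fun p q r t => ?_, ?_, fun p q => ?_⟩
    · have h1 : E i p q * E i r t = π (if q = r then eS i p t else 0) := by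
        rw [← map_mul]
        refine FiberSeq.mk_eq_of_le fun m => ?_
        have := ((hd m).units i hi).mul p q r t
        split_ifs at this ⊢ <;> exact this
      rw [h1]
      split_ifs
      · rfl
      · exact map_zero π
    · rw [← map_sum, ← map_one π]
      refine FiberSeq.mk_eq_of_le fun m => ?_
      have h1 : ((∑ p, eS i p p : boundedSeq B.toTracialExpectation k) : ℕ → M) m 
          = ∑ p, e m i p p :=
        boundedSeq.coe_sum _ _ _
      rw [h1]
      exact ((hd m).units i hi).one
    · rw [← map_star]
      exact FiberSeq.mk_eq_of_le fun m => ((hd m).units i hi).star_sub p q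
  have hEE : ∀ j < N, ∀ i < j, ∀ p q r t, Commute (E i p q) (E j r t) := by
    intro j hj i hi p q r t
    refine Commute.symm ?_
    show π _ * π _ = π _ * π _
    rw [← map_mul, ← map_mul]
    exact FiberSeq.mk_eq_of_le fun m => (hd m).comm j hj i hi p q r t
  have hX : ∀ i p q, π (xS i p q) = π (sS i) * E i p q := by
    intro i p q
    rw [← map_mul]
    exact FiberSeq.mk_eq_of_eq_zero fun m => (hd m).x_sub i p q
  -- the coefficients satisfy `c² + s² = 1`, and `s = 1` at the level `i₀`
  have hcs : ∀ i, π (cS i) * π (cS i) + π (sS i) * π (sS i) = 1 := by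
    intro i
    rw [← map_mul, ← map_mul, ← map_add, ← map_one π]
    refine congrArg π (Subtype.ext (funext fun m => ?_))
    show B.real (coFun (s m i)) * B.real (coFun (s m i)) + B.real (s m i) * B.real (s m i) = 1
    rw [← B.real_mul, ← B.real_mul, ← B.real_add, ← B.real_one]
    congr 1
    ext l
    show Real.sqrt (1 - s m i l ^ 2) * Real.sqrt (1 - s m i l ^ 2) + s m i l * s m i l = 1
    rw [Real.mul_self_sqrt]
    · ring
    · nlinarith [(hd m).nonneg i l, (hd m).le_one i l]
  have hc₀ : π (cS i₀) = 0 := by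
    rw [← map_zero π]
    refine FiberSeq.mk_eq_of_eq_zero fun m => ?_
    show B.norm2 (k m) (B.real (coFun (s m i₀)) - 0) = 0
    rw [sub_zero, B.norm2_real, abs_eq_zero]
    show Real.sqrt (1 - s m i₀ (k m) ^ 2) = 0
    rw [(hd m).eq_one]
    simp
  have hs₀ : π (sS i₀) = 1 := by
    rw [← map_one π]
    refine FiberSeq.mk_eq_of_eq_zero fun m => ?_
    show B.norm2 (k m) (B.real (s m i₀) - 1) = 0
    rw [← B.real_one, ← B.real_sub, B.norm2_real, abs_eq_zero]
    show s m i₀ (k m) - 1 = 0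
    rw [(hd m).eq_one, sub_self]
  -- in the quotient `θ` is obtained by rotations from exact matrix units, so it consists of matrix
  -- units, which commute with `F` and are transformed by `γ_g` like matrix units under `Ad(μ_g)`
  have hπθ : (fun p q => π (θ p q)) = patched (fun i => π (cS i)) (fun i => π (sS i))
      (fun i p q => π (sS i) * E i p q) N := by
    funext p q
    refine (map_patched (FiberSeq.mk B.toTracialExpectation k).toAlgHom cS sS xS N p q).trans ?_
    congr 1
    funext i p q
    exact hX i p q
  have hU : IsMatrixUnits fun p q => π (θ p q) := by
    rw [hπθ]
    refine IsMatrixUnits.patched (fun i => hcen _ _) (fun i => hcen _ _) hcs (fun i => ?_)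
      (fun i => ?_) hE hEE hc₀ hs₀ hi₀ le_rfl
    · rw [← map_star]
      exact congrArg π (Subtype.ext (funext fun m => B.star_real _))
    · rw [← map_star]
      exact congrArg π (Subtype.ext (funext fun m => B.star_real _))
  have hcomm : ∀ a ∈ F, ∀ p q,
      Commute (π ⟨fun _ => a, B.mem_boundedSeq k fun _ => le_rfl⟩) (π (θ p q)) := by
    intro a ha p q
    rw [congrFun (congrFun hπθ p) q]
    refine Commute.patched (fun i => (hcen _ _ _).symm) (fun i => (hcen _ _ _).symm)
      (fun j hj p q => (hcen _ _ _).symm.mul_right ?_) p q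
    refine Commute.symm ?_
    show π _ * π _ = π _ * π _
    rw [← map_mul, ← map_mul]
    exact FiberSeq.mk_eq_of_le fun m => ((hd m).units j hj).comm a ha p q
  have hequi : ∀ g ∈ H, ∀ p q, π (γS g (θ p q)) = π (conjFam (μ g) θ p q) := by
    intro g hg p q
    have h1 : γS g (θ p q) = patched cS sS (fun i p q => γS g (xS i p q)) N p q := by
      refine Subtype.ext (funext fun m => ?_)
      refine Eq.trans ?_ (map_patched (boundedSeq.eval m) cS sS
        (fun i p q => γS g (xS i p q)) N p q).symm
      show γ.act g ((θ p q : ℕ → M) m) = _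
      rw [hθ]
      refine (map_patched ((γ.act g : M →⋆ₐ[ℂ] M).toAlgHom) _ _ (x m) N p q).trans ?_
      congr 1
      · exact funext fun i => γ.act_real g _
      · exact funext fun i => γ.act_real g _
    have h2 : ∀ i < N, ∀ p q, π (γS g (xS i p q))
        = conjFam (μ g) (fun p q => π (sS i) * E i p q) p q := by
      intro i hi p q
      have h3 : π (γS g (xS i p q)) = π (sS i * γS g (eS i p q)) := by
        refine FiberSeq.mk_eq_of_eq_zero fun m => ?_
        show B.norm2 (k m) (γ.act g (x m i p q) - B.real (s m i) * γ.act g (e m i p q)) = 0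
        rw [← γ.act_real g (s m i), ← map_mul, ← map_sub, norm2_act]
        exact (hd m).x_sub i p q
      have h4 : π (γS g (eS i p q)) = π (conjFam (μ g) (eS i) p q) := by
        refine FiberSeq.mk_eq_of_le fun m => ?_
        have h5 : ((conjFam (μ g) (eS i) p q : boundedSeq B.toTracialExpectation k) : ℕ → M) m
            = conjFam (μ g) (e m i) p q := boundedSeq.coe_conjFam _ _ _ _ _
        rw [h5]
        exact ((hd m).units i hi).equiv g hg p q
      rw [h3, map_mul, h4, map_conjFam]
      simp only [conjFam, Finset.mul_sum, mul_smul_comm]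
      rfl
    rw [map_conjFam, h1, hπθ, ← patched_conjFam (hμ g)]
    refine (map_patched (FiberSeq.mk B.toTracialExpectation k).toAlgHom cS sS _ N p q).trans ?_
    exact congrFun (congrFun (patched_congr fun i hi => funext fun p => funext fun q =>
      h2 i hi p q) p) q
  -- exact relations in the quotient hold up to `ε` for large `m`
  have hev : ∀ᶠ m in atTop, ApproxUnits γ.toTracialAction μ F H (k m) ε
      (patch B (s m) (x m) N) := by
    have ev1 : ∀ᶠ m in atTop, ∀ p q r t, B.norm2 (k m) (patch B (s m) (x m) N p q *
        patch B (s m) (x m) N r t - if q = r then patch B (s m) (x m) N p t else 0) ≤ ε := by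
      simp only [eventually_all]
      intro p q r t
      have h1 : π (θ p q * θ r t) = π (if q = r then θ p t else 0) := by
        rw [map_mul, hU.mul]
        split_ifs
        · rfl
        · exact (map_zero π).symm
      filter_upwards [FiberSeq.eventually_le h1 hε] with m hm
      rw [← hθ, ← hθ, ← hθ]
      split_ifs at hm ⊢ <;> exact hm
    have ev2 : ∀ᶠ m in atTop, B.norm2 (k m) (∑ p, patch B (s m) (x m) N p p - 1) ≤ ε := by
      have h1 : π (∑ p, θ p p) = π 1 := by rw [map_sum, hU.one, map_one]
      filter_upwards [FiberSeq.eventually_le h1 hε] with m hm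
      have h2 : ((∑ p, θ p p : boundedSeq B.toTracialExpectation k) : ℕ → M) m
          = ∑ p, patch B (s m) (x m) N p p :=
        (boundedSeq.coe_sum _ _ _).trans (Finset.sum_congr rfl fun p _ => hθ p p m)
      rw [h2] at hm
      exact hm
    have ev3 : ∀ᶠ m in atTop, ∀ p q, B.norm2 (k m) (star (patch B (s m) (x m) N p q) -
        patch B (s m) (x m) N q p) ≤ ε := by
      simp only [eventually_all]
      intro p q
      have h1 : π (star (θ p q)) = π (θ q p) := by rw [map_star, hU.star_eq]
      filter_upwards [FiberSeq.eventually_le h1 hε] with m hm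
      rw [← hθ, ← hθ]
      exact hm
    have ev4 : ∀ᶠ m in atTop, ∀ a ∈ F, ∀ p q, B.norm2 (k m) (patch B (s m) (x m) N p q * a -
        a * patch B (s m) (x m) N p q) ≤ ε := by
      rw [eventually_all_finite hF]
      intro a ha
      simp only [eventually_all]
      intro p q
      have h1 := (hcomm a ha p q).symm.eq
      rw [← map_mul, ← map_mul] at h1
      filter_upwards [FiberSeq.eventually_le h1 hε] with m hm
      rw [← hθ]
      exact hm
    have ev5 : ∀ᶠ m in atTop, ∀ g ∈ H, ∀ p q, B.norm2 (k m) (γ.act g (patch B (s m) (x m) N p q) -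
        conjFam (μ g) (patch B (s m) (x m) N) p q) ≤ ε := by
      rw [eventually_all_finite hH]
      intro g hg
      simp only [eventually_all]
      intro p q
      filter_upwards [FiberSeq.eventually_le (hequi g hg p q) hε] with m hm
      have h2 : ((conjFam (μ g) θ p q : boundedSeq B.toTracialExpectation k) : ℕ → M) m
          = conjFam (μ g) (patch B (s m) (x m) N) p q := by
        refine (boundedSeq.coe_conjFam _ _ _ _ _).trans ?_
        congr 1
        funext r t
        exact hθ r t m
      rw [h2] at hm
      rw [← hθ]
      exact hm
    filter_upwards [ev1, ev2, ev3, ev4, ev5] with m h1 h2 h3 h4 h5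
    exact ⟨h1, h2, h3, h4, h5⟩
  obtain ⟨m, hm⟩ := hev.exists
  exact hbad m hm

end Patching

end

end EquivariantBundle

namespace EquivariantBundle

noncomputable section

open TracialExpectation

/-! ### Coloured functions on a space of finite covering dimension -/

section Coloring

universe u

variable {K : Type u} [TopologicalSpace K] [CompactSpace K] [TopologicalSpace.MetrizableSpace K]

/-- For nonempty finite sets `S` of indices, the supports of the functions
`∏_{a ∈ S} g_a ∏_{b ∉ S} (g_a - g_b)⁺` belonging to sets of equal size are disjoint. -/
theorem exists_disjoint_of_card_eq {W : Type*} [Fintype W] [DecidableEq W] {g : W → K → ℝ}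
    (hgc : ∀ v, Continuous (g v)) (hg0 : ∀ v l, 0 ≤ g v l) (hgpos : ∀ l, ∃ v, g v l ≠ 0) :
    ∃ s : {S : Finset W // S.Nonempty} → C(K, ℝ), (∀ S l, 0 ≤ s S l) ∧ (∀ S l, s S l ≤ 1) ∧
      (∀ S l, s S l ≠ 0 → ∀ v ∈ S.1, g v l ≠ 0) ∧
      (∀ S T l, S.1.card = T.1.card → s S l ≠ 0 → s T l ≠ 0 → S = T) ∧
      ∀ l, ∃ S, s S l = 1 := by
  obtain ⟨f, hfdef⟩ : ∃ f : Finset W → K → ℝ,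
      f = fun S l => ∏ v ∈ S, (g v l * ∏ b ∈ Sᶜ, max 0 (g v l - g b l)) := ⟨_, rfl⟩
  have hfc : ∀ S, Continuous (f S) := fun S => by
    rw [hfdef]
    fun_prop
  have hf0 : ∀ S l, 0 ≤ f S l := fun S l => by
    rw [hfdef]
    exact Finset.prod_nonneg fun v _ =>
      mul_nonneg (hg0 v l) (Finset.prod_nonneg fun b _ => le_max_left _ _)
  have hfg : ∀ S l, f S l ≠ 0 → ∀ v ∈ S, g v l ≠ 0 := fun S l hS v hv h0 => by
    rw [hfdef] at hS
    exact hS (Finset.prod_eq_zero hv (by rw [h0, zero_mul]))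
  have hflt : ∀ S l, f S l ≠ 0 → ∀ v ∈ S, ∀ b ∉ S, g b l < g v l := by
    intro S l hS v hv b hb
    by_contra! hlt
    rw [hfdef] at hS
    have h0 : ∏ b ∈ Sᶜ, max 0 (g v l - g b l) = 0 :=
      Finset.prod_eq_zero (i := b) (by simpa using hb) (max_eq_left (by linarith))
    exact hS (Finset.prod_eq_zero hv (by rw [h0, mul_zero]))
  obtain ⟨tot, htotdef⟩ : ∃ tot : K → ℝ,
      tot = fun l => ∑ T : {S : Finset W // S.Nonempty}, f T.1 l := ⟨_, rfl⟩
  -- `f_S(l) > 0` for the set `S` of all `v` with `g_v(l) ≠ 0`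
  have htot : ∀ l, 0 < tot l := by
    intro l
    obtain ⟨v, hv⟩ := hgpos l
    have hS : (Finset.univ.filter fun v => g v l ≠ 0).Nonempty := ⟨v, by simpa using hv⟩
    have hfS : 0 < f (Finset.univ.filter fun v => g v l ≠ 0) l := by
      rw [hfdef]
      refine Finset.prod_pos fun w hw => ?_
      have hw0 : 0 < g w l := lt_of_le_of_ne (hg0 w l) (Finset.mem_filter.1 hw).2.symm
      refine mul_pos hw0 (Finset.prod_pos fun b hb => lt_max_of_lt_right ?_)
      have hb' : g b l = 0 := by simpa using hb
      rw [hb', sub_zero]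
      exact hw0
    rw [htotdef]
    exact hfS.trans_le (Finset.single_le_sum (f := fun T : {S : Finset W // S.Nonempty} => f T.1 l)
      (fun T _ => hf0 T.1 l) (Finset.mem_univ ⟨_, hS⟩))
  have htotc : Continuous tot := by
    rw [htotdef]
    exact continuous_finsetSum _ fun T _ => hfc T.1
  obtain ⟨N, hN⟩ : ∃ N : ℝ, N = Fintype.card {S : Finset W // S.Nonempty} := ⟨_, rfl⟩
  have hN0 : 0 ≤ N := by rw [hN]; positivity
  have hs0 : ∀ (S : {S : Finset W // S.Nonempty}) l, min 1 (N * f S.1 l / tot l) ≠ 0 →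
      f S.1 l ≠ 0 := by
    intro S l hS h0
    refine hS ?_
    rw [h0, mul_zero, zero_div]
    exact min_eq_right zero_le_one
  -- at each point some `f_S` is at least the average `tot / N`, so that it becomes `1` after
  -- division by the average and truncation
  refine ⟨fun S => ⟨fun l => min 1 (N * f S.1 l / tot l),
      continuous_const.min ((continuous_const.mul (hfc _)).div htotc fun l => (htot l).ne')⟩,
    fun S l => le_min zero_le_one (div_nonneg (mul_nonneg hN0 (hf0 _ _)) (htot l).le),
    fun S l => min_le_left _ _, fun S l hl => hfg _ l (hs0 S l hl), fun S T l hST hS hT => ?_,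
    fun l => ?_⟩
  · have hS' := hs0 S l hS
    have hT' := hs0 T l hT
    refine Subtype.ext ?_
    -- of two different sets of equal size neither contains the other: `g_w < g_v` and `g_v < g_w`
    by_contra hne
    have h1 : ∃ v ∈ S.1, v ∉ T.1 := by
      by_contra! hcon
      exact hne (Finset.eq_of_subset_of_card_le hcon hST.ge)
    have h2 : ∃ v ∈ T.1, v ∉ S.1 := by
      by_contra! hcon
      exact hne (Finset.eq_of_subset_of_card_le hcon hST.le).symm
    obtain ⟨v, hvS, hvT⟩ := h1
    obtain ⟨w, hwT, hwS⟩ := h2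
    exact lt_asymm (hflt _ l hS' v hvS w hwS) (hflt _ l hT' w hwT v hvT)
  · obtain ⟨S, hS⟩ : ∃ S : {S : Finset W // S.Nonempty}, tot l ≤ N * f S.1 l := by
      by_contra! hcon
      have hne : (Finset.univ : Finset {S : Finset W // S.Nonempty}).Nonempty := by
        obtain ⟨v, -⟩ := hgpos l
        exact ⟨⟨{v}, Finset.singleton_nonempty v⟩, Finset.mem_univ _⟩
      have h1 := Finset.sum_lt_sum_of_nonempty hne fun T _ => hcon T
      rw [← Finset.mul_sum, Finset.sum_const, Finset.card_univ, nsmul_eq_mul, ← hN, htotdef] at h1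
      exact lt_irrefl _ h1
    exact ⟨S, min_eq_left ((one_le_div (htot l)).2 hS)⟩

/-- On a space of covering dimension at most `n` there are finitely many functions in `n + 2`
levels, with supports subordinate to given neighbourhoods and disjoint within each level, such that
at each point one of them takes the value `1`. -/
theorem exists_coloring {n : ℕ} (h : CoveringDimLE K n) (O : K → Set K) (hO : ∀ k, O k ∈ 𝓝 k) :
    ∃ (ι : Type u) (_ : Fintype ι) (a : ι → K) (lev : ι → ℕ) (s : ι → C(K, ℝ)),
      (∀ j l, 0 ≤ s j l) ∧ (∀ j l, s j l ≤ 1) ∧ (∀ j l, s j l ≠ 0 → l ∈ O (a j)) ∧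
      (∀ i j l, lev i = lev j → s i l ≠ 0 → s j l ≠ 0 → i = j) ∧
      ∀ l, ∃ j, lev j < n + 2 ∧ s j l = 1 := by
  classical
  obtain ⟨t, ht⟩ := CompactSpace.elim_nhds_subcover (fun k => interior (O k))
    fun k => interior_mem_nhds.2 (hO k)
  obtain ⟨V, hVo, hVc, hVU, hVn⟩ := h ((fun k => interior (O k)) '' t) (t.finite_toSet.image _)
    (by rintro _ ⟨k, -, rfl⟩; exact isOpen_interior) (by rw [Set.sUnion_image]; exact ht)
  obtain ⟨t', ht'⟩ := isCompact_univ.elim_finite_subcover (fun v : V => (v : Set K))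
    (fun v => hVo v v.2) (by rw [← Set.sUnion_eq_iUnion, hVc])
  have hsub : ∀ v : {v : V // v ∈ t'}, ∃ k, (v : Set K) ⊆ O k := by
    intro v
    obtain ⟨_, ⟨k, -, rfl⟩, hk⟩ := hVU v v.1.2
    exact ⟨k, hk.trans interior_subset⟩
  choose a ha using hsub
  obtain ⟨g, hg⟩ := PartitionOfUnity.exists_isSubordinate isClosed_univ
    (fun v : {v : V // v ∈ t'} => (v : Set K)) (fun v => hVo v v.1.2) (by
      intro k hk
      obtain ⟨v, hv, hkv⟩ := Set.mem_iUnion₂.1 (ht' hk)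
      exact Set.mem_iUnion.2 ⟨⟨v, hv⟩, hkv⟩)
  have hgmem : ∀ (v : {v : V // v ∈ t'}) l, g v l ≠ 0 → l ∈ (v : Set K) := fun v l hl =>
    hg v (subset_tsupport _ hl)
  obtain ⟨s, hs0, hs1, hsg, hsd, hs⟩ := exists_disjoint_of_card_eq (g := fun v l => g v l)
    (fun v => (g v).continuous) (fun v l => g.nonneg v l) (fun l => by
      by_contra! hcon
      have := g.sum_eq_one (Set.mem_univ l)
      rw [finsum_eq_zero_of_forall_eq_zero hcon] at this
      exact zero_ne_one this)
  -- the level of `S` is its size; at most `n + 1` of the `g_v` are nonzero at a point, so the sets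
  -- that occur have between `1` and `n + 1` elements
  refine ⟨{S : Finset {v : V // v ∈ t'} // S.Nonempty}, inferInstance, fun S => a S.2.choose,
    fun S => S.1.card, s, hs0, hs1, fun S l hl => ha _ (hgmem _ l (hsg S l hl _ S.2.choose_spec)),
    hsd, fun l => ?_⟩
  obtain ⟨S, hS⟩ := hs l
  refine ⟨S, ?_, hS⟩
  have h1 : ((S.1.image fun v : {v : V // v ∈ t'} => v.1.1 : Finset (Set K)) : Set (Set K))
      ⊆ {v ∈ V | l ∈ v} := by
    intro v hv
    obtain ⟨w, hw, rfl⟩ := Finset.mem_image.1 (Finset.mem_coe.1 hv)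
    exact ⟨w.1.2, hgmem w l (hsg S l (by rw [hS]; exact one_ne_zero) w hw)⟩
  have h2 := (Set.encard_le_encard h1).trans (hVn l)
  rw [Set.encard_coe_eq_coe_finsetCard, Finset.card_image_of_injective _ fun v w hvw =>
    Subtype.ext (Subtype.ext hvw)] at h2
  have h3 : S.1.card ≤ n + 1 := by exact_mod_cast h2
  exact Nat.lt_succ_of_le h3

end Coloring

/-! ### Global approximate equivariant matrix units -/

section Global

variable {K M : Type*} [TopologicalSpace K] [CompactSpace K] [CStarAlgebra M]
  [PartialOrder M] [StarOrderedRing M] {B : WStarBundle K M}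
  {G I : Type*} [Group G] [Fintype I] [DecidableEq I] {γ : FiberwiseAction G B}
  {μ : G → Matrix I I ℂ}

theorem ApproxUnits.mono {F F' : Set M} {H : Set G} {k : K} {ε ε' : ℝ} {e : I → I → M}
    (h : ApproxUnits γ.toTracialAction μ F H k ε e) (hF : F' ⊆ F) (hε : ε ≤ ε') :
    ApproxUnits γ.toTracialAction μ F' H k ε' e :=
  ⟨fun p q r s => (h.mul p q r s).trans hε, h.one.trans hε, fun p q => (h.star_sub p q).trans hε,
    fun a ha p q => (h.comm a (hF ha) p q).trans hε, fun g hg p q => (h.equiv g hg p q).trans hε⟩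

theorem ApproxUnits.eventually {F : Set M} (hF : F.Finite) {H : Set G} (hH : H.Finite) {k : K}
    {ε ε' : ℝ} {e : I → I → M} (h : ApproxUnits γ.toTracialAction μ F H k ε e) (hε : ε < ε') :
    ∀ᶠ l in 𝓝 k, ApproxUnits γ.toTracialAction μ F H l ε' e := by
  have key : ∀ a : M, B.norm2 k a ≤ ε → ∀ᶠ l in 𝓝 k, B.norm2 l a ≤ ε' := fun a ha =>
    (((B.continuous_norm2 a).tendsto k).eventually (gt_mem_nhds (ha.trans_lt hε))).mono
      fun _ h => h.le
  have h1 : ∀ᶠ l in 𝓝 k, ∀ p q r s,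
      B.norm2 l (e p q * e r s - if q = r then e p s else 0) ≤ ε' := by
    simp only [eventually_all]
    exact fun p q r s => key _ (h.mul p q r s)
  have h3 : ∀ᶠ l in 𝓝 k, ∀ p q, B.norm2 l (star (e p q) - e q p) ≤ ε' := by
    simp only [eventually_all]
    exact fun p q => key _ (h.star_sub p q)
  have h4 : ∀ᶠ l in 𝓝 k, ∀ a ∈ F, ∀ p q, B.norm2 l (e p q * a - a * e p q) ≤ ε' := by
    rw [eventually_all_finite hF]
    simp only [eventually_all]
    exact fun a ha p q => key _ (h.comm a ha p q)
  have h5 : ∀ᶠ l in 𝓝 k, ∀ g ∈ H, ∀ p q,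
      B.norm2 l (γ.act g (e p q) - conjFam (μ g) e p q) ≤ ε' := by
    rw [eventually_all_finite hH]
    simp only [eventually_all]
    exact fun g hg p q => key _ (h.equiv g hg p q)
  filter_upwards [h1, key _ h.one, h3, h4, h5] with l h1 h2 h3 h4 h5
  exact ⟨h1, h2, h3, h4, h5⟩

variable (γ μ) in
/-- Every fiber contains contractive approximate equivariant matrix units. -/
def LocallyApproximable : Prop := ∀ (k : K) (F : Set M) (H : Set G) (ε : ℝ), F.Finite →
  H.Finite → 0 < ε → ∃ e : I → I → M, (∀ p q, ‖e p q‖ ≤ 1) ∧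
    ApproxUnits γ.toTracialAction μ F H k ε e

/-- By compactness, finitely many local families suffice. -/
theorem LocallyApproximable.exists_finite (hloc : LocallyApproximable γ μ) {F : Set M}
    (hF : F.Finite) {H : Set G} (hH : H.Finite) {δ : ℝ} (hδ : 0 < δ) :
    ∃ E : K → I → I → M, (Set.range E).Finite ∧ (∀ k p q, ‖E k p q‖ ≤ 1) ∧
      ∀ k, ∀ᶠ l in 𝓝 k, ApproxUnits γ.toTracialAction μ F H l δ (E k) := by
  choose e he1 he2 using fun k => hloc k F H (δ / 2) hF hH (half_pos hδ)
  obtain ⟨t, ht⟩ := CompactSpace.elim_nhds_subcover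
    (fun k => interior {l | ApproxUnits γ.toTracialAction μ F H l δ (e k)})
    fun k => interior_mem_nhds.2 ((he2 k).eventually hF hH (half_lt_self hδ))
  have hc : ∀ k, ∃ l ∈ t, k ∈ interior {l' | ApproxUnits γ.toTracialAction μ F H l' δ (e l)} := by
    intro k
    obtain ⟨l, hl, hk⟩ := Set.mem_iUnion₂.1 (ht.ge (Set.mem_univ k))
    exact ⟨l, hl, hk⟩
  choose c hct hc using hc
  refine ⟨fun k => e (c k), (t.finite_toSet.image e).subset ?_, fun k => he1 _, fun k =>
    mem_interior_iff_mem_nhds.1 (hc k)⟩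
  rintro _ ⟨k, rfl⟩
  exact ⟨c k, hct k, rfl⟩

/-- Patching contractions over a given number of levels gives a norm bound that depends only on this
number and on the size of the systems. -/
theorem norm_patch_le (B : WStarBundle K M) (I : Type*) [Fintype I] (N : ℕ) :
    ∃ C : ℝ, ∀ (s : ℕ → C(K, ℝ)) (x : ℕ → I → I → M), (∀ i l, 0 ≤ s i l) → (∀ i l, s i l ≤ 1) →
      (∀ i p q, ‖x i p q‖ ≤ 1) → ∀ p q, ‖patch B s x N p q‖ ≤ C := by
  induction N with
  | zero => exact ⟨0, fun s x _ _ _ p q => by simp [patch, patched]⟩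
  | succ N ih =>
    obtain ⟨C, ih⟩ := ih
    refine ⟨C + 1 + 2 * (C * (∑ _ : I, ∑ _ : I, C)), fun s x h0 h1 hx p q => ?_⟩
    have hC := ih s x h0 h1 hx
    have hC0 : 0 ≤ C := (norm_nonneg _).trans (hC p q)
    have hs : ‖B.real (s N)‖ ≤ 1 := B.norm_real_le zero_le_one fun l =>
      abs_le.2 ⟨by linarith [h0 N l], h1 N l⟩
    have hc : ‖B.real (coFun (s N))‖ ≤ 1 := B.norm_real_le zero_le_one fun l => by
      show |Real.sqrt (1 - s N l ^ 2)| ≤ 1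
      rw [abs_of_nonneg (Real.sqrt_nonneg _)]
      exact Real.sqrt_le_one.2 (by nlinarith [sq_nonneg (s N l)])
    have hmul1 : ∀ {a b : M} {D : ℝ}, ‖a‖ ≤ 1 → ‖b‖ ≤ D → ‖a * b‖ ≤ D := fun ha hb =>
      (norm_mul_le _ _).trans ((mul_le_mul ha hb (norm_nonneg _) zero_le_one).trans_eq (one_mul _))
    set θ : I → I → M := patched (fun i => B.real (coFun (s i))) (fun i => B.real (s i)) x N
    have hθ : ∀ p q, ‖θ p q‖ ≤ C := hC
    have hflip : ‖flip θ (x N)‖ ≤ ∑ _ : I, ∑ _ : I, C := by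
      refine (norm_sum_le _ _).trans (Finset.sum_le_sum fun r _ => ?_)
      refine (norm_sum_le _ _).trans (Finset.sum_le_sum fun t _ => ?_)
      refine (norm_mul_le _ _).trans ((mul_le_mul (hθ r t) (hx N t r) (norm_nonneg _) hC0).trans_eq
        (mul_one _))
    have hD0 := (norm_nonneg _).trans hflip
    show ‖B.real (coFun (s N)) * B.real (coFun (s N)) * θ p q + B.real (s N) * x N p q
      + Complex.I • (B.real (coFun (s N)) * (θ p q * flip θ (x N) - flip θ (x N) * θ p q))‖ ≤ _
    refine (norm_add_le _ _).trans (add_le_add ((norm_add_le _ _).trans (add_le_add ?_ ?_)) ?_)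
    · exact hmul1 (hmul1 hc hc) (hθ p q)
    · exact hmul1 hs (hx N p q)
    · rw [norm_smul, Complex.norm_I, one_mul]
      refine hmul1 hc ((norm_sub_le _ _).trans ?_)
      have e1 := (norm_mul_le (θ p q) (flip θ (x N))).trans
        (mul_le_mul (hθ p q) hflip (norm_nonneg _) hC0)
      have e2 := (norm_mul_le (flip θ (x N)) (θ p q)).trans
        (mul_le_mul hflip (hθ p q) (norm_nonneg _) hD0)
      linarith

theorem WStarBundle.real_zero (B : WStarBundle K M) : B.real 0 = 0 := by
  rw [← sub_self (0 : C(K, ℝ)), B.real_sub, sub_self]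

theorem WStarBundle.real_sum (B : WStarBundle K M) {ι : Type*} (t : Finset ι)
    (f : ι → C(K, ℝ)) : B.real (∑ i ∈ t, f i) = ∑ i ∈ t, B.real (f i) :=
  map_sum (⟨⟨B.real, B.real_zero⟩, B.real_add⟩ : C(K, ℝ) →+ M) f t

/-- A sequence of levels: finitely many local families for each level, those of a level commuting
approximately with all families of the lower levels. -/
theorem LocallyApproximable.exists_levels (hloc : LocallyApproximable γ μ) {F : Set M}
    (hF : F.Finite) {H : Set G} (hH : H.Finite) {δ : ℝ} (hδ : 0 < δ) :
    ∃ E : ℕ → K → I → I → M, (∀ i k p q, ‖E i k p q‖ ≤ 1) ∧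
      ∀ i k, ∀ᶠ l in 𝓝 k, ApproxUnits γ.toTracialAction μ
        (F ∪ {a | ∃ j < i, ∃ k p q, E j k p q = a}) H l δ (E i k) := by
  choose E hEfin hE1 hE2 using fun S : {S : Set M // S.Finite} =>
    hloc.exists_finite S.2 hH hδ
  have hent : ∀ S, {a | ∃ k p q, E S k p q = a}.Finite := by
    intro S
    refine (((hEfin S).prod (Set.finite_univ (α := I × I))).image
      fun y => y.1 y.2.1 y.2.2).subset ?_
    rintro _ ⟨k, p, q, rfl⟩
    exact ⟨(E S k, p, q), ⟨⟨k, rfl⟩, Set.mem_univ _⟩, rfl⟩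
  let st : ℕ → {S : Set M // S.Finite} := fun i =>
    Nat.rec ⟨F, hF⟩ (fun _ S => ⟨S.1 ∪ {a | ∃ k p q, E S k p q = a}, S.2.union (hent S)⟩) i
  have hst : ∀ i, (st (i + 1)).1 = (st i).1 ∪ {a | ∃ k p q, E (st i) k p q = a} := fun _ => rfl
  have hmono : Monotone fun i => (st i).1 := monotone_nat_of_le_succ fun i => by
    rw [hst]
    exact Set.subset_union_left
  refine ⟨fun i => E (st i), fun i => hE1 _, fun i k => (hE2 (st i) k).mono fun l hl =>
    hl.mono (Set.union_subset (hmono (Nat.zero_le i)) ?_) le_rfl⟩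
  rintro _ ⟨j, hj, k', p, q, rfl⟩
  exact hmono (Nat.succ_le_of_lt hj) (Or.inr ⟨k', p, q, rfl⟩ : _ ∈ (st (j + 1)).1)

/-- Over a base space of finite covering dimension, approximate matrix units in the fibers can be
patched to approximate matrix units for all fibers simultaneously, with a uniform bound. -/
theorem LocallyApproximable.exists_approxUnits [TopologicalSpace.MetrizableSpace K] {n : ℕ}
    (hdim : CoveringDimLE K n) (hμ : ∀ g, μ g * star (μ g) = 1) (hloc : LocallyApproximable γ μ) :
    ∃ C : ℝ, ∀ (F : Set M) (H : Set G) (ε : ℝ), F.Finite → H.Finite → 0 < ε →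
      ∃ e : I → I → M, (∀ p q, ‖e p q‖ ≤ C) ∧
        ∀ k, ApproxUnits γ.toTracialAction μ F H k ε e := by
  classical
  obtain ⟨C, hC⟩ := norm_patch_le B I (n + 2)
  refine ⟨C, fun F H ε hF hH hε => ?_⟩
  -- a tolerance that serves for all positions `i₀` of the coefficient `1`
  obtain ⟨δ, hδ, htol⟩ : ∃ δ > 0, ∀ i₀ < n + 2, ∀ s x k e,
      PatchData γ μ F H (n + 2) i₀ δ s x k e →
      ApproxUnits γ.toTracialAction μ F H k ε (patch B s x (n + 2)) := by
    choose! δ hδ htol using fun i₀ (hi₀ : i₀ < n + 2) =>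
      exists_patch_tolerance γ hμ hF hH hi₀ hε
    have hne : (Finset.range (n + 2)).Nonempty := ⟨0, by simp⟩
    refine ⟨(Finset.range (n + 2)).inf' hne δ, (Finset.lt_inf'_iff _).2 fun i hi =>
      hδ i (Finset.mem_range.1 hi), fun i₀ hi₀ s x k e hd => htol i₀ hi₀ s x k e ?_⟩
    have hle := Finset.inf'_le δ (Finset.mem_range.2 hi₀)
    exact ⟨hd.nonneg, hd.le_one, hd.norm_x, hd.norm_e, hd.x_sub,
      fun i hi => (hd.units i hi).mono subset_rfl hle,
      fun j hj i hi p q r t => (hd.comm j hj i hi p q r t).trans hle, hd.eq_one⟩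
  obtain ⟨E, hE1, hE2⟩ := hloc.exists_levels hF hH hδ
  let O : K → Set K := fun k => ⋂ i ∈ Finset.range (n + 2), {l | ApproxUnits γ.toTracialAction μ
    (F ∪ {a | ∃ j < i, ∃ k p q, E j k p q = a}) H l δ (E i k)}
  have hO : ∀ k, O k ∈ 𝓝 k := fun k => (Filter.biInter_finset_mem _).2 fun i _ => hE2 i k
  obtain ⟨ι, _, a, lev, s, hs0, hs1, hsO, hsd, hs⟩ := exists_coloring hdim O hO
  -- at a point, all nonzero coefficients of a level belong to the same family
  have hL : ∀ i k, ∃ l, k ∈ O l ∧ ∀ j, lev j = i → s j k ≠ 0 → a j = l := by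
    intro i k
    by_cases hex : ∃ j, lev j = i ∧ s j k ≠ 0
    · obtain ⟨j, hj, hjk⟩ := hex
      exact ⟨a j, hsO j k hjk, fun j' hj' hjk' =>
        congrArg a (hsd j' j k (hj'.trans hj.symm) hjk' hjk)⟩
    · exact ⟨k, mem_of_mem_nhds (hO k), fun j hj hjk => absurd ⟨j, hj, hjk⟩ hex⟩
  choose L hLO hL using hL
  -- the coefficient and the system of a level: at each point at most one summand is nonzero
  let S : ℕ → C(K, ℝ) := fun i => ∑ j with lev j = i, s j
  let x : ℕ → I → I → M := fun i p q => ∑ j with lev j = i, B.real (s j) * E i (a j) p q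
  have hSval : ∀ i l, S i l = ∑ j with lev j = i, s j l := fun i l => by
    simp [S, ContinuousMap.sum_apply]
  have hS : ∀ j l, s j l ≠ 0 → S (lev j) l = s j l := by
    intro j l hj
    rw [hSval]
    refine Finset.sum_eq_single j (fun j' hj' hne => ?_) (by simp)
    by_contra h0
    exact hne (hsd j' j l (Finset.mem_filter.1 hj').2 h0 hj)
  have hS1 : ∀ i l, S i l ≤ 1 := by
    intro i l
    by_cases hex : ∃ j, lev j = i ∧ s j l ≠ 0
    · obtain ⟨j, rfl, hj⟩ := hex
      rw [hS j l hj]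
      exact hs1 j l
    · push Not at hex
      rw [hSval, Finset.sum_eq_zero fun j hj => hex j (Finset.mem_filter.1 hj).2]
      exact zero_le_one
  have hS0 : ∀ i l, 0 ≤ S i l := fun i l => by
    rw [hSval]
    exact Finset.sum_nonneg fun j _ => hs0 j l
  have hx : ∀ k i p q, B.norm2 k (x i p q - B.real (S i) * E i (L i k) p q) = 0 := by
    intro k i p q
    have h1 : x i p q - B.real (S i) * E i (L i k) p q
        = ∑ j with lev j = i, B.real (s j) * (E i (a j) p q - E i (L i k) p q) := by
      simp only [x, S, B.real_sum, Finset.sum_mul, mul_sub, Finset.sum_sub_distrib]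
    rw [h1]
    refine le_antisymm ((norm2_sum_le _ _ _ _).trans (le_of_eq ?_)) (norm2_nonneg _ _ _)
    refine Finset.sum_eq_zero fun j hj => ?_
    rw [B.norm2_real_mul]
    by_cases h0 : s j k = 0
    · rw [h0, abs_zero, zero_mul]
    · rw [hL i k j (Finset.mem_filter.1 hj).2 h0, sub_self, norm2_zero, mul_zero]
  have hx1 : ∀ i p q, ‖x i p q‖ ≤ 1 := by
    intro i p q
    refine B.norm_le_of_opNormLE zero_le_one (opNormLE_of_opNormLEAt zero_le_one fun k b => ?_)
    have h1 : x i p q * b = (x i p q - B.real (S i) * E i (L i k) p q) * b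
        + B.real (S i) * (E i (L i k) p q * b) := by noncomm_ring
    have h2 := B.norm2_mul_le' k (x i p q - B.real (S i) * E i (L i k) p q) b
    rw [hx, zero_mul] at h2
    have h3 := B.norm2_real_mul k (S i) (E i (L i k) p q * b)
    rw [abs_of_nonneg (hS0 i k)] at h3
    have h4 := (B.norm2_mul_le k (E i (L i k) p q) b).trans
      (mul_le_mul_of_nonneg_right (hE1 i _ p q) (norm2_nonneg _ _ _))
    have h5 := mul_le_mul (hS1 i k) h4 (norm2_nonneg _ _ _) zero_le_one
    rw [h1]
    refine (norm2_add_le _ _ _ _).trans ?_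
    linarith
  refine ⟨patch B S x (n + 2), hC S x hS0 hS1 hx1, fun k => ?_⟩
  obtain ⟨j, hj, hjk⟩ := hs k
  have hunits : ∀ i < n + 2, ApproxUnits γ.toTracialAction μ
      (F ∪ {a | ∃ j < i, ∃ k p q, E j k p q = a}) H k δ (E i (L i k)) := fun i hi =>
    Set.mem_iInter₂.1 (hLO i k) i (Finset.mem_range.2 hi)
  refine htol (lev j) hj S x k (fun i => E i (L i k)) ⟨hS0, hS1, hx1, fun i => hE1 i _, hx k,
    fun i hi => (hunits i hi).mono Set.subset_union_left le_rfl,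
    fun j hj i hi p q r t => (hunits j hj).comm _ (Or.inr ⟨i, hi, L i k, p, q, rfl⟩) r t, ?_⟩
  rw [hS j k (by rw [hjk]; exact one_ne_zero), hjk]

end Global

end

end EquivariantBundle

namespace EquivariantBundle

noncomputable section

open TracialExpectation

/-! ### Unitaries close to approximate symmetries -/

section Unitary

variable {D : Type*} [CStarAlgebra D] {v : D}

theorem star_cfc_add_mul_self {f g : ℝ → ℝ} (hf : Continuous f)
    (hg : Continuous g) :
    star (cfc f v + Complex.I • cfc g v) * (cfc f v + Complex.I • cfc g v)
      = cfc (fun t => f t * f t + g t * g t) v := by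
  have hfs : star (cfc f v) = cfc f v := cfc_predicate f v
  have hgs : star (cfc g v) = cfc g v := cfc_predicate g v
  have hcomm : cfc g v * cfc f v = cfc f v * cfc g v := (cfc_commute_cfc g f v).eq
  rw [star_add, star_smul, hfs, hgs, cfc_add v (fun t => f t * f t) (fun t => g t * g t)
    (by fun_prop) (by fun_prop), cfc_mul f f v (by fun_prop) (by fun_prop),
    cfc_mul g g v (by fun_prop) (by fun_prop)]
  have hI : ∀ x : D, Complex.I • Complex.I • x = -x := fun x => by
    rw [smul_smul, Complex.I_mul_I, neg_smul, one_smul]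
  simp only [add_mul, mul_add, smul_mul_assoc, mul_smul_comm, Complex.star_def, Complex.conj_I,
    neg_mul, hcomm, neg_smul, smul_add, smul_neg, hI, neg_neg]
  abel

theorem cfc_add_mul_star_self {f g : ℝ → ℝ} (hf : Continuous f)
    (hg : Continuous g) :
    (cfc f v + Complex.I • cfc g v) * star (cfc f v + Complex.I • cfc g v)
      = cfc (fun t => f t * f t + g t * g t) v := by
  rw [← star_cfc_add_mul_self hf hg]
  have hfs : star (cfc f v) = cfc f v := cfc_predicate f v
  have hgs : star (cfc g v) = cfc g v := cfc_predicate g v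
  have hcomm : cfc g v * cfc f v = cfc f v * cfc g v := (cfc_commute_cfc g f v).eq
  rw [star_add, star_smul, hfs, hgs]
  simp only [add_mul, mul_add, smul_mul_assoc, mul_smul_comm, hcomm, Complex.star_def,
    Complex.conj_I, neg_mul, neg_smul, mul_neg, smul_add, smul_neg]
  abel

/-- A self-adjoint `v` is close to a unitary `V` if `v²` is close to `1`: with the truncation
`c(t) = max(-1, min(t, 1))`, the unitary `V = c(v) + i (1 - c(v)²)^{1/2}` satisfies
`|V - v|² ≤ |v² - 1|`. -/
theorem exists_unitary_near (hv : IsSelfAdjoint v) :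
    ∃ V r q : D, star V * V = 1 ∧ V * star V = 1 ∧
      star (V - v) * (V - v) + star r * r = q ∧ star q = q ∧
      q * q = (v * v - 1) * (v * v - 1) := by
  let c : ℝ → ℝ := fun t => max (-1) (min t 1)
  let b : ℝ → ℝ := fun t => Real.sqrt (1 - c t ^ 2)
  let r : ℝ → ℝ := fun t => Real.sqrt (2 * max (|t| - 1) 0)
  have hc : Continuous c := by fun_prop
  have hb : Continuous b := by fun_prop
  have hr : Continuous r := by fun_prop
  have hc1 : ∀ t, c t ^ 2 ≤ 1 := fun t => by
    have h1 : -1 ≤ c t := le_max_left _ _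
    have h2 : c t ≤ 1 := max_le (by norm_num) (min_le_right _ _)
    nlinarith
  have hbb : ∀ t, b t * b t = 1 - c t ^ 2 := fun t =>
    Real.mul_self_sqrt (by linarith [hc1 t])
  have hrr : ∀ t, r t * r t = 2 * max (|t| - 1) 0 := fun t =>
    Real.mul_self_sqrt (mul_nonneg zero_le_two (le_max_right _ _))
  have hone : cfc (fun t => c t * c t + b t * b t) v = 1 := by
    have : (fun t => c t * c t + b t * b t) = fun _ => 1 := by
      funext t
      rw [hbb]
      ring
    rw [this, cfc_const_one ℝ v]
  refine ⟨cfc c v + Complex.I • cfc b v, cfc r v, cfc (fun t : ℝ => |t * t - 1|) v, ?_, ?_, ?_,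
    cfc_predicate (fun t : ℝ => |t * t - 1|) v, ?_⟩
  · rw [star_cfc_add_mul_self hc hb, hone]
  · rw [cfc_add_mul_star_self hc hb, hone]
  · have h1 : cfc c v + Complex.I • cfc b v - v
        = cfc (fun t => c t - t) v + Complex.I • cfc b v := by
      rw [cfc_sub c (fun t => t) v (by fun_prop) (by fun_prop), cfc_id' ℝ v]
      abel
    have hrs : star (cfc r v) = cfc r v := cfc_predicate r v
    rw [h1, star_cfc_add_mul_self (by fun_prop) hb, hrs, ← cfc_mul r r v (by fun_prop)
      (by fun_prop), ← cfc_add v _ _ (by fun_prop) (by fun_prop)]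
    congr 1
    funext t
    rw [hbb, hrr]
    -- both sides are `1 - t²` on `[-1, 1]` and `t² - 1` elsewhere
    rcases le_total t (-1) with h | h
    · have e1 : c t = -1 := by
        show max (-1) (min t 1) = -1
        rw [min_eq_left (by linarith), max_eq_left h]
      rw [e1, abs_of_nonpos (show t ≤ 0 by linarith), max_eq_left (by linarith),
        abs_of_nonneg (by nlinarith)]
      ring
    · rcases le_total t 1 with h' | h'
      · have e1 : c t = t := by
          show max (-1) (min t 1) = t
          rw [min_eq_left h', max_eq_right h]
        rw [e1, max_eq_right (by linarith [abs_le.2 ⟨h, h'⟩]), abs_of_nonpos (by nlinarith)]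
        ring
      · have e1 : c t = 1 := by
          show max (-1) (min t 1) = 1
          rw [min_eq_right h', max_eq_right (by norm_num)]
        rw [e1, abs_of_nonneg (show 0 ≤ t by linarith), max_eq_left (by linarith),
          abs_of_nonneg (by nlinarith)]
        ring
  · have h1 : cfc (fun t : ℝ => t * t - 1) v = v * v - 1 := by
      rw [cfc_sub (fun t : ℝ => t * t) (fun _ => 1) v (by fun_prop) (by fun_prop),
        cfc_mul (fun t : ℝ => t) (fun t => t) v (by fun_prop) (by fun_prop), cfc_id' ℝ v,
        cfc_const_one ℝ v]
    rw [← h1, ← cfc_mul _ _ v (by fun_prop) (by fun_prop), ← cfc_mul _ _ v (by fun_prop)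
      (by fun_prop)]
    congr 1
    funext t
    exact abs_mul_abs_self _

end Unitary

section Flip

variable {M R I : Type*} [CStarAlgebra M] [PartialOrder M] [StarOrderedRing M] [Ring R]
  [StarRing R] [Algebra ℂ R] [StarModule ℂ R] [Fintype I] [DecidableEq I]

theorem sum_one_tmul_single (M : Type*) [CStarAlgebra M] [PartialOrder M] [StarOrderedRing M]
    (θ : Matrix I I ℂ →⋆ₐ[ℂ] R) :
    ∑ p, ∑ q, (1 : CStarMatrix I I M) p q ⊗ₜ[ℂ] θ (Matrix.single p q 1) = 1 := by
  have h : ∀ p q : I, (1 : CStarMatrix I I M) p q ⊗ₜ[ℂ] θ (Matrix.single p q 1)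
      = if p = q then (1 : M) ⊗ₜ[ℂ] θ (Matrix.single p p 1) else 0 := by
    intro p q
    rw [CStarMatrix.one_apply]
    split_ifs with h
    · rw [h]
    · rw [TensorProduct.zero_tmul]
  simp only [h, Finset.sum_ite_eq, Finset.mem_univ, if_true]
  rw [← TensorProduct.tmul_sum, ← map_sum, Matrix.sum_single_one, map_one]
  rfl

/-- The `*`-homomorphism `M ⊗ M_I → M ⊗ R` induced by `θ : M_I → R`. -/
def matrixHom (M : Type*) [CStarAlgebra M] [PartialOrder M] [StarOrderedRing M]
    (θ : Matrix I I ℂ →⋆ₐ[ℂ] R) : CStarMatrix I I M →⋆ₐ[ℂ] M ⊗[ℂ] R where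
  toFun X := ∑ p, ∑ q, X p q ⊗ₜ θ (Matrix.single p q 1)
  map_one' := sum_one_tmul_single M θ
  map_mul' X Y := by
    have h : ∀ p q r s : I, X p q ⊗ₜ[ℂ] θ (Matrix.single p q 1) *
        Y r s ⊗ₜ[ℂ] θ (Matrix.single r s 1)
        = if q = r then (X p q * Y q s) ⊗ₜ[ℂ] θ (Matrix.single p s 1) else 0 := by
      intro p q r s
      rw [Algebra.TensorProduct.tmul_mul_tmul, ← map_mul]
      split_ifs with h
      · rw [h, Matrix.single_mul_single_same, one_mul]
      · rw [Matrix.single_mul_single_of_ne _ _ _ _ h, map_zero, TensorProduct.tmul_zero]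
    have h2 : ∀ p q : I, X p q ⊗ₜ[ℂ] θ (Matrix.single p q 1) *
        ∑ r, ∑ s, Y r s ⊗ₜ[ℂ] θ (Matrix.single r s 1)
        = ∑ s, (X p q * Y q s) ⊗ₜ[ℂ] θ (Matrix.single p s 1) := by
      intro p q
      simp only [Finset.mul_sum, h]
      rw [Finset.sum_comm]
      simp
    rw [Finset.sum_mul]
    refine Finset.sum_congr rfl fun p _ => ?_
    rw [Finset.sum_mul]
    simp only [h2, CStarMatrix.mul_apply, TensorProduct.sum_tmul]
    exact Finset.sum_comm
  map_zero' := by simp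
  map_add' X Y := by
    simp only [CStarMatrix.add_apply, TensorProduct.add_tmul, Finset.sum_add_distrib]
  commutes' c := by
    rw [Algebra.algebraMap_eq_smul_one, Algebra.algebraMap_eq_smul_one,
      ← sum_one_tmul_single M θ]
    simp only [Finset.smul_sum, CStarMatrix.smul_apply, TensorProduct.smul_tmul']
  map_star' X := by
    simp only [star_sum, TensorProduct.star_tmul, CStarMatrix.star_apply, ← map_star,
      Matrix.star_eq_conjTranspose, Matrix.conjTranspose_single, star_one]
    exact Finset.sum_comm

theorem matrixHom_apply (θ : Matrix I I ℂ →⋆ₐ[ℂ] R) (X : CStarMatrix I I M) :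
    matrixHom M θ X = ∑ p, ∑ q, X p q ⊗ₜ θ (Matrix.single p q 1) := rfl

variable {K : Type*} [TopologicalSpace K] [CompactSpace K] {B : WStarBundle K M}
  {S : TracialExpectation Unit R} {G : Type*} [Group G]

theorem tmul_mem_boundedSeq (B : WStarBundle K M) (k : ℕ → K) {a : ℕ → M} {C : ℝ}
    (ha : ∀ n, ‖a n‖ ≤ C) {r : R} (hr : S.Bdd r) :
    (fun n => a n ⊗ₜ r) ∈ boundedSeq (B.tensor S) k := by
  have hC : 0 ≤ C := (norm_nonneg _).trans (ha 0)
  have key : ∀ n (a : M), ‖a‖ ≤ C → B.OpNormLEAt (k n) C a := fun n a ha b =>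
    (B.norm2_mul_le (k n) a b).trans (mul_le_mul_of_nonneg_right ha (norm2_nonneg _ _ _))
  obtain ⟨D, hD, h1, h2⟩ := hr
  have hS (b : R) (hb : S.OpNormLE D b) : S.OpNormLEAt () D b := fun c => by
    simpa only [norm2u_unit] using hb c
  refine ⟨C * D, mul_nonneg hC hD, fun n => ⟨(key n _ (ha n)).tmul hC hD (hS r h1), ?_⟩⟩
  rw [TensorProduct.star_tmul]
  exact (key n _ (by rw [norm_star]; exact ha n)).tmul hC hD (hS _ h2)

/-- If `V` is a unitary close to `v`, in the sense of `exists_unitary_near`, then the 2-seminorms of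
`V - v` are controlled by those of `v² - 1`. -/
theorem norm2_sq_le_of_add_eq {A : Type*} [Ring A] [StarRing A] [Algebra ℂ A] [StarModule ℂ A]
    (T : TracialExpectation K A) (k : K) {x r q z : A} (h : star x * x + star r * r = q)
    (hq : star q = q) (hqz : q * q = star z * z) :
    T.norm2 k x ^ 2 ≤ T.norm2 k 1 * T.norm2 k z := by
  have h1 : T.norm2 k q = T.norm2 k z := by
    rw [TracialExpectation.norm2, hq, hqz]
    rfl
  have h2 : T.norm2 k x ^ 2 + T.norm2 k r ^ 2 = (T.E q k).re := by
    rw [norm2_sq, norm2_sq, ← Complex.add_re, ← ContinuousMap.add_apply, ← map_add, h]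
  have h3 := (Complex.re_le_norm _).trans (T.norm_apply_le k q)
  rw [h1, ← h2] at h3
  nlinarith [sq_nonneg (T.norm2 k r)]

/-- A tensor close to `z ⊗ 1` is close to its own slice. -/
theorem norm2_sub_slice_tmul_one_le {K A R : Type*} [TopologicalSpace K] [Ring A] [StarRing A]
    [Algebra ℂ A] [StarModule ℂ A] [Ring R] [StarRing R] [Algebra ℂ R] [StarModule ℂ R]
    (T : TracialExpectation K A) {S : TracialExpectation Unit R} (hS : S.E 1 () = 1) (k : K)
    (u : A ⊗[ℂ] R) (z : A) :
    (T.tensor S).norm2 k (u - slice A S u ⊗ₜ 1) ≤ 2 * (T.tensor S).norm2 k (u - z ⊗ₜ 1) := by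
  have h1 : (T.tensor S).norm2 k ((slice A S u - z) ⊗ₜ 1)
      ≤ (T.tensor S).norm2 k (u - z ⊗ₜ 1) := by
    rw [norm2_tmul_one T S hS]
    have h := norm2_slice_le (T := T) hS k (u - z ⊗ₜ 1)
    rwa [map_sub, slice_tmul_one hS] at h
  have h2 := (T.tensor S).norm2_add_le k (u - z ⊗ₜ 1) (-((slice A S u - z) ⊗ₜ 1))
  rw [norm2_neg, ← sub_eq_add_neg, TensorProduct.sub_tmul, sub_sub_sub_cancel_right] at h2
  rw [TensorProduct.sub_tmul] at h1
  linarith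

/-- Conjugation by a symmetry `Φ` that exchanges `e` and `E` and commutes with the coefficients. -/
theorem mul_sum_mul_eq_of_involution {Q : Type*} [Ring Q] {Φ : Q} (hΦ : Φ * Φ = 1)
    {a e E : I → I → Q} (ha : ∀ p q, Commute (a p q) Φ) (hE : ∀ p q, E p q * Φ = Φ * e p q) :
    Φ * (∑ p, ∑ q, a p q * E p q) * Φ = ∑ p, ∑ q, a p q * e p q := by
  simp only [Finset.mul_sum, Finset.sum_mul]
  refine Finset.sum_congr rfl fun p _ => Finset.sum_congr rfl fun q _ => ?_
  rw [mul_assoc, mul_assoc, hE, ← mul_assoc (a p q), (ha p q).eq, mul_assoc, ← mul_assoc Φ, hΦ,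
    one_mul]

set_option maxHeartbeats 1000000 in
/-- Approximate equivariant matrix units `e` in all fibers and equivariant matrix units `E` in `R`
give rise to unitaries close to the flip `∑ e_{rt} ⊗ E_{tr}`. They almost commute with given
elements of `M`, are almost invariant, and move `∑ b_{pq} ⊗ E_{pq}` almost into `M`, namely to
`∑ b_{pq} e_{pq}`. -/
theorem exists_flip_unitary (γ : FiberwiseAction G B) (δ : TracialAction G S)
    (hS : S.E 1 () = 1) (hR : ∀ r, S.Bdd r) {μ : G → Matrix I I ℂ}
    (hμ : ∀ g, μ g * star (μ g) = 1) (θ : Matrix I I ℂ →⋆ₐ[ℂ] R)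
    (hθ : ∀ g X, δ.act g (θ X) = θ (μ g * X * star (μ g))) {C : ℝ}
    (hloc : ∀ (F : Set M) (H : Set G) (ε : ℝ), F.Finite → H.Finite → 0 < ε →
      ∃ e : I → I → M, (∀ p q, ‖e p q‖ ≤ C) ∧ ∀ k, ApproxUnits γ.toTracialAction μ F H k ε e)
    {F : Set M} (hF : F.Finite) {Y : Set (I → I → M)} (hY : Y.Finite) {H : Set G} (hH : H.Finite)
    {ε : ℝ} (hε : 0 < ε) :
    ∃ V : M ⊗[ℂ] R, star V * V = 1 ∧ V * star V = 1 ∧ ∀ k,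
      (∀ a ∈ F, (B.tensor S).norm2 k (V * (a ⊗ₜ 1) - (a ⊗ₜ 1) * V) ≤ ε) ∧
      (∀ b ∈ Y, (B.tensor S).norm2 k
        (star V * (∑ p, ∑ q, b p q ⊗ₜ θ (Matrix.single p q 1)) * V
          - slice M S (star V * (∑ p, ∑ q, b p q ⊗ₜ θ (Matrix.single p q 1)) * V) ⊗ₜ 1) ≤ ε) ∧
      ∀ g ∈ H, (B.tensor S).norm2 k ((γ.tensor δ).act g V - V) ≤ ε := by
  -- choose approximate units that also commute with the entries of the given matrices over `M`
  let F' : Set M := F ∪ {a | ∃ b ∈ Y, ∃ p q, b p q = a}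
  have hF' : F'.Finite := by
    refine hF.union (((hY.prod (Set.finite_univ (α := I × I))).image
      fun y => y.1 y.2.1 y.2.2).subset ?_)
    rintro _ ⟨b, hb, p, q, rfl⟩
    exact ⟨(b, p, q), ⟨hb, Set.mem_univ _⟩, rfl⟩
  choose e₀ he₀C he₀ using fun m : ℕ => hloc F' H (1 / ((m : ℝ) + 1)) hF' hH (by positivity)
  -- replace the units by a self-adjoint system
  let e : ℕ → I → I → M := fun m p q => (1 / 2 : ℂ) • (e₀ m p q + star (e₀ m q p))
  have hes : ∀ m p q, star (e m p q) = e m q p := fun m p q => by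
    simp only [e, star_smul, star_add, star_star]
    rw [add_comm]
    congr 1
    simp
  have heC : ∀ m p q, ‖e m p q‖ ≤ C := fun m p q => by
    have h1 := norm_add_le (e₀ m p q) (star (e₀ m q p))
    rw [norm_star] at h1
    rw [norm_smul]
    norm_num
    linarith [he₀C m p q, he₀C m q p]
  have hee₀ : ∀ m p q k, B.norm2 k (e m p q - e₀ m p q) ≤ 1 / ((m : ℝ) + 1) := fun m p q k => by
    have h1 : e m p q - e₀ m p q = (1 / 2 : ℂ) • (star (e₀ m q p) - e₀ m p q) := by
      simp only [e]
      module
    rw [h1, norm2_smul]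
    have h2 := (he₀ m k).star_sub q p
    have h3 := norm2_nonneg B.toTracialExpectation k (star (e₀ m q p) - e₀ m p q)
    norm_num
    norm_num at h2
    linarith
  -- as a matrix over `M` the flip `v` is self-adjoint; `V` is a unitary close to it
  let X : ℕ → CStarMatrix I I M := fun m => CStarMatrix.ofMatrix (Matrix.of fun t r => e m r t)
  have hX : ∀ m, IsSelfAdjoint (X m) := fun m => by
    ext t r
    rw [CStarMatrix.star_apply]
    exact hes m t r
  choose W r q hW1 hW2 hWr hq hqq using fun m => exists_unitary_near (hX m)
  let V : ℕ → M ⊗[ℂ] R := fun m => matrixHom M θ (W m)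
  let v : ℕ → M ⊗[ℂ] R := fun m => matrixHom M θ (X m)
  have hV1 : ∀ m, star (V m) * V m = 1 := fun m => by
    rw [← map_star, ← map_mul, hW1, map_one]
  have hV2 : ∀ m, V m * star (V m) = 1 := fun m => by
    rw [← map_star, ← map_mul, hW2, map_one]
  have hvs : ∀ m, star (v m) = v m := fun m => by
    rw [← map_star, (hX m).star_eq]
  have hVv : ∀ m k, (B.tensor S).norm2 k (V m - v m) ^ 2
      ≤ (B.tensor S).norm2 k 1 * (B.tensor S).norm2 k (v m * v m - 1) := fun m k => by
    refine norm2_sq_le_of_add_eq (B.tensor S) k (r := matrixHom M θ (r m))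
      (q := matrixHom M θ (q m)) ?_ ?_ ?_
    · rw [← map_sub, ← map_star, ← map_star, ← map_mul, ← map_mul, ← map_add, hWr]
    · rw [← map_star, hq]
    · rw [← map_mul, hqq, star_sub, star_mul, hvs, star_one, map_mul, map_sub, map_mul, map_one]
  let y : (I → I → M) → M ⊗[ℂ] R := fun b => ∑ p, ∑ q, b p q ⊗ₜ θ (Matrix.single p q 1)
  suffices hmain : ∃ m, ∀ k,
      (∀ a ∈ F, (B.tensor S).norm2 k (V m * (a ⊗ₜ 1) - (a ⊗ₜ 1) * V m) ≤ ε) ∧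
      (∀ b ∈ Y, (B.tensor S).norm2 k
        (star (V m) * y b * V m - slice M S (star (V m) * y b * V m) ⊗ₜ 1) ≤ ε) ∧
      ∀ g ∈ H, (B.tensor S).norm2 k ((γ.tensor δ).act g (V m) - V m) ≤ ε by
    obtain ⟨m, hm⟩ := hmain
    exact ⟨V m, hV1 m, hV2 m, hm⟩
  -- otherwise for each `m` there is a point `k_m` where one of the estimates fails; in the algebra
  -- of sequences modulo null sequences at the `k_m` all relations are exact
  by_contra hcon
  simp only [not_exists, not_forall] at hcon
  choose k hk using hcon
  let Q := FiberSeq (B.tensor S) k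
  let π : boundedSeq (B.tensor S) k →⋆ₐ[ℂ] Q := FiberSeq.mk (B.tensor S) k
  let eS : I → I → boundedSeq (B.tensor S) k := fun p q =>
    ⟨fun m => e m p q ⊗ₜ 1, tmul_mem_boundedSeq B k (fun m => heC m p q) (hR 1)⟩
  let aS : M → boundedSeq (B.tensor S) k := fun a =>
    ⟨fun _ => a ⊗ₜ 1, tmul_mem_boundedSeq B k (fun _ => le_rfl) (hR 1)⟩
  let ES : I → I → boundedSeq (B.tensor S) k := fun p q =>
    ⟨fun _ => 1 ⊗ₜ θ (Matrix.single p q 1), tmul_mem_boundedSeq B k (fun _ => le_rfl) (hR _)⟩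
  have hunit : ∀ x : ℕ → M ⊗[ℂ] R, (∀ m, star (x m) * x m = 1) → (∀ m, x m * star (x m) = 1) →
      x ∈ boundedSeq (B.tensor S) k := fun x h1 h2 =>
    ⟨1, zero_le_one, fun m => ⟨OpNormLEAt.of_star_mul_self (h1 m),
      OpNormLEAt.of_star_mul_self (by rw [star_star, h2 m])⟩⟩
  let VS : boundedSeq (B.tensor S) k := ⟨V, hunit V hV1 hV2⟩
  have hvflip : ∀ m, v m = ∑ r, ∑ t, (e m r t ⊗ₜ 1) * (1 ⊗ₜ θ (Matrix.single t r 1)) := fun m => by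
    show matrixHom M θ (X m) = _
    rw [matrixHom_apply, Finset.sum_comm]
    refine Finset.sum_congr rfl fun r _ => Finset.sum_congr rfl fun t _ => ?_
    rw [Algebra.TensorProduct.tmul_mul_tmul, one_mul, mul_one]
    rfl
  let vS : boundedSeq (B.tensor S) k := flip eS ES
  have hvS : ∀ m, (vS : ℕ → M ⊗[ℂ] R) m = v m := fun m => by
    rw [hvflip]
    refine (boundedSeq.coe_sum _ _ m).trans (Finset.sum_congr rfl fun r _ => ?_)
    exact boundedSeq.coe_sum _ _ m
  let Φ : Q := flip (fun p q => π (eS p q)) (fun p q => π (ES p q))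
  have hπv : π vS = Φ := by
    simp only [vS, Φ, flip, map_sum, map_mul]
  have hn1 : ∀ (l : K) (a : M), (B.tensor S).norm2 l (a ⊗ₜ 1) = B.norm2 l a :=
    norm2_tmul_one B.toTracialExpectation S hS
  have hmk : ∀ (x x' : ℕ → M) (xS xS' : boundedSeq (B.tensor S) k),
      (∀ m, (xS : ℕ → M ⊗[ℂ] R) m = x m ⊗ₜ 1) → (∀ m, (xS' : ℕ → M ⊗[ℂ] R) m = x' m ⊗ₜ 1) →
      (∀ m : ℕ, B.norm2 (k m) (x m - x' m) ≤ 1 / ((m : ℝ) + 1)) → π xS = π xS' := by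
    intro x x' xS xS' hx hx' h
    refine FiberSeq.mk_eq_of_le fun m => ?_
    rw [hx, hx', ← TensorProduct.sub_tmul, hn1]
    exact h m
  let e₀S : I → I → boundedSeq (B.tensor S) k := fun p q =>
    ⟨fun m => e₀ m p q ⊗ₜ 1, tmul_mem_boundedSeq B k (fun m => he₀C m p q) (hR 1)⟩
  have hπe : ∀ p q, π (eS p q) = π (e₀S p q) := fun p q =>
    hmk (fun m => e m p q) (fun m => e₀ m p q) _ _ (fun m => rfl) (fun m => rfl)
      fun m => hee₀ m p q _
  -- `π (eS p q)` and `π (ES p q)` are commuting systems of matrix units, with flip `Φ`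
  have hEU : IsMatrixUnits fun p q => π (ES p q) := by
    refine ⟨fun p q r t => ?_, ?_, fun p q => ?_⟩
    · have h1 : ES p q * ES r t = if q = r then ES p t else 0 := by
        refine Subtype.ext (funext fun m => ?_)
        have h2 : (1 ⊗ₜ θ (Matrix.single p q 1)) * (1 ⊗ₜ θ (Matrix.single r t 1))
            = if q = r then (1 : M) ⊗ₜ[ℂ] θ (Matrix.single p t 1) else 0 := by
          rw [Algebra.TensorProduct.tmul_mul_tmul, ← map_mul, one_mul]
          split_ifs with h
          · rw [h, Matrix.single_mul_single_same, one_mul]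
          · rw [Matrix.single_mul_single_of_ne _ _ _ _ h, map_zero, TensorProduct.tmul_zero]
        refine h2.trans ?_
        split_ifs <;> rfl
      rw [← map_mul, h1]
      split_ifs
      · rfl
      · exact map_zero π
    · rw [← map_sum, ← map_one π]
      refine congrArg π (Subtype.ext (funext fun m => ?_))
      rw [boundedSeq.coe_sum]
      show ∑ p, (1 : M) ⊗ₜ[ℂ] θ (Matrix.single p p 1) = 1
      rw [← TensorProduct.tmul_sum, ← map_sum, Matrix.sum_single_one, map_one]
      rfl
    · rw [← map_star]
      refine congrArg π (Subtype.ext (funext fun m => ?_))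
      show star ((1 : M) ⊗ₜ[ℂ] θ (Matrix.single p q 1)) = 1 ⊗ₜ θ (Matrix.single q p 1)
      rw [TensorProduct.star_tmul, star_one, ← map_star, Matrix.star_eq_conjTranspose,
        Matrix.conjTranspose_single, star_one]
  have heU : IsMatrixUnits fun p q => π (eS p q) := by
    refine ⟨fun p q r t => ?_, ?_, fun p q => ?_⟩
    · have h1 : π (e₀S p q * e₀S r t) = π (if q = r then e₀S p t else 0) := by
        refine hmk (fun m => e₀ m p q * e₀ m r t) (fun m => if q = r then e₀ m p t else 0) _ _
          (fun m => ?_) (fun m => ?_) fun m => (he₀ m (k m)).mul p q r t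
        · show (e₀ m p q ⊗ₜ[ℂ] (1 : R)) * (e₀ m r t ⊗ₜ[ℂ] (1 : R)) = _
          rw [Algebra.TensorProduct.tmul_mul_tmul, one_mul]
        · split_ifs
          · rfl
          · exact (TensorProduct.zero_tmul M (1 : R)).symm
      rw [hπe, hπe, hπe, ← map_mul, h1]
      split_ifs
      · rfl
      · exact map_zero π
    · simp only [hπe]
      rw [← map_sum, ← map_one π]
      refine hmk (fun m => ∑ p, e₀ m p p) (fun _ => 1) _ _ (fun m => ?_) (fun m => rfl)
        fun m => (he₀ m (k m)).one
      rw [boundedSeq.coe_sum, TensorProduct.sum_tmul]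
    · rw [← map_star]
      refine congrArg π (Subtype.ext (funext fun m => ?_))
      show star (e m p q ⊗ₜ[ℂ] (1 : R)) = e m q p ⊗ₜ 1
      rw [TensorProduct.star_tmul, star_one, hes]
  have hxE : ∀ (x : boundedSeq (B.tensor S) k) (x' : ℕ → M),
      (∀ m, (x : ℕ → M ⊗[ℂ] R) m = x' m ⊗ₜ 1) →
      ∀ p q, Commute (π x) (π (ES p q)) := by
    intro x x' hx p q
    show π x * π (ES p q) = π (ES p q) * π x
    rw [← map_mul, ← map_mul]
    refine congrArg π (Subtype.ext (funext fun m => ?_))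
    show (x : ℕ → M ⊗[ℂ] R) m * (1 ⊗ₜ θ (Matrix.single p q 1))
      = (1 ⊗ₜ θ (Matrix.single p q 1)) * (x : ℕ → M ⊗[ℂ] R) m
    rw [hx, Algebra.TensorProduct.tmul_mul_tmul, Algebra.TensorProduct.tmul_mul_tmul, one_mul,
      one_mul, mul_one, mul_one]
  have heE : ∀ p q r t, Commute (π (eS p q)) (π (ES r t)) := fun p q =>
    hxE _ (fun m => e m p q) fun m => rfl
  have haE : ∀ a p q, Commute (π (aS a)) (π (ES p q)) := fun a => hxE _ (fun _ => a) fun m => rfl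
  have hae : ∀ a ∈ F', ∀ p q, Commute (π (aS a)) (π (eS p q)) := by
    intro a ha p q
    refine Commute.symm ?_
    show π _ * π _ = π _ * π _
    rw [hπe, ← map_mul, ← map_mul]
    refine hmk (fun m => e₀ m p q * a) (fun m => a * e₀ m p q) _ _ (fun m => ?_) (fun m => ?_)
      fun m => (he₀ m (k m)).comm a ha p q
    · show (e₀ m p q ⊗ₜ[ℂ] (1 : R)) * (a ⊗ₜ[ℂ] (1 : R)) = _
      rw [Algebra.TensorProduct.tmul_mul_tmul, one_mul]
    · show (a ⊗ₜ[ℂ] (1 : R)) * (e₀ m p q ⊗ₜ[ℂ] (1 : R)) = _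
      rw [Algebra.TensorProduct.tmul_mul_tmul, one_mul]
  have hΦ2 : Φ * Φ = 1 := heU.flip_mul_flip hEU heE
  have hΦs : star Φ = Φ := heU.star_flip hEU heE
  have haΦ : ∀ a ∈ F', Commute (π (aS a)) Φ := fun a ha => Commute.flip (hae a ha) (haE a)
  -- `V - v` is controlled by `v² - 1`, and `Φ² = 1`, so `V` also represents `Φ`
  have hπV : π VS = Φ := by
    rw [← hπv]
    refine FiberSeq.mk_eq_iff.2 ?_
    have h1 : Tendsto (fun m => (B.tensor S).norm2 (k m) (v m * v m - 1)) atTop (𝓝 0) := by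
      have h2 : π (vS * vS) = π 1 := by rw [map_mul, hπv, hΦ2, map_one]
      refine (FiberSeq.mk_eq_iff.1 h2).congr fun m => ?_
      rw [← hvS]
      rfl
    have h2 := (Real.continuous_sqrt.tendsto 0).comp h1
    rw [Real.sqrt_zero] at h2
    refine squeeze_zero (fun _ => norm2_nonneg _ _ _) (fun m => ?_) h2
    refine Real.le_sqrt_of_sq_le ?_
    have h3 := hVv m (k m)
    rw [show (1 : M ⊗[ℂ] R) = 1 ⊗ₜ 1 from rfl, hn1, B.norm2_one, one_mul] at h3
    rw [hvS]
    exact h3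
  -- `Φ` commutes with `F`
  have hC1 : ∀ᶠ m in atTop, ∀ a ∈ F,
      (B.tensor S).norm2 (k m) (V m * (a ⊗ₜ 1) - (a ⊗ₜ 1) * V m) ≤ ε := by
    rw [eventually_all_finite hF]
    intro a ha
    have h1 : π (VS * aS a) = π (aS a * VS) := by
      rw [map_mul, map_mul, hπV]
      exact (haΦ a (Or.inl ha)).symm.eq
    exact FiberSeq.eventually_le h1 hε
  -- conjugation by `Φ` replaces `E` by `e`, so it moves `∑ b_{pq} ⊗ E_{pq}` into `M ⊗ 1`
  have hC2 : ∀ᶠ m in atTop, ∀ b ∈ Y, (B.tensor S).norm2 (k m)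
      (star (V m) * y b * V m - slice M S (star (V m) * y b * V m) ⊗ₜ 1) ≤ ε := by
    rw [eventually_all_finite hY]
    intro b hb
    have h1 : π (star VS * (∑ p, ∑ q, aS (b p q) * ES p q) * VS)
        = π (∑ p, ∑ q, aS (b p q) * eS p q) := by
      rw [map_mul, map_mul, map_star, hπV, hΦs]
      have h2 : ∀ x : I → I → boundedSeq (B.tensor S) k, π (∑ p, ∑ q, aS (b p q) * x p q)
          = ∑ p, ∑ q, π (aS (b p q)) * π (x p q) := fun x => by
        simp only [map_sum, map_mul]
      rw [h2, h2]
      exact mul_sum_mul_eq_of_involution hΦ2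
        (fun p q => haΦ (b p q) (Or.inr ⟨b, hb, p, q, rfl⟩))
        fun p q => (heU.flip_mul hEU heE p q).symm
    filter_upwards [FiberSeq.eventually_le h1 (half_pos hε)] with m hm
    have h2 : ((∑ p, ∑ q, aS (b p q) * eS p q : boundedSeq (B.tensor S) k) : ℕ → M ⊗[ℂ] R) m
        = (∑ p, ∑ q, b p q * e m p q) ⊗ₜ 1 := by
      simp only [boundedSeq.coe_sum, TensorProduct.sum_tmul]
      refine Finset.sum_congr rfl fun p _ => Finset.sum_congr rfl fun q _ => ?_
      show (b p q ⊗ₜ[ℂ] (1 : R)) * (e m p q ⊗ₜ[ℂ] (1 : R)) = _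
      rw [Algebra.TensorProduct.tmul_mul_tmul, one_mul]
    have h3 : ((∑ p, ∑ q, aS (b p q) * ES p q : boundedSeq (B.tensor S) k) : ℕ → M ⊗[ℂ] R) m
        = y b := by
      simp only [boundedSeq.coe_sum, y]
      refine Finset.sum_congr rfl fun p _ => Finset.sum_congr rfl fun q _ => ?_
      show (b p q ⊗ₜ[ℂ] (1 : R)) * ((1 : M) ⊗ₜ[ℂ] θ (Matrix.single p q 1)) = _
      rw [Algebra.TensorProduct.tmul_mul_tmul, one_mul, mul_one]
    have h4 : ((star VS * (∑ p, ∑ q, aS (b p q) * ES p q) * VS : boundedSeq (B.tensor S) k) :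
        ℕ → M ⊗[ℂ] R) m = star (V m) * y b * V m := by
      rw [← h3]
      rfl
    rw [h2, h4] at hm
    exact (norm2_sub_slice_tmul_one_le B.toTracialExpectation hS (k m) _ _).trans (by linarith)
  -- `Ad(μ_g)` acts on both systems, and the flip is invariant under simultaneous unitary changes
  have hC3 : ∀ᶠ m in atTop, ∀ g ∈ H,
      (B.tensor S).norm2 (k m) ((γ.tensor δ).act g (V m) - V m) ≤ ε := by
    rw [eventually_all_finite hH]
    intro g hg
    let βS : boundedSeq (B.tensor S) k → boundedSeq (B.tensor S) k :=
      fun y => ⟨fun m => (γ.tensor δ).act g ((y : ℕ → M ⊗[ℂ] R) m), by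
        obtain ⟨C, hC, h⟩ := y.2
        refine ⟨C, hC, fun m => ⟨(h m).1.act (γ.tensor δ) g, ?_⟩⟩
        rw [← map_star]
        exact (h m).2.act (γ.tensor δ) g⟩
    have hβ : ∀ x x', π x = π x' → π (βS x) = π (βS x') := by
      intro x x' h
      refine FiberSeq.mk_eq_iff.2 ((FiberSeq.mk_eq_iff.1 h).congr fun m => ?_)
      show _ = (B.tensor S).norm2 (k m) ((γ.tensor δ).act g ((x : ℕ → M ⊗[ℂ] R) m)
        - (γ.tensor δ).act g ((x' : ℕ → M ⊗[ℂ] R) m))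
      rw [← map_sub, norm2_act]
    have hβe : ∀ p q, π (βS (eS p q)) = conjFam (μ g) (fun p q => π (eS p q)) p q := by
      intro p q
      simp only [hβ _ _ (hπe p q), hπe]
      rw [← map_conjFam π]
      refine hmk (fun m => γ.act g (e₀ m p q)) (fun m => conjFam (μ g) (e₀ m) p q) _ _
        (fun m => ?_) (fun m => ?_) fun m => (he₀ m (k m)).equiv g hg p q
      · show tensorEquiv (γ.act g) (δ.act g) (e₀ m p q ⊗ₜ 1) = _
        rw [tensorEquiv_tmul, map_one]
      · rw [boundedSeq.coe_conjFam]
        simp only [conjFam, TensorProduct.sum_tmul]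
        rfl
    have hβE : ∀ p q, π (βS (ES p q)) = conjFam (μ g) (fun p q => π (ES p q)) p q := by
      intro p q
      rw [← map_conjFam π]
      refine congrArg π (Subtype.ext (funext fun m => ?_))
      rw [boundedSeq.coe_conjFam]
      show tensorEquiv (γ.act g) (δ.act g) (1 ⊗ₜ θ (Matrix.single p q 1)) = _
      rw [tensorEquiv_tmul, map_one, hθ, conj_single]
      simp only [conjFam, map_sum, map_smul, TensorProduct.tmul_sum, TensorProduct.tmul_smul]
      rfl
    have hβv : βS vS = flip (fun p q => βS (eS p q)) (fun p q => βS (ES p q)) := by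
      refine Subtype.ext (funext fun m => ?_)
      show (γ.tensor δ).act g ((vS : ℕ → M ⊗[ℂ] R) m) = _
      simp only [vS, flip, boundedSeq.coe_sum, map_sum]
      refine Finset.sum_congr rfl fun r _ => Finset.sum_congr rfl fun t _ => ?_
      exact map_mul ((γ.tensor δ).act g) _ _
    have h1 : π (βS VS) = π VS := by
      rw [hβ VS vS (hπV.trans hπv.symm), hβv, hπV]
      have h2 : π (flip (fun p q => βS (eS p q)) (fun p q => βS (ES p q)))
          = flip (fun p q => π (βS (eS p q))) (fun p q => π (βS (ES p q))) := by
        simp only [flip, map_sum, map_mul]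
      rw [h2]
      simp only [hβe, hβE]
      exact flip_conjFam (hμ g) _ _
    exact FiberSeq.eventually_le h1 hε
  obtain ⟨m, h1, h2, h3⟩ := (hC1.and (hC2.and hC3)).exists
  exact hk m ⟨h1, h2, h3⟩

end Flip

end

end EquivariantBundle

namespace EquivariantBundle

noncomputable section

open TracialExpectation

/-! ### One-sided approximate intertwining -/

section Intertwining

variable {K M A G : Type*} [TopologicalSpace K] [CompactSpace K] [CStarAlgebra M] [PartialOrder M]
  [StarOrderedRing M] [Ring A] [StarRing A] [Algebra ℂ A] [StarModule ℂ A] [Group G]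

/-- The quotient map onto the strict completion. -/
def clsHom (T : TracialExpectation K A) : T.bddCauchy →⋆ₐ[ℂ] T.Completion where
  toFun := T.cls
  map_one' := rfl
  map_mul' _ _ := rfl
  map_zero' := rfl
  map_add' _ _ := rfl
  commutes' _ := rfl
  map_star' _ := rfl

theorem norm2u_cls_sub_const_le {T : TracialExpectation K A} {y : T.bddCauchy} {x : A}
    (hx : T.Bdd x) {ε : ℝ} (h : ∀ᶠ m in atTop, T.norm2u ((y : ℕ → A) m - x) ≤ ε) :
    T.completion.norm2u (T.cls y - T.const x hx) ≤ ε := by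
  obtain ⟨z, hz⟩ : ∃ z : T.bddCauchy, z = ⟨fun _ => x, hx.mem_bddCauchy⟩ := ⟨_, rfl⟩
  have h1 := tendsto_norm2u_cls (y - z)
  have h2 : ∀ m, ((y - z : T.bddCauchy) : ℕ → A) m = (y : ℕ → A) m - x := fun m => by
    rw [hz]
    rfl
  simp only [h2] at h1
  rw [cls_sub, hz] at h1
  exact le_of_tendsto h1 h

theorem opNormLE_of_star_mul_self {T : TracialExpectation K A} {w : A} (h : star w * w = 1) :
    T.OpNormLE 1 w := fun b => by rw [norm2u_unitary_mul h, one_mul]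

variable {T : TracialExpectation K A} {w : ℕ → A}

/-- The pointwise conjugates `w_n ι(a) w_n*`, as a `*`-homomorphism to the bounded Cauchy
sequences. -/
def conjSeqHom (ι : M →⋆ₐ[ℂ] A) (hw : ∀ n, star (w n) * w n = 1)
    (hw' : ∀ n, w n * star (w n) = 1) (hT : ∀ x, T.Bdd x)
    (hc : ∀ a, T.CauchySeq2 fun n => w n * ι a * star (w n)) : M →⋆ₐ[ℂ] T.bddCauchy where
  toFun a := ⟨fun n => w n * ι a * star (w n), by
    refine ⟨?_, hc a⟩
    obtain ⟨C, hC, h1, h2⟩ := hT (ι a)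
    have h3 : ∀ n, T.OpNormLE 1 (w n) := fun n => opNormLE_of_star_mul_self (hw n)
    have h4 : ∀ n, T.OpNormLE 1 (star (w n)) := fun n =>
      opNormLE_of_star_mul_self (by rw [star_star, hw'])
    refine ⟨1 * C * 1, by positivity, fun n => ⟨((h3 n).mul zero_le_one h1).mul (by positivity)
      (h4 n), ?_⟩⟩
    rw [star_mul, star_mul, star_star, ← mul_assoc]
    exact ((h3 n).mul zero_le_one h2).mul (by positivity) (h4 n)⟩
  map_one' := Subtype.ext (funext fun n => by
    show w n * ι 1 * star (w n) = 1
    rw [map_one, mul_one, hw'])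
  map_mul' a b := Subtype.ext (funext fun n => by
    show w n * ι (a * b) * star (w n) = w n * ι a * star (w n) * (w n * ι b * star (w n))
    calc w n * ι (a * b) * star (w n) = w n * ι a * 1 * ι b * star (w n) := by
          rw [map_mul]; noncomm_ring
      _ = _ := by rw [← hw n]; noncomm_ring)
  map_zero' := Subtype.ext (funext fun n => by
    show w n * ι 0 * star (w n) = 0
    rw [map_zero, mul_zero, zero_mul])
  map_add' a b := Subtype.ext (funext fun n => by
    show w n * ι (a + b) * star (w n) = w n * ι a * star (w n) + w n * ι b * star (w n)
    rw [map_add, mul_add, add_mul])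
  commutes' c := Subtype.ext (funext fun n => by
    show w n * ι (algebraMap ℂ M c) * star (w n) = algebraMap ℂ A c
    rw [AlgHomClass.commutes, Algebra.algebraMap_eq_smul_one, mul_smul_comm, mul_one,
      smul_mul_assoc, hw'])
  map_star' a := Subtype.ext (funext fun n => by
    show w n * ι (star a) * star (w n) = star (w n * ι a * star (w n))
    rw [map_star, star_mul, star_mul, star_star, mul_assoc])

theorem completion_E_conjSeqHom {B : WStarBundle K M} {ι : M →⋆ₐ[ℂ] A}
    (hι : ∀ a, T.E (ι a) = B.E a) (hw : ∀ n, star (w n) * w n = 1)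
    (hw' : ∀ n, w n * star (w n) = 1) (hT : ∀ x, T.Bdd x)
    (hc : ∀ a, T.CauchySeq2 fun n => w n * ι a * star (w n)) (a : M) :
    T.completion.E (T.cls (conjSeqHom ι hw hw' hT hc a)) = B.E a := by
  have h : Tendsto (fun n => T.E (w n * ι a * star (w n))) atTop
      (𝓝 (T.completion.E (T.cls (conjSeqHom ι hw hw' hT hc a)))) :=
    completion_E_cls (conjSeqHom ι hw hw' hT hc a)
  have h2 : ∀ n, T.E (w n * ι a * star (w n)) = B.E a := fun n => by
    rw [T.tracial, ← mul_assoc, hw, one_mul, hι]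
  simp only [h2] at h
  exact tendsto_nhds_unique h tendsto_const_nhds

/-- A 2-isometric `*`-homomorphism from a `W*`-bundle to a strict completion is surjective if
bounded sequences of elements of `A` can be approximated by images of bounded sequences: the unit
ball of `M` is complete. -/
theorem surjective_of_approx {B : WStarBundle K M} (φ : M →⋆ₐ[ℂ] T.Completion)
    (hφn : ∀ a, T.completion.norm2u (φ a) = B.norm2u a) (hT : ∀ x, T.Bdd x)
    (happrox : ∀ C x, 0 ≤ C → T.OpNormLE C x → ∀ ε > 0, ∃ a, ‖a‖ ≤ C ∧
      T.completion.norm2u (φ a - T.const x (hT x)) ≤ ε) : Function.Surjective φ := by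
  intro q
  obtain ⟨x, rfl⟩ := cls_surjective q
  obtain ⟨C, hC, hx⟩ := bddCauchy_bddSeq x
  choose a haC ha using fun m : ℕ =>
    happrox C ((x : ℕ → A) m) hC (hx m).1 (1 / ((m : ℝ) + 1)) (by positivity)
  have hlim : Tendsto (fun m => T.completion.norm2u (φ (a m) - T.cls x)) atTop (𝓝 0) := by
    have h1 := (tendsto_one_div_add_atTop_nhds_zero_nat (𝕜 := ℝ)).add
      (tendsto_norm2u_cls_sub_const x)
    rw [add_zero] at h1
    refine squeeze_zero (fun _ => norm2u_nonneg _ _) (fun m => ?_) h1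
    refine (T.completion.norm2u_sub_le_sub _ (T.const ((x : ℕ → A) m) (hT _)) _).trans ?_
    rw [T.completion.norm2u_sub_comm (T.const _ _) (T.cls x)]
    exact add_le_add (ha m) le_rfl
  have hacauchy : B.CauchySeq2 a := by
    intro ε hε
    obtain ⟨N, hN⟩ := (Metric.tendsto_atTop.1 hlim) (ε / 2) (half_pos hε)
    refine ⟨N, fun m hm m' hm' => ?_⟩
    have h1 := hN m hm
    have h2 := hN m' hm'
    rw [Real.dist_0_eq_abs, abs_of_nonneg (norm2u_nonneg _ _)] at h1 h2
    rw [← hφn, map_sub]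
    have h3 := T.completion.norm2u_sub_le_sub (φ (a m)) (T.cls x) (φ (a m'))
    rw [T.completion.norm2u_sub_comm (T.cls x)] at h3
    linarith
  obtain ⟨b, -, hb⟩ := B.exists_limit haC hacauchy
  refine ⟨b, eq_of_norm2u_sub_eq_zero (le_antisymm ?_ (norm2u_nonneg _ _))⟩
  have h1 := hlim.add hb
  rw [add_zero] at h1
  refine ge_of_tendsto' h1 fun m => ?_
  have h2 := T.completion.norm2u_sub_le_sub (φ b) (φ (a m)) (T.cls x)
  rw [← map_sub, hφn, B.norm2u_sub_comm] at h2
  linarith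

/-- A sequence of unitaries whose coboundaries converge gives a unitary cocycle in the strict
completion; it is trivialized by conjugation with the sequence. -/
theorem exists_limit_coboundary {γ : G →* (M ≃⋆ₐ[ℂ] M)} {α : TracialAction G T} {ι : M →⋆ₐ[ℂ] A}
    (hια : ∀ g a, α.act g (ι a) = ι (γ g a))
    (hw : ∀ n, star (w n) * w n = 1) (hw' : ∀ n, w n * star (w n) = 1) (hT : ∀ x, T.Bdd x)
    (hc : ∀ a, T.CauchySeq2 fun n => w n * ι a * star (w n))
    (hcα : ∀ g, T.CauchySeq2 fun n => α.act g (w n) * star (w n)) :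
    ∃ c : G → T.Completion, (∀ g, star (c g) * c g = 1) ∧ (∀ g, c g * star (c g) = 1) ∧
      (∀ g h, c (g * h) = α.completion.act g (c h) * c g) ∧
      ∀ g a, α.completion.act g (T.cls (conjSeqHom ι hw hw' hT hc a))
        = c g * T.cls (conjSeqHom ι hw hw' hT hc (γ g a)) * star (c g) := by
  have h1 : ∀ g n, star (α.act g (w n) * star (w n)) * (α.act g (w n) * star (w n)) = 1 :=
    fun g n => by
      rw [star_mul, star_star, mul_assoc, ← mul_assoc (star (α.act g (w n))), ← map_star,
        ← map_mul, hw, map_one, one_mul, hw']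
  have h2 : ∀ g n, (α.act g (w n) * star (w n)) * star (α.act g (w n) * star (w n)) = 1 :=
    fun g n => by
      rw [star_mul, star_star, mul_assoc, ← mul_assoc (star (w n)), hw, one_mul, ← map_star,
        ← map_mul, hw', map_one]
  let c' : G → T.bddCauchy := fun g => ⟨fun n => α.act g (w n) * star (w n),
    ⟨1, zero_le_one, fun n => ⟨opNormLE_of_star_mul_self (h1 g n),
      opNormLE_of_star_mul_self (by rw [star_star, h2])⟩⟩, hcα g⟩
  refine ⟨fun g => T.cls (c' g), fun g => ?_, fun g => ?_, fun g h => ?_, fun g a => ?_⟩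
  · exact congrArg T.cls (a₁ := star (c' g) * c' g) (a₂ := 1) (Subtype.ext (funext fun n => h1 g n))
  · exact congrArg T.cls (a₁ := c' g * star (c' g)) (a₂ := 1) (Subtype.ext (funext fun n => h2 g n))
  · refine congrArg T.cls (a₁ := c' (g * h))
      (a₂ := bddCauchyMap (α.act g) (α.E_act g) (c' h) * c' g) (Subtype.ext (funext fun n => ?_))
    show α.act (g * h) (w n) * star (w n)
      = α.act g (α.act h (w n) * star (w n)) * (α.act g (w n) * star (w n))
    rw [map_mul α.act, StarAlgEquiv.mul_apply, map_mul (α.act g), mul_assoc,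
      ← mul_assoc (α.act g (star (w n))), ← map_mul (α.act g), hw, map_one, one_mul]
  · refine congrArg T.cls
      (a₁ := bddCauchyMap (α.act g) (α.E_act g) (conjSeqHom ι hw hw' hT hc a))
      (a₂ := c' g * conjSeqHom ι hw hw' hT hc (γ g a) * star (c' g))
      (Subtype.ext (funext fun n => ?_))
    show α.act g (w n * ι a * star (w n)) = (α.act g (w n) * star (w n))
      * (w n * ι (γ g a) * star (w n)) * star (α.act g (w n) * star (w n))
    have h3 : (α.act g (w n) * star (w n)) * (w n * ι (γ g a) * star (w n))
          * star (α.act g (w n) * star (w n))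
        = α.act g (w n) * (star (w n) * w n) * ι (γ g a) * (star (w n) * w n)
          * star (α.act g (w n)) := by
      rw [star_mul, star_star]
      noncomm_ring
    rw [h3, hw, mul_one, mul_one, map_mul, map_mul, hια, map_star]

/-- Suppose that the unitaries `w_n ∈ A` conjugate `M` to a subalgebra of the strict completion of
`A`, that their coboundaries `α_g(w_n) w_n*` converge, and that every `x ∈ A` is in the closure of
the image of `M`, the approximating elements being `σ(w_n* x w_n)` for a contraction `σ`. Then the
actions on `M` and on the strict completion of `A` are cocycle conjugate. -/
theorem cocycleConjugate_of_intertwining {B : WStarBundle K M}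
    {γ : TracialAction G B.toTracialExpectation} {α : TracialAction G T} {ι : M →⋆ₐ[ℂ] A}
    (hι : ∀ a, T.E (ι a) = B.E a) (hια : ∀ g a, α.act g (ι a) = ι (γ.act g a))
    {σ : A → M} (hσ : ∀ C x, T.OpNormLE C x → B.OpNormLE C (σ x)) (hT : ∀ x, T.Bdd x)
    (hw : ∀ n, star (w n) * w n = 1) (hw' : ∀ n, w n * star (w n) = 1)
    (hc : ∀ a, T.CauchySeq2 fun n => w n * ι a * star (w n))
    (hcα : ∀ g, T.CauchySeq2 fun n => α.act g (w n) * star (w n))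
    (hsurj : ∀ x, ∀ ε > 0, ∃ n, ∀ᶠ m in atTop,
      T.norm2u (w m * ι (σ (star (w n) * x * w n)) * star (w m) - x) ≤ ε) :
    CocycleConjugate γ α.completion := by
  obtain ⟨c, hc1, hc2, hcoc, hequiv⟩ := exists_limit_coboundary hια hw hw' hT hc hcα
  obtain ⟨φ, hφ⟩ : ∃ φ : M →⋆ₐ[ℂ] T.Completion, ∀ a,
      φ a = T.cls (conjSeqHom ι hw hw' hT hc a) :=
    ⟨(clsHom T).comp (conjSeqHom ι hw hw' hT hc), fun _ => rfl⟩
  have hφE : ∀ a, T.completion.E (φ a) = B.E a := fun a => by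
    rw [hφ]
    exact completion_E_conjSeqHom hι hw hw' hT hc a
  have hφn : ∀ a, T.completion.norm2u (φ a) = B.norm2u a := by
    intro a
    refine norm2u_congr (T := T.completion) (S := B.toTracialExpectation) ?_
    rw [← map_star, ← map_mul, hφE]
  have hinj : Function.Injective φ := by
    intro a b hab
    refine sub_eq_zero.1 (B.faithful_norm2u ?_)
    rw [← hφn, map_sub, hab, sub_self, norm2u_zero]
  have hsur : Function.Surjective φ := by
    refine surjective_of_approx φ hφn hT fun C x hC hx ε hε => ?_
    obtain ⟨n, hn⟩ := hsurj x ε hε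
    refine ⟨σ (star (w n) * x * w n), ?_, ?_⟩
    · refine B.norm_le_of_opNormLE hC (hσ _ _ ?_)
      have h1 : T.OpNormLE 1 (star (w n)) :=
        opNormLE_of_star_mul_self (by rw [star_star, hw'])
      have h2 := (h1.mul zero_le_one hx).mul (by positivity)
        (opNormLE_of_star_mul_self (hw n))
      rwa [one_mul, mul_one] at h2
    · rw [hφ]
      exact norm2u_cls_sub_const_le (y := conjSeqHom ι hw hw' hT hc (σ (star (w n) * x * w n)))
        (hT x) hn
  simp only [← hφ] at hequiv
  let ψ : M ≃⋆ₐ[ℂ] T.Completion := StarAlgEquiv.ofBijective φ ⟨hinj, hsur⟩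
  have hinv : ∀ q, φ (ψ.symm q) = q := fun q => ψ.apply_symm_apply q
  refine ⟨fun g => ⟨ψ.symm (c g), ?_⟩, fun g h => ?_, ψ, hφE, fun g a => ?_⟩
  · rw [Unitary.mem_iff]
    constructor
    · refine hinj ?_
      rw [map_mul, map_star, hinv, hc1, map_one]
    · refine hinj ?_
      rw [map_mul, map_star, hinv, hc2, map_one]
  · refine hinj ?_
    show φ (ψ.symm (c (g * h))) = φ (ψ.symm (c g) * γ.act g (ψ.symm (c h)))
    rw [map_mul, hinv, hinv, hcoc]
    conv_lhs => rw [← hinv (c h), hequiv, mul_assoc, hc1, mul_one]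
  · show α.completion.act g (φ a) = φ (ψ.symm (c g) * γ.act g a * star (ψ.symm (c g)))
    rw [map_mul, map_mul, map_star, hinv, hequiv]

end Intertwining

end

end EquivariantBundle

namespace EquivariantBundle

noncomputable section

open TracialExpectation

section Intertwining

variable {K M A G : Type*} [TopologicalSpace K] [CompactSpace K] [CStarAlgebra M] [PartialOrder M]
  [StarOrderedRing M] [Ring A] [StarRing A] [Algebra ℂ A] [StarModule ℂ A] [Group G]

/-- The sequence `w_n = v_1 ⋯ v_n`: the unitary `v_{n+1}` almost commutes with the first elements of
a given sequence `s` in `M` and with all the elements `σ(w_i* x_j w_i)` for `i, j ≤ n`, it moves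
`w_n* x_j w_n` almost into `M` for `j ≤ n`, and it is almost invariant. -/
theorem exists_intertwining_sequence {T : TracialExpectation K A}
    {α : TracialAction G T} {ι : M →⋆ₐ[ℂ] A} {σ : A →ₗ[ℂ] M}
    (hv : ∀ (F : Set M) (Y : Set A) (H : Set G) (ε : ℝ), F.Finite → Y.Finite → H.Finite → 0 < ε →
      ∃ v : A, star v * v = 1 ∧ v * star v = 1 ∧
        (∀ a ∈ F, T.norm2u (v * ι a - ι a * v) ≤ ε) ∧
        (∀ y ∈ Y, T.norm2u (star v * y * v - ι (σ (star v * y * v))) ≤ ε) ∧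
        ∀ g ∈ H, T.norm2u (α.act g v - v) ≤ ε)
    (s : ℕ → M) (x : ℕ → A) (h : ℕ → G) :
    ∃ w : ℕ → A, (∀ n, star (w n) * w n = 1) ∧ (∀ n, w n * star (w n) = 1) ∧
      (∀ j n, j ≤ n →
        T.norm2u (w (n + 1) * ι (s j) * star (w (n + 1)) - w n * ι (s j) * star (w n))
          ≤ (1 / 2) ^ n) ∧
      (∀ i j n, j ≤ i → i ≤ n →
        T.norm2u (w (n + 1) * ι (σ (star (w i) * x j * w i)) * star (w (n + 1))
          - w n * ι (σ (star (w i) * x j * w i)) * star (w n)) ≤ (1 / 2) ^ n) ∧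
      (∀ j n, j ≤ n → T.norm2u (w (n + 1) * ι (σ (star (w (n + 1)) * x j * w (n + 1)))
          * star (w (n + 1)) - x j) ≤ (1 / 2) ^ n) ∧
      ∀ j n, j ≤ n → T.norm2u (α.act (h j) (w (n + 1)) * star (w (n + 1))
          - α.act (h j) (w n) * star (w n)) ≤ (1 / 2) ^ n := by
  -- a state `(w, F)` consists of a unitary `w` and a finite set `F`, in which the elements that
  -- later unitaries have to almost commute with are accumulated
  let P := {p : A × Set M // (star p.1 * p.1 = 1 ∧ p.1 * star p.1 = 1) ∧ p.2.Finite}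
  let F : ℕ → P → Set M := fun n p =>
    p.1.2 ∪ (s '' Set.Iic n ∪ (fun j => σ (star p.1.1 * x j * p.1.1)) '' Set.Iic n)
  have hstep : ∀ n (p : P), ∃ p' : P, p'.1.2 = F n p ∧ ∃ v, star v * v = 1 ∧ v * star v = 1 ∧
      p'.1.1 = p.1.1 * v ∧ (∀ a ∈ F n p, T.norm2u (v * ι a - ι a * v) ≤ (1 / 2) ^ n) ∧
      (∀ j ≤ n, T.norm2u (star v * (star p.1.1 * x j * p.1.1) * v
        - ι (σ (star v * (star p.1.1 * x j * p.1.1) * v))) ≤ (1 / 2) ^ n) ∧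
      ∀ j ≤ n, T.norm2u (α.act (h j) v - v) ≤ (1 / 2) ^ n := by
    intro n p
    have hF : (F n p).Finite := p.2.2.union
      (((Set.finite_Iic n).image _).union ((Set.finite_Iic n).image _))
    obtain ⟨v, hv1, hv2, hvF, hvY, hvH⟩ := hv (F n p)
      ((fun j => star p.1.1 * x j * p.1.1) '' Set.Iic n) (h '' Set.Iic n) ((1 / 2) ^ n) hF
      ((Set.finite_Iic n).image _) ((Set.finite_Iic n).image _) (by positivity)
    refine ⟨⟨(p.1.1 * v, F n p), ⟨?_, ?_⟩, hF⟩, rfl, v, hv1, hv2, rfl, hvF,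
      fun j hj => hvY _ ⟨j, hj, rfl⟩, fun j hj => hvH _ ⟨j, hj, rfl⟩⟩
    · rw [star_mul, mul_assoc, ← mul_assoc (star p.1.1), p.2.1.1, one_mul, hv1]
    · rw [star_mul, mul_assoc, ← mul_assoc v, hv2, one_mul, p.2.1.2]
  choose next hnextF v hv1 hv2 hnext hvF hvY hvH using hstep
  let p₀ : P := ⟨(1, ∅), by simp, Set.finite_empty⟩
  let p : ℕ → P := fun n => Nat.rec p₀ next n
  have hp : ∀ n, p (n + 1) = next n (p n) := fun n => rfl
  have hw1 : ∀ n, star (p n).1.1 * (p n).1.1 = 1 := fun n => (p n).2.1.1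
  have hw2 : ∀ n, (p n).1.1 * star (p n).1.1 = 1 := fun n => (p n).2.1.2
  have hws : ∀ n, (p (n + 1)).1.1 = (p n).1.1 * v n (p n) := fun n => by rw [hp, hnext]
  have hmono : ∀ i n, i ≤ n → F i (p i) ⊆ F n (p n) := by
    intro i n hin
    induction n, hin using Nat.le_induction with
    | base => exact subset_rfl
    | succ n _ ih =>
      refine ih.trans ?_
      rw [← hnextF, ← hp]
      exact Set.subset_union_left
  -- `w_{n+1} a w_{n+1}* - w_n a w_n*` is the conjugate by `w_n` of `[v, a] v*`
  have hFconj : ∀ n, ∀ a ∈ F n (p n), T.norm2u ((p (n + 1)).1.1 * ι a * star (p (n + 1)).1.1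
      - (p n).1.1 * ι a * star (p n).1.1) ≤ (1 / 2) ^ n := by
    intro n a ha
    have e : (p (n + 1)).1.1 * ι a * star (p (n + 1)).1.1 - (p n).1.1 * ι a * star (p n).1.1
        = (p n).1.1 * ((v n (p n) * ι a - ι a * v n (p n)) * star (v n (p n)))
          * star (p n).1.1 := by
      rw [sub_mul, mul_assoc (ι a), hv2, mul_one, hws, star_mul]
      noncomm_ring
    rw [e, norm2u_mul_unitary (by rw [star_star, hw1]), norm2u_unitary_mul (hw1 n),
      norm2u_mul_unitary (by rw [star_star, hv1])]
    exact hvF n (p n) a ha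
  refine ⟨fun n => (p n).1.1, hw1, hw2, fun j n hj => hFconj n _ (Or.inr (Or.inl ⟨j, hj, rfl⟩)),
    fun i j n hj hi => hFconj n _ (hmono i n hi (Or.inr (Or.inr ⟨j, hj, rfl⟩))),
    fun j n hj => ?_, fun j n hj => ?_⟩
  · have h1 := hvY n (p n) j hj
    have e : star (v n (p n)) * (star (p n).1.1 * x j * (p n).1.1) * v n (p n)
        = star (p (n + 1)).1.1 * x j * (p (n + 1)).1.1 := by
      rw [hws, star_mul]
      noncomm_ring
    rw [e] at h1
    show T.norm2u ((p (n + 1)).1.1 * _ * star (p (n + 1)).1.1 - x j) ≤ _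
    set u := (p (n + 1)).1.1
    rw [← norm2u_unitary_mul (T := T) (u := u) (hw1 (n + 1)),
      ← norm2u_mul_unitary (T := T) (u := star u) (by rw [star_star]; exact hw1 (n + 1))] at h1
    have e2 : u * (star u * x j * u - ι (σ (star u * x j * u))) * star u
        = x j - u * ι (σ (star u * x j * u)) * star u := by
      have e3 : u * (star u * x j * u) * star u = (u * star u) * x j * (u * star u) := by
        noncomm_ring
      have e4 : u * star u = 1 := hw2 (n + 1)
      rw [mul_sub, sub_mul, e3, e4, one_mul, mul_one]
    rwa [e2, norm2u_sub_comm] at h1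
  · have h1 := hvH n (p n) j hj
    show T.norm2u (α.act (h j) (p (n + 1)).1.1 * star (p (n + 1)).1.1
      - α.act (h j) (p n).1.1 * star (p n).1.1) ≤ _
    have e : α.act (h j) (p (n + 1)).1.1 * star (p (n + 1)).1.1
        - α.act (h j) (p n).1.1 * star (p n).1.1
        = α.act (h j) (p n).1.1 * ((α.act (h j) (v n (p n)) - v n (p n)) * star (v n (p n)))
          * star (p n).1.1 := by
      rw [sub_mul, hv2, hws, map_mul, star_mul]
      noncomm_ring
    rw [e, norm2u_mul_unitary (by rw [star_star, hw1]),
      norm2u_unitary_mul (by rw [← map_star, ← map_mul, hw1, map_one]),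
      norm2u_mul_unitary (by rw [star_star, hv1])]
    exact h1

/-- One-sided approximate intertwining. Let `M` be embedded in `A`, with a conditional expectation
`σ`. If there are approximately invariant unitaries in `A` which almost commute with given elements
of `M` and conjugate given elements of `A` almost into `M`, then the action on `M` is cocycle
conjugate to the action on the strict completion of `A`. -/
theorem cocycleConjugate_of_exists_unitary [Countable G] {B : WStarBundle K M}
    {T : TracialExpectation K A} {γ : TracialAction G B.toTracialExpectation}
    {α : TracialAction G T} {ι : M →⋆ₐ[ℂ] A}
    (hι : ∀ a, T.E (ι a) = B.E a) (hια : ∀ g a, α.act g (ι a) = ι (γ.act g a))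
    {σ : A →ₗ[ℂ] M} (hσ : ∀ C x, T.OpNormLE C x → B.OpNormLE C (σ x))
    (hσ2 : ∀ x, B.norm2u (σ x) ≤ T.norm2u x) (hT : ∀ x, T.Bdd x)
    (hsep : B.StrictlySeparable) {X : Set A} (hX : X.Countable)
    (hXd : ∀ x, ∀ ε > 0, ∃ y ∈ Submodule.span ℂ X, T.norm2u (x - y) ≤ ε)
    (hv : ∀ (F : Set M) (Y : Set A) (H : Set G) (ε : ℝ), F.Finite → Y.Finite → H.Finite → 0 < ε →
      ∃ v : A, star v * v = 1 ∧ v * star v = 1 ∧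
        (∀ a ∈ F, T.norm2u (v * ι a - ι a * v) ≤ ε) ∧
        (∀ y ∈ Y, T.norm2u (star v * y * v - ι (σ (star v * y * v))) ≤ ε) ∧
        ∀ g ∈ H, T.norm2u (α.act g v - v) ≤ ε) :
    CocycleConjugate γ α.completion := by
  obtain ⟨S₀, hS₀, hS₀d⟩ := hsep
  -- enumerations; adding `0` ensures that the sets are nonempty
  obtain ⟨s, hs⟩ := (hS₀.insert 0).exists_eq_range (Set.insert_nonempty _ _)
  obtain ⟨x, hx⟩ := (hX.insert 0).exists_eq_range (Set.insert_nonempty _ _)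
  obtain ⟨h, hh⟩ := exists_surjective_nat G
  obtain ⟨w, hw1, hw2, hws, hwx, hwx', hwh⟩ := exists_intertwining_sequence hv s x h
  have hιn : ∀ a, T.norm2u (ι a) = B.norm2u a := fun a => by
    refine norm2u_congr (T := T) (S := B.toTracialExpectation) ?_
    rw [← map_star, ← map_mul, hι]
  have hconj : ∀ n a, T.norm2u (w n * a * star (w n)) = T.norm2u a := fun n a => by
    rw [norm2u_mul_unitary (by rw [star_star, hw1]), norm2u_unitary_mul (hw1 n)]
  have hconj' : ∀ n a, T.norm2u (star (w n) * a * w n) = T.norm2u a := fun n a => by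
    rw [norm2u_mul_unitary (hw2 n), norm2u_unitary_mul (by rw [star_star, hw2])]
  -- `w_n a w_n*` is Cauchy for `a` in the dense sequence `s`, hence for all `a`
  have hc : ∀ a, T.CauchySeq2 fun n => w n * ι a * star (w n) := by
    intro a ε hε
    obtain ⟨t, ht, hat⟩ := hS₀d a (ε / 3) (by positivity)
    obtain ⟨j, rfl⟩ : t ∈ Set.range s := hs ▸ Set.mem_insert_of_mem _ ht
    obtain ⟨N, hN⟩ := cauchySeq2_of_le_geometric (y := fun n => w n * ι (s j) * star (w n))
      (hws j) (ε / 3) (by positivity)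
    refine ⟨N, fun m hm n hn => ?_⟩
    have h1 : ∀ n, T.norm2u (w n * ι a * star (w n) - w n * ι (s j) * star (w n)) < ε / 3 := by
      intro n
      rw [← sub_mul, ← mul_sub, hconj, ← map_sub, hιn]
      exact hat
    have h2 := T.norm2u_sub_le_sub (w m * ι a * star (w m)) (w m * ι (s j) * star (w m))
      (w n * ι a * star (w n))
    have h3 := T.norm2u_sub_le_sub (w m * ι (s j) * star (w m)) (w n * ι (s j) * star (w n))
      (w n * ι a * star (w n))
    rw [T.norm2u_sub_comm (w n * ι (s j) * star (w n))] at h3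
    have h4 := hN m hm n hn
    linarith [h1 m, h1 n]
  have hcα : ∀ g, T.CauchySeq2 fun n => α.act g (w n) * star (w n) := by
    intro g
    obtain ⟨j, rfl⟩ := hh g
    exact cauchySeq2_of_le_geometric (hwh j)
  -- `w_m σ(w_n* y w_n) w_m*` is close to `y` for large `n ≤ m`: by construction for `y` in the
  -- sequence `x`, by linearity on its span, and as `τ` is contractive everywhere
  let τ : ℕ → ℕ → A → A := fun n m y => w m * ι (σ (star (w n) * y * w n)) * star (w m)
  have hτadd : ∀ n m y z, τ n m (y + z) = τ n m y + τ n m z := fun n m y z => by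
    simp only [τ, mul_add, add_mul, map_add]
  have hτsmul : ∀ n m (c : ℂ) y, τ n m (c • y) = c • τ n m y := fun n m c y => by
    simp only [τ, mul_smul_comm, smul_mul_assoc, map_smul]
  have hτn : ∀ n m y, T.norm2u (τ n m y) ≤ T.norm2u y := fun n m y => by
    rw [hconj, hιn, ← hconj' n y]
    exact hσ2 _
  have hspan : ∀ y ∈ Submodule.span ℂ X, ∀ ε > 0, ∃ N, ∀ n ≥ N, ∀ m ≥ n,
      T.norm2u (τ n m y - y) ≤ ε := by
    intro y hy
    induction hy using Submodule.span_induction with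
    | mem y hy =>
      intro ε hε
      obtain ⟨j, rfl⟩ : y ∈ Set.range x := hx ▸ Set.mem_insert_of_mem _ hy
      obtain ⟨N, hN⟩ := exists_pow_lt_of_lt_one (show 0 < ε / 4 by positivity)
        (show (1 / 2 : ℝ) < 1 by norm_num)
      refine ⟨max j N + 1, fun n hn m hm => ?_⟩
      obtain ⟨n, rfl⟩ : ∃ n', n = n' + 1 := ⟨n - 1, by omega⟩
      have hjn : j ≤ n := (le_max_left j N).trans (by omega)
      have hNn : N ≤ n := (le_max_right j N).trans (by omega)
      have h1 := hwx' j n hjn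
      have h2 := norm2u_sub_le_of_le_geometric (T := T)
        (y := fun m => w m * ι (σ (star (w (n + 1)) * x j * w (n + 1))) * star (w m))
        (fun m hm => hwx (n + 1) j m (by omega) hm) le_rfl hm
      have h3 := T.norm2u_sub_le_sub (τ (n + 1) m (x j)) (τ (n + 1) (n + 1) (x j)) (x j)
      have h4 : (1 / 2 : ℝ) ^ n ≤ (1 / 2) ^ N :=
        pow_le_pow_of_le_one (by norm_num) (by norm_num) hNn
      have h5 : (1 / 2 : ℝ) ^ (n + 1) = (1 / 2) ^ n / 2 := by rw [pow_succ]; ring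
      rw [h5] at h2
      simp only [τ] at h3 ⊢
      linarith
    | zero =>
      intro ε hε
      refine ⟨0, fun n _ m _ => ?_⟩
      have h1 : τ n m 0 = 0 := by simp [τ]
      rw [h1, sub_self, norm2u_zero]
      exact hε.le
    | add y z _ _ hy hz =>
      intro ε hε
      obtain ⟨N, hN⟩ := hy (ε / 2) (half_pos hε)
      obtain ⟨N', hN'⟩ := hz (ε / 2) (half_pos hε)
      refine ⟨max N N', fun n hn m hm => ?_⟩
      rw [hτadd, add_sub_add_comm]
      have h1 := T.norm2u_add_le (τ n m y - y) (τ n m z - z)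
      linarith [hN n (le_of_max_le_left hn) m hm, hN' n (le_of_max_le_right hn) m hm]
    | smul c y _ hy =>
      intro ε hε
      obtain ⟨N, hN⟩ := hy (ε / (‖c‖ + 1)) (by positivity)
      refine ⟨N, fun n hn m hm => ?_⟩
      rw [hτsmul, ← smul_sub, T.norm2u_smul]
      have h1 := hN n hn m hm
      rw [le_div_iff₀ (by positivity)] at h1
      nlinarith [T.norm2u_nonneg (τ n m y - y)]
  refine cocycleConjugate_of_intertwining hι hια hσ hT hw1 hw2 hc hcα fun y ε hε => ?_
  obtain ⟨z, hz, hyz⟩ := hXd y (ε / 3) (by positivity)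
  obtain ⟨N, hN⟩ := hspan z hz (ε / 3) (by positivity)
  refine ⟨N, eventually_atTop.2 ⟨N, fun m hm => ?_⟩⟩
  show T.norm2u (τ N m y - y) ≤ ε
  have h1 : τ N m y - y = τ N m (y - z) + (τ N m z - z) - (y - z) := by
    have := hτadd N m (y - z) z
    rw [sub_add_cancel] at this
    rw [this]
    abel
  have h2 := T.norm2u_sub_le (τ N m (y - z) + (τ N m z - z)) (y - z)
  have h3 := T.norm2u_add_le (τ N m (y - z)) (τ N m z - z)
  rw [h1]
  linarith [hτn N m (y - z), hN N le_rfl m hm]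

end Intertwining

end

end EquivariantBundle

namespace EquivariantBundle

noncomputable section

open TracialExpectation

/-! ### Absorption of an approximately finite-dimensional algebra -/

section Absorption

variable {K M R G : Type*} [TopologicalSpace K] [CompactSpace K] [CStarAlgebra M] [PartialOrder M]
  [StarOrderedRing M] [Ring R] [StarRing R] [Algebra ℂ R] [StarModule ℂ R] [Group G]
  {B : WStarBundle K M} {S : TracialExpectation Unit R}
  {I : ℕ → Type*} [∀ N, Fintype (I N)] [∀ N, DecidableEq (I N)]
  {θ : ∀ N, Matrix (I N) (I N) ℂ →⋆ₐ[ℂ] R}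

/-- The inclusion `a ↦ a ⊗ 1`. -/
def tmulOneHom (A R : Type*) [Ring A] [StarRing A] [Algebra ℂ A] [StarModule ℂ A] [Ring R]
    [StarRing R] [Algebra ℂ R] [StarModule ℂ R] : A →⋆ₐ[ℂ] A ⊗[ℂ] R where
  __ := (Algebra.TensorProduct.includeLeft : A →ₐ[ℂ] A ⊗[ℂ] R)
  map_star' a := by
    show star a ⊗ₜ[ℂ] (1 : R) = star (a ⊗ₜ[ℂ] (1 : R))
    rw [TensorProduct.star_tmul, star_one]

theorem tmulOneHom_apply {A R : Type*} [Ring A] [StarRing A] [Algebra ℂ A] [StarModule ℂ A]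
    [Ring R] [StarRing R] [Algebra ℂ R] [StarModule ℂ R] (a : A) :
    tmulOneHom A R a = a ⊗ₜ 1 := rfl

/-- Elements of `M ⊗ R` are approximated by matrices over `M`. -/
theorem exists_sum_tmul_near (B : WStarBundle K M)
    (hmono : ∀ N N', N ≤ N' → ∀ X, ∃ Y, θ N X = θ N' Y)
    (hdense : ∀ r, ∀ ε > 0, ∃ N X, S.norm2u (r - θ N X) < ε) (y : M ⊗[ℂ] R) {ε : ℝ} (hε : 0 < ε) :
    ∃ N₀, ∀ N ≥ N₀, ∃ b : I N → I N → M,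
      (B.toTracialExpectation.tensor S).norm2u
        (y - ∑ p, ∑ q, b p q ⊗ₜ θ N (Matrix.single p q 1)) ≤ ε := by
  induction y generalizing ε with
  | zero => exact ⟨0, fun N _ => ⟨0, by simpa using hε.le⟩⟩
  | add y z hy hz =>
    obtain ⟨N₁, h1⟩ := hy (half_pos hε)
    obtain ⟨N₂, h2⟩ := hz (half_pos hε)
    refine ⟨max N₁ N₂, fun N hN => ?_⟩
    obtain ⟨b, hb⟩ := h1 N (le_of_max_le_left hN)
    obtain ⟨c, hc⟩ := h2 N (le_of_max_le_right hN)
    refine ⟨b + c, ?_⟩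
    have e : y + z - ∑ p, ∑ q, (b + c) p q ⊗ₜ[ℂ] θ N (Matrix.single p q 1)
        = (y - ∑ p, ∑ q, b p q ⊗ₜ[ℂ] θ N (Matrix.single p q 1))
          + (z - ∑ p, ∑ q, c p q ⊗ₜ[ℂ] θ N (Matrix.single p q 1)) := by
      simp only [Pi.add_apply, TensorProduct.add_tmul, Finset.sum_add_distrib]
      abel
    rw [e]
    exact (norm2u_add_le _ _ _).trans (by linarith)
  | tmul a r =>
    have h0 := B.norm2u_nonneg a
    obtain ⟨N₀, X₀, hX₀⟩ := hdense r (ε / (B.norm2u a + 1)) (by positivity)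
    refine ⟨N₀, fun N hN => ?_⟩
    obtain ⟨X, hX⟩ := hmono N₀ N hN X₀
    rw [hX, lt_div_iff₀ (by positivity)] at hX₀
    refine ⟨fun p q => X p q • a, ?_⟩
    have e : ∑ p, ∑ q, (X p q • a) ⊗ₜ[ℂ] θ N (Matrix.single p q 1) = a ⊗ₜ θ N X := by
      conv_rhs => rw [Matrix.matrix_eq_sum_single X]
      simp only [map_sum, TensorProduct.tmul_sum]
      refine Finset.sum_congr rfl fun p _ => Finset.sum_congr rfl fun q _ => ?_
      rw [TensorProduct.smul_tmul, ← map_smul, Matrix.smul_single, smul_eq_mul, mul_one]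
    rw [e, ← TensorProduct.tmul_sub, norm2u_tmul]
    nlinarith [S.norm2u_nonneg (r - θ N X)]

/-- The elementary tensors `s ⊗ θ_N(E_{pq})`, with `s` in a dense subset of `M`, span a dense
subspace of `M ⊗ R`. -/
theorem exists_span_near (B : WStarBundle K M)
    (hmono : ∀ N N', N ≤ N' → ∀ X, ∃ Y, θ N X = θ N' Y)
    (hdense : ∀ r, ∀ ε > 0, ∃ N X, S.norm2u (r - θ N X) < ε) {S₀ : Set M}
    (hS₀ : ∀ a, ∀ ε > 0, ∃ s ∈ S₀, B.norm2u (a - s) < ε) (y : M ⊗[ℂ] R) {ε : ℝ} (hε : 0 < ε) :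
    ∃ z ∈ Submodule.span ℂ (⋃ N, ⋃ p, ⋃ q, (fun s => s ⊗ₜ[ℂ] θ N (Matrix.single p q 1)) '' S₀),
      (B.toTracialExpectation.tensor S).norm2u (y - z) ≤ ε := by
  obtain ⟨N, hN⟩ := exists_sum_tmul_near B hmono hdense y (half_pos hε)
  obtain ⟨b, hb⟩ := hN N le_rfl
  set D : ℝ := ∑ p, ∑ q, S.norm2u (θ N (Matrix.single p q 1)) with hD
  have hD0 : 0 ≤ D := Finset.sum_nonneg fun _ _ => Finset.sum_nonneg fun _ _ => norm2u_nonneg _ _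
  choose s hs hbs using fun p q => hS₀ (b p q) (ε / (2 * (D + 1))) (by positivity)
  refine ⟨∑ p, ∑ q, s p q ⊗ₜ θ N (Matrix.single p q 1), ?_, ?_⟩
  · refine Submodule.sum_mem _ fun p _ => Submodule.sum_mem _ fun q _ => Submodule.subset_span ?_
    simp only [Set.mem_iUnion]
    exact ⟨N, p, q, s p q, hs p q, rfl⟩
  · refine (norm2u_sub_le_sub _ _ (∑ p, ∑ q, b p q ⊗ₜ θ N (Matrix.single p q 1)) _).trans ?_
    have h1 : (B.toTracialExpectation.tensor S).norm2u
        (∑ p, ∑ q, b p q ⊗ₜ[ℂ] θ N (Matrix.single p q 1)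
          - ∑ p, ∑ q, s p q ⊗ₜ[ℂ] θ N (Matrix.single p q 1)) ≤ ε / (2 * (D + 1)) * D := by
      simp only [← Finset.sum_sub_distrib, ← TensorProduct.sub_tmul]
      rw [hD, Finset.mul_sum]
      refine (norm2u_sum_le _ _ _).trans (Finset.sum_le_sum fun p _ => ?_)
      rw [Finset.mul_sum]
      refine (norm2u_sum_le _ _ _).trans (Finset.sum_le_sum fun q _ => ?_)
      rw [norm2u_tmul]
      exact mul_le_mul_of_nonneg_right (hbs p q).le (norm2u_nonneg _ _)
    have h2 : ε / (2 * (D + 1)) * D ≤ ε / 2 := by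
      rw [div_mul_eq_mul_div, div_le_div_iff₀ (by positivity) two_pos]
      nlinarith
    linarith

/-- If `M` contains approximately central, approximately equivariant copies of the
finite-dimensional algebras `θ_N(M_{I_N})` whose union is dense in `R`, then `M` absorbs `R`
equivariantly. -/
theorem cocycleConjugate_tensor_of_approxUnits [Countable G] (hsep : B.StrictlySeparable)
    (γ : FiberwiseAction G B) (δ : TracialAction G S) (hS : S.E 1 () = 1) (hR : ∀ r, S.Bdd r)
    {μ : ∀ N, G → Matrix (I N) (I N) ℂ} (hμ : ∀ N g, μ N g * star (μ N g) = 1)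
    (hθ : ∀ N g X, δ.act g (θ N X) = θ N (μ N g * X * star (μ N g)))
    (hmono : ∀ N N', N ≤ N' → ∀ X, ∃ Y, θ N X = θ N' Y)
    (hdense : ∀ r, ∀ ε > 0, ∃ N X, S.norm2u (r - θ N X) < ε)
    (hloc : ∀ N, ∃ C : ℝ, ∀ (F : Set M) (H : Set G) (ε : ℝ), F.Finite → H.Finite → 0 < ε →
      ∃ e : I N → I N → M, (∀ p q, ‖e p q‖ ≤ C) ∧
        ∀ k, ApproxUnits γ.toTracialAction (μ N) F H k ε e) :
    CocycleConjugate γ.toTracialAction (γ.toTracialAction.tensor δ).completion := by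
  obtain ⟨S₀, hS₀, hS₀d⟩ := id hsep
  refine cocycleConjugate_of_exists_unitary (ι := tmulOneHom M R) (σ := slice M S) (fun a => ?_)
    (fun g a => ?_) (fun C x h => h.slice hS) (norm2u_slice_le hS) (B.bdd_tensor S hR) hsep
    (X := ⋃ N, ⋃ p, ⋃ q, (fun s => s ⊗ₜ[ℂ] θ N (Matrix.single p q 1)) '' S₀) ?_
    (fun x ε hε => exists_span_near B hmono hdense hS₀d x hε) fun F Y H ε hF hY hH hε => ?_
  · rw [tmulOneHom_apply, tensor_E_tmul, hS, one_smul]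
  · show tensorEquiv (γ.act g) (δ.act g) (a ⊗ₜ 1) = γ.act g a ⊗ₜ 1
    rw [tensorEquiv_tmul, map_one]
  · exact Set.countable_iUnion fun N => Set.countable_iUnion fun p =>
      Set.countable_iUnion fun q => hS₀.image _
  -- approximate the given elements by matrices over `M` at a common level `N`, and move these
  -- almost into `M`
  · choose N₀ hN₀ using fun y : M ⊗[ℂ] R =>
      exists_sum_tmul_near B hmono hdense y (show 0 < ε / 4 by positivity)
    obtain ⟨N, hN⟩ := (hY.image N₀).bddAbove
    have hN' : ∀ y ∈ Y, N₀ y ≤ N := fun y hy => hN ⟨y, hy, rfl⟩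
    choose! b hb using fun y (hy : y ∈ Y) => hN₀ y N (hN' y hy)
    obtain ⟨C, hC⟩ := hloc N
    obtain ⟨V, hV1, hV2, hV⟩ := exists_flip_unitary γ δ hS hR (hμ N) (θ N) (hθ N) hC hF
      (hY.image b) hH (show 0 < ε / 4 by positivity)
    refine ⟨V, hV1, hV2, fun a ha => ?_, fun y hy => ?_, fun g hg => ?_⟩
    · exact (norm2u_le_iff _ _ hε.le).2 fun k => ((hV k).1 a ha).trans (by linarith)
    · refine (norm2u_le_iff _ _ hε.le).2 fun k => ?_
      have h1 := (hV k).2.1 (b y) ⟨y, hy, rfl⟩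
      have h2 := ((B.toTracialExpectation.tensor S).norm2_le k _).trans (hb y hy)
      set y' := ∑ p, ∑ q, b y p q ⊗ₜ[ℂ] θ N (Matrix.single p q 1)
      refine (norm2_sub_slice_tmul_one_le B.toTracialExpectation hS k _
        (slice M S (star V * y' * V))).trans ?_
      have h3 := (B.toTracialExpectation.tensor S).norm2_sub_le_sub k (star V * y * V)
        (star V * y' * V) (slice M S (star V * y' * V) ⊗ₜ 1)
      have h4 : star V * y * V - star V * y' * V = star V * (y - y') * V := by noncomm_ring
      rw [h4, norm2_mul_unitary hV2, norm2_unitary_mul (by rw [star_star, hV2])] at h3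
      linarith
    · exact (norm2u_le_iff _ _ hε.le).2 fun k => ((hV k).2.2 g hg).trans (by linarith)

end Absorption

/-- McDuff fibers give global approximate matrix units of every size `M_d^{⊗ N}`, and hence the
absorption of `R`. -/
theorem isMcDuff_of_fiber {K : Type*} [TopologicalSpace K] [CompactSpace K]
    [TopologicalSpace.MetrizableSpace K] {M : Type*} [CStarAlgebra M] [PartialOrder M]
    [StarOrderedRing M] {B : WStarBundle K M} (hsep : B.StrictlySeparable) {n : ℕ}
    (hdim : CoveringDimLE K n) {G : Type*} [Group G] [Countable G] (γ : FiberwiseAction G B)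
    {d : ℕ} (hd : d ≠ 0) (ν : G →* Matrix.unitaryGroup (Fin d) ℂ)
    (h : ∀ k, IsMcDuff ν (γ.fiber k)) : IsMcDuff ν γ.toTracialAction := by
  have hμ : ∀ N g, repPow ν g N * star (repPow ν g N) = 1 := fun N g => by
    rw [repPow_star, ← repPow_mul, mul_inv_cancel, repPow_one]
  exact cocycleConjugate_tensor_of_approxUnits (θ := level d) (μ := fun N g => repPow ν g N) hsep γ
    (productTypeAction ν) (hyperfiniteTrace_one hd) (hyperfinite_bdd d) hμ
    (fun N g X => productTypeAction_level ν g N X) (fun N N' hN X => level_range_mono d hN X)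
    (fun r ε hε => exists_level_near d r hε) fun N =>
      LocallyApproximable.exists_approxUnits hdim (hμ N) fun k F H ε hF hH hε =>
        exists_approxUnits_of_fiber ν γ k (h k) N hF hH hε

end

end EquivariantBundle

open EquivariantBundle in
theorem mainTheorem6 {K : Type*} [TopologicalSpace K] [CompactSpace K]
    [TopologicalSpace.MetrizableSpace K]
    {M : Type*} [CStarAlgebra M] [PartialOrder M] [StarOrderedRing M]
    (B : WStarBundle K M) (hsep : B.StrictlySeparable) (hdim : ∃ n : ℕ, CoveringDimLE K n)
    {G : Type*} [Group G] [Countable G] (γ : FiberwiseAction G B)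
    {d : ℕ} (hd : 1 < d) (ν : G →* Matrix.unitaryGroup (Fin d) ℂ) :
    IsMcDuff ν γ.toTracialAction ↔ ∀ k : K, IsMcDuff ν (γ.fiber k) := by
  obtain ⟨n, hn⟩ := hdim
  exact ⟨fun h k => B.cocycleConjugate_fiber k (hyperfiniteTrace d) γ (hyperfinite_bdd d)
    (productTypeAction ν) h, isMcDuff_of_fiber hsep hn γ (by omega) ν⟩
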